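/- Notation. For $\xi\in\mathbf R^3$ let $v(\xi)=\xi/\sqrt{1+|\xi|^2}$, let $\Box_{t,x}=\partial_t^2-\Delta_x$, and let $(-\Delta_x)^{-1}\rho(x)=\int_{\mathbf R^3}\frac{\rho(y)}{4\pi|x-y|}\,dy$. Put $\rho_f(t,x)=\int_{\mathbf R^3} f(t,x,\xi)\,d\xi$ and $j_f(t,x)=\int_{\mathbf R^3} v(\xi)f(t,x,\xi)\,d\xi$. Let $T>0$, let $f\in C_c^\infty([0,T]\times\mathbf R^3\times\mathbf R^3)$ be real-valued, let $f^{in}=f|_{t=0}$ and $\phi^{in}=(-\Delta_x)^{-1}\int_{\mathbf R^3} f^{in}\,d\xi$, and let $\phi_0$ be the classical solution on $[0,T]\times\mathbf R^3$ of $$\Box_{t,x}\phi_0=0,\qquad \phi_0|_{t=0}=\phi^{in},\qquad \partial_t\phi_0|_{t=0}=0 .$$ Suppose that $(f,u)$, with $u=u(t,x,\xi)\in\mathbf R$, satisfies the scalar formulation of the Vlasov--Maxwell system on $[0,T]\times\mathbf R^3\times\mathbf R^3$: $$\partial_tf+v(\xi)\cdot\nabla_xf+(E+v(\xi)\wedge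 B)\cdot\nabla_\xi f=0,\qquad \Box_{t,x}u=f,$$ $$\phi=\phi_0+\int_{\mathbf R^3}u\,d\xi,\qquad A=\int_{\mathbf R^3}v(\xi)u\,d\xi,\qquad B=\operatorname{curl}_xA,\qquad E=-\partial_tA-\nabla_x\phi,$$ with initial data $f|_{t=0}=f^{in}$ and $u|_{t=0}=\partial_tu|_{t=0}=0$, where for each $\xi$ the function $u(\cdot,\cdot,\xi)$ is a classical solution of the wave equation. (A classical solution is of class $C^1$ on $[0,T]\times\mathbf R^3$, of class $C^2$ on $(0,T)\times\mathbf R^3$, and satisfies the equation on $(0,T)\times\mathbf R^3$ and the initial conditions at $t=0$. At $t=0$ and $t=T$ time derivatives are one-sided.) Then the integrals defining $\phi$ and $A$ converge absolutely, $\phi$ and $A$ are of class $C^\infty$ on $[0,T]\times\mathbf R^3$, and they satisfy the Lorentz gauge condition $$\partial_t\phi+\operatorname{div}_xA=0\quad\text{on }[0,T]\times\mathbf R^3 .$$ Moreover, $(f,E,B)$ is a $C^1$ solution on $[0,T]$ of the Vlasov--Maxwell system $$\partial_tf+v(\xi)\cdot\nabla_xf+(E+v(\xi)\wedge B)\cdot\nabla_\xi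 f=0,$$ $$\operatorname{div}_xB=0,\qquad \partial_tB+\operatorname{curl}_xE=0,\qquad \operatorname{div}_xE=\rho_f,\qquad \partial_tE-\operatorname{curl}_xB=-j_f,$$ with initial data $$f|_{t=0}=f^{in},\qquad E|_{t=0}=-\nabla_x\phi^{in}=-\nabla_x(-\Delta_x)^{-1}\int_{\mathbf R^3} f^{in}\,d\xi,\qquad B|_{t=0}=0 .$$ -/

import Mathlib

open Set MeasureTheory
open scoped ContDiff

noncomputable section

namespace VlasovMaxwell

/-- Euclidean space of dimension three, used for positions and for momenta. -/
abbrev E3 : Type := EuclideanSpace ℝ (Fin 3)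

/-! ### Differential operators -/

/-- The cross product of two vectors of Euclidean space. -/
def cross (a b : E3) : E3 := WithLp.toLp 2 (crossProduct a.ofLp b.ofLp)

/-- The partial derivative in the `i`-th space direction. -/
def partialDeriv (i : Fin 3) (g : E3 → ℝ) (x : E3) : ℝ :=
  fderiv ℝ g x (EuclideanSpace.single i 1)

/-- The divergence of a vector field. -/
def divergence (F : E3 → E3) (x : E3) : ℝ :=
  ∑ i : Fin 3, partialDeriv i (fun y => F y i) x

/-- The curl of a vector field. -/
def curl (F : E3 → E3) (x : E3) : E3 :=
  !₂[partialDeriv 1 (fun y => F y 2) x - partialDeriv 2 (fun y => F y 1) x,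
     partialDeriv 2 (fun y => F y 0) x - partialDeriv 0 (fun y => F y 2) x,
     partialDeriv 0 (fun y => F y 1) x - partialDeriv 1 (fun y => F y 0) x]

/-- The time derivative on the time interval `[0, T]` (one-sided at the two end points). -/
def timeDeriv {F : Type*} [NormedAddCommGroup F] [NormedSpace ℝ F]
    (T : ℝ) (w : ℝ → E3 → F) (t : ℝ) (x : E3) : F :=
  derivWithin (fun s => w s x) (Icc 0 T) t

/-- The d'Alembert operator `∂ₜ² - Δ`. -/
def dAlembert (T : ℝ) (w : ℝ → E3 → ℝ) (t : ℝ) (x : E3) : ℝ :=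
  timeDeriv T (timeDeriv T w) t x - Laplacian.laplacian (w t) x

/-- The closed slab `[0, T] × ℝ³`. -/
def slab (T : ℝ) : Set (ℝ × E3) := Icc 0 T ×ˢ univ

/-- The closed phase space slab `[0, T] × ℝ³ × ℝ³`. -/
def phaseSlab (T : ℝ) : Set (ℝ × E3 × E3) := Icc 0 T ×ˢ univ

/-! ### Kinetic quantities -/

/-- The relativistic velocity `v(ξ) = ξ / √(1 + |ξ|²)` of a particle of momentum `ξ`. -/
def velocity (ξ : E3) : E3 := (Real.sqrt (1 + ‖ξ‖ ^ 2))⁻¹ • ξ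

/-- The charge density `∫ f dξ` of a distribution function at a given time. -/
def chargeDensity (f : E3 → E3 → ℝ) (x : E3) : ℝ := ∫ ξ, f x ξ

/-- The current density `∫ v(ξ) f dξ` of a distribution function at a given time. -/
def currentDensity (f : E3 → E3 → ℝ) (x : E3) : E3 := ∫ ξ, f x ξ • velocity ξ

/-- The Newtonian potential `(-Δ)⁻¹ ρ`, i.e. the convolution of `ρ` with the fundamental
solution `1 / (4π|x|)` of `-Δ`. -/
def newtonPotential (ρ : E3 → ℝ) (x : E3) : ℝ :=
  ∫ y, (4 * Real.pi * ‖x - y‖)⁻¹ * ρ y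

/-- The space `C_c^∞([0, T] × ℝ³ × ℝ³)`: smooth up to the boundary of the slab, and vanishing on
the slab outside a compact set. The values for times outside `[0, T]` play no role. -/
structure IsSmoothCompactlySupported (T : ℝ) (f : ℝ → E3 → E3 → ℝ) : Prop where
  smooth : ContDiffOn ℝ ∞ (fun p : ℝ × E3 × E3 => f p.1 p.2.1 p.2.2) (phaseSlab T)
  support : ∃ K : Set (ℝ × E3 × E3), IsCompact K ∧
    ∀ p ∈ phaseSlab T, p ∉ K → f p.1 p.2.1 p.2.2 = 0

/-- The Vlasov equation `∂ₜf + v(ξ)·∇ₓf + (E + v(ξ) × B)·∇_ξ f = 0` on `[0, T] × ℝ³ × ℝ³`. -/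
def VlasovEquation (T : ℝ) (f : ℝ → E3 → E3 → ℝ) (E B : ℝ → E3 → E3) : Prop :=
  ∀ t ∈ Icc 0 T, ∀ x ξ : E3,
    timeDeriv T (fun s y => f s y ξ) t x
      + inner ℝ (velocity ξ) (gradient (fun y => f t y ξ) x)
      + inner ℝ (E t x + cross (velocity ξ) (B t x)) (gradient (fun η => f t x η) ξ) = 0

/-! ### The Cauchy problem for the wave equation -/

/-- `w` is a classical solution on `[0, T] × ℝ³` of the Cauchy problem `□w = h`, `w = w₀` and
`∂ₜw = w₁` at `t = 0`: it is `C¹` up to the boundary of the slab, `C²` in its interior, and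
satisfies the equation there. -/
structure IsWaveSolution (T : ℝ) (h : ℝ → E3 → ℝ) (w₀ w₁ : E3 → ℝ) (w : ℝ → E3 → ℝ) : Prop where
  contDiffOn_one : ContDiffOn ℝ 1 (fun p : ℝ × E3 => w p.1 p.2) (slab T)
  contDiffOn_two : ContDiffOn ℝ 2 (fun p : ℝ × E3 => w p.1 p.2) (Ioo 0 T ×ˢ univ)
  equation : ∀ t ∈ Ioo 0 T, ∀ x : E3, dAlembert T w t x = h t x
  initial : ∀ x : E3, w 0 x = w₀ x
  initial_timeDeriv : ∀ x : E3, timeDeriv T w 0 x = w₁ x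

/-! ### The scalar formulation -/

/-- The scalar potential `φ = φ₀ + ∫ u dξ`. -/
def scalarPotential (φ₀ : ℝ → E3 → ℝ) (u : ℝ → E3 → E3 → ℝ) (t : ℝ) (x : E3) : ℝ :=
  φ₀ t x + ∫ ξ, u t x ξ

/-- The vector potential `A = ∫ v(ξ) u dξ`. -/
def vectorPotential (u : ℝ → E3 → E3 → ℝ) (t : ℝ) (x : E3) : E3 :=
  ∫ ξ, u t x ξ • velocity ξ

/-- The electric field `E = -∂ₜA - ∇φ` of an electromagnetic potential. -/
def electricField (T : ℝ) (φ : ℝ → E3 → ℝ) (A : ℝ → E3 → E3) (t : ℝ) (x : E3) : E3 :=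
  -timeDeriv T A t x - gradient (φ t) x

/-- The magnetic field `B = curl A` of an electromagnetic potential. -/
def magneticField (A : ℝ → E3 → E3) (t : ℝ) (x : E3) : E3 :=
  curl (A t) x

/-- `(f, u)` satisfies the scalar formulation of the Vlasov-Maxwell system on `[0, T]` with
initial data `f = fin`, `u = ∂ₜu = 0` at `t = 0`, where `φ₀` is the free part of the scalar
potential. For each momentum, `u` is a classical solution of the wave equation in the time and
position variables; no regularity of `u` in the momentum variable is required. -/
structure IsScalarSolution (T : ℝ) (fin : E3 → E3 → ℝ) (φ₀ : ℝ → E3 → ℝ)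
    (f u : ℝ → E3 → E3 → ℝ) : Prop where
  vlasov : VlasovEquation T f
    (electricField T (scalarPotential φ₀ u) (vectorPotential u))
    (magneticField (vectorPotential u))
  wave : ∀ ξ : E3, IsWaveSolution T (fun t x => f t x ξ) (fun _ => 0) (fun _ => 0)
    (fun t x => u t x ξ)
  initial : ∀ x ξ : E3, f 0 x ξ = fin x ξ

/-! ### The Vlasov-Maxwell system -/

/-- `(f, E, B)` is a classical solution of the Vlasov-Maxwell system on `[0, T]`. -/
structure IsVlasovMaxwellSolution (T : ℝ) (f : ℝ → E3 → E3 → ℝ) (E B : ℝ → E3 → E3) : Prop where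
  contDiffOn_f : ContDiffOn ℝ 1 (fun p : ℝ × E3 × E3 => f p.1 p.2.1 p.2.2) (phaseSlab T)
  contDiffOn_E : ContDiffOn ℝ 1 (fun p : ℝ × E3 => E p.1 p.2) (slab T)
  contDiffOn_B : ContDiffOn ℝ 1 (fun p : ℝ × E3 => B p.1 p.2) (slab T)
  vlasov : VlasovEquation T f E B
  div_B : ∀ t ∈ Icc 0 T, ∀ x : E3, divergence (B t) x = 0
  faraday : ∀ t ∈ Icc 0 T, ∀ x : E3, timeDeriv T B t x + curl (E t) x = 0
  gauss : ∀ t ∈ Icc 0 T, ∀ x : E3, divergence (E t) x = chargeDensity (f t) x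
  ampere : ∀ t ∈ Icc 0 T, ∀ x : E3,
    timeDeriv T E t x - curl (B t) x = -currentDensity (f t) x

/-- The initial condition `f = fin`, `E = -∇(-Δ)⁻¹ ∫ fin dξ`, `B = 0` at `t = 0`. -/
structure HasElectrostaticInitialData (fin : E3 → E3 → ℝ) (f : ℝ → E3 → E3 → ℝ)
    (E B : ℝ → E3 → E3) : Prop where
  initial_f : ∀ x ξ : E3, f 0 x ξ = fin x ξ
  initial_E : ∀ x : E3, E 0 x = -gradient (newtonPotential (chargeDensity fin)) x
  initial_B : ∀ x : E3, B 0 x = 0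

end VlasovMaxwell

end

open VlasovMaxwell

/-! The scalar formulation can be solved explicitly. Let $Dh$ be the solution of $\Box w=h$ with
zero Cauchy data, given by the retarded potential. Uniqueness of classical solutions yields
$u(\cdot,\cdot,\xi)=D[f(\cdot,\cdot,\xi)]$ for each $\xi$, so the dependence of $u$ on $\xi$, about
which nothing is assumed, is inherited from $f$. By Fubini, $\int u\,d\xi=D\rho_f$ and
$A_i=D(j_f)_i$. The Newtonian potential $\phi^{in}$, viewed as a static function on space-time,
satisfies $\Box\phi^{in}=\rho_{f^{in}}$, whence $\phi_0=\phi^{in}-D\rho_{f^{in}}$ by uniqueness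
again. Thus $\phi$ and $A$ are smooth up to the boundary and satisfy $\Box\phi=\rho_f$, $\Box A=j_f$
on the closed slab.

Let $G=\partial_t\phi+\operatorname{div}A$. Then $\Box G=\partial_t\rho_f+\operatorname{div}j_f=0$,
the integral over $\xi$ of the Vlasov equation: the Lorentz force is divergence-free in $\xi$,
because $v=\nabla_\xi\sqrt{1+|\xi|^2}$ is a gradient (`continuity_equation`). At $t=0$, $G=0$ and
$\partial_tG=\Delta\phi^{in}+\rho_{f^{in}}=0$, so $G=0$ by uniqueness (`slabGauge_eq_zero`).
Maxwell's equations are then vector calculus: $\operatorname{div}B=0$ and Faraday's law hold for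
every potential, Gauss's and Ampère's laws follow from the wave equations and the gauge.

Two analytic facts carry this. The first is that $D$ inverts $\Box$ for a source that is only smooth
up to the boundary of the slab. Scaling the light cone to the unit ball writes $Dh$ as an integral
over a fixed domain, with argument linear in $(t,x)$, hence smooth up to the boundary. The equation
comes from the identity "the retarded potential of $\Box k$ is $k$" (`integral_retarded_waveOp`),
proved by applying the divergence theorem on the smooth cones $s=t-\sqrt{\varepsilon^2+|y|^2}$ and
letting $\varepsilon\to0$. It is applied to $k=\eta h$ with a time cut-off $\eta$, and integrated
twice in time so that no derivative of $\eta$ remains when $\eta\to1$ (`duhamel_cutoff_eq`,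
`duhamel_eq_integral`). The same identity for static $k$ gives $-\Delta(-\Delta)^{-1}\rho=\rho$.

The second is uniqueness (`IsWaveSolution.eq_zero`), by an energy estimate with a smooth weight that
decreases in time faster than it varies in space. -/

open VlasovMaxwell
open Filter Topology Metric

namespace VlasovMaxwell

/-! ### Differentiation under the integral sign within a convex set -/

section ParametricIntegral

variable {P P' G G' α : Type} [NormedAddCommGroup P] [NormedSpace ℝ P]
  [NormedAddCommGroup P'] [NormedSpace ℝ P'] [NormedAddCommGroup G] [NormedSpace ℝ G]
  [NormedAddCommGroup G'] [NormedSpace ℝ G']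

/-- Dominated convergence for difference quotients. Only derivatives within `s` are at hand, and
convexity is what bounds the quotients: the mean value inequality holds along the segment from `p`
to `q`, which stays in `s`. -/
theorem hasFDerivWithinAt_integral_of_dominated [CompleteSpace G'] [MeasurableSpace α]
    {μ : Measure α} {s : Set P} (hs : Convex ℝ s) {F : P → α → G'} {F' : P → α → P →L[ℝ] G'} {b : α → ℝ}
    (hF : ∀ p ∈ s, Integrable (F p) μ)
    (hd : ∀ᵐ a ∂μ, ∀ p ∈ s, HasFDerivWithinAt (fun q => F q a) (F' p a) s p)
    (hb : ∀ᵐ a ∂μ, ∀ p ∈ s, ‖F' p a‖ ≤ b a) (hbi : Integrable b μ)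
    {p : P} (hp : p ∈ s) (hF' : AEStronglyMeasurable (F' p) μ) :
    HasFDerivWithinAt (fun q => ∫ a, F q a ∂μ) (∫ a, F' p a ∂μ) s p := by
  have hi : Integrable (F' p) μ := hbi.mono' hF' (hb.mono fun a ha => ha p hp)
  rw [hasFDerivWithinAt_iff_tendsto]
  have key : ∀ᶠ q in 𝓝[s] p,
      ‖q - p‖⁻¹ * ‖(∫ a, F q a ∂μ) - (∫ a, F p a ∂μ) - (∫ a, F' p a ∂μ) (q - p)‖ =
      ‖∫ a, ‖q - p‖⁻¹ • (F q a - F p a - F' p a (q - p)) ∂μ‖ := by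
    filter_upwards [self_mem_nhdsWithin] with q hq
    have e := integral_sub ((hF q hq).sub (hF p hp)) (hi.apply_continuousLinearMap (q - p))
    simp only [Pi.sub_apply] at e
    rw [integral_smul, norm_smul_of_nonneg (inv_nonneg.2 (norm_nonneg _)), e,
      integral_sub (hF q hq) (hF p hp), ContinuousLinearMap.integral_apply hi]
  rw [tendsto_congr' key, ← tendsto_zero_iff_norm_tendsto_zero, ← integral_zero α G' (μ := μ)]
  apply tendsto_integral_filter_of_dominated_convergence (bound := fun a => b a + ‖F' p a‖)
  · filter_upwards [self_mem_nhdsWithin] with q hq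
    exact (((hF q hq).sub (hF p hp)).sub (hi.apply_continuousLinearMap _)).aestronglyMeasurable
      |>.const_smul _
  · filter_upwards [self_mem_nhdsWithin] with q hq
    filter_upwards [hd, hb] with a had hab
    have hlip : ‖F q a - F p a‖ ≤ b a * ‖q - p‖ :=
      hs.norm_image_sub_le_of_norm_hasFDerivWithin_le had hab hp hq
    have h2 : ‖F q a - F p a - F' p a (q - p)‖ ≤ (b a + ‖F' p a‖) * ‖q - p‖ :=
      (norm_sub_le _ _).trans (by nlinarith [(F' p a).le_opNorm (q - p)])
    rw [norm_smul, norm_inv, norm_norm]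
    have hb0 : 0 ≤ b a + ‖F' p a‖ :=
      add_nonneg ((norm_nonneg _).trans (hab p hp)) (norm_nonneg _)
    rcases (norm_nonneg (q - p)).eq_or_lt with h | h
    · rw [← h]; simpa using hb0
    · rw [inv_mul_le_iff₀ h, mul_comm]; exact h2
  · exact hbi.add hi.norm
  · filter_upwards [hd] with a had
    have h := hasFDerivWithinAt_iff_tendsto.1 (had p hp)
    rw [tendsto_zero_iff_norm_tendsto_zero]
    refine h.congr fun q => ?_
    rw [norm_smul_of_nonneg (inv_nonneg.2 (norm_nonneg _))]

/-- Smoothness on `s` together with vanishing on `s` outside a compact set. -/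
structure IsTestOn (s : Set P) (h : P → G) : Prop where
  smooth : ContDiffOn ℝ ∞ h s
  support : ∃ K : Set P, IsCompact K ∧ ∀ p ∈ s, p ∉ K → h p = 0

theorem IsTestOn.exists_bound {s : Set P} {h : P → G} (hh : IsTestOn s h) (hs : IsClosed s) :
    ∃ C, ∀ p ∈ s, ‖h p‖ ≤ C := by
  obtain ⟨K, hK, h0⟩ := hh.support
  obtain ⟨C, hC⟩ := (hK.inter_right hs).exists_bound_of_continuousOn
    (hh.smooth.continuousOn.mono inter_subset_right)
  refine ⟨max C 0, fun p hp => ?_⟩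
  by_cases hpK : p ∈ K
  · exact (hC p ⟨hpK, hp⟩).trans (le_max_left _ _)
  · simp [h0 p hp hpK]

theorem IsTestOn.isTestOn_fderivWithin {s : Set P} {h : P → G} (hh : IsTestOn s h)
    (hs : UniqueDiffOn ℝ s) : IsTestOn s (fderivWithin ℝ h s) := by
  obtain ⟨K, hK, h0⟩ := hh.support
  refine ⟨hh.smooth.fderivWithin hs (by simp), K, hK, fun p hp hpK => ?_⟩
  have : h =ᶠ[𝓝[s] p] fun _ => 0 := by
    filter_upwards [self_mem_nhdsWithin,
      mem_nhdsWithin_of_mem_nhds (hK.isClosed.isOpen_compl.mem_nhds hpK)] with q hq hqK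
    exact h0 q hq hqK
  rw [this.fderivWithin_eq (h0 p hp hpK)]
  simp

theorem IsTestOn.comp_clm {s : Set P} {h : P → G} (hh : IsTestOn s h) (L : G →L[ℝ] G') :
    IsTestOn s (fun p => L (h p)) := by
  obtain ⟨K, hK, h0⟩ := hh.support
  exact ⟨L.contDiff.comp_contDiffOn hh.smooth, K, hK, fun p hp hpK => by simp [h0 p hp hpK]⟩

theorem IsTestOn.add {s : Set P} {g h : P → G} (hg : IsTestOn s g) (hh : IsTestOn s h) :
    IsTestOn s (fun p => g p + h p) := by
  obtain ⟨K, hK, h0⟩ := hh.support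
  obtain ⟨L, hL, g0⟩ := hg.support
  exact ⟨hg.smooth.add hh.smooth, K ∪ L, hK.union hL, fun p hp hpK => by
    simp only [mem_union, not_or] at hpK
    simp [h0 p hp hpK.1, g0 p hp hpK.2]⟩

theorem IsTestOn.smooth_smul {s : Set P} {h : P → G} (hh : IsTestOn s h) {c : P → ℝ}
    (hc : ContDiffOn ℝ ∞ c s) : IsTestOn s (fun p => c p • h p) := by
  obtain ⟨K, hK, h0⟩ := hh.support
  exact ⟨hc.smul hh.smooth, K, hK, fun p hp hpK => by simp [h0 p hp hpK]⟩

variable [TopologicalSpace α] [SecondCountableTopology α] [MeasurableSpace α]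
  [OpensMeasurableSpace α] {μ : Measure α} {A : Set α} {s : Set P} {s' : Set P'}
  {h : P' → G} {Λ : α → P →L[ℝ] P'} {c : α → P'} {C : ℝ} {W : α → G →L[ℝ] G'}

theorem IsTestOn.aestronglyMeasurable_comp (hA : MeasurableSet A) (hh : ContinuousOn h s')
    (hΛ : ContinuousOn Λ A) (hc : ContinuousOn c A)
    (hmap : ∀ a ∈ A, ∀ p ∈ s, Λ a p + c a ∈ s') {p : P} (hp : p ∈ s) :
    AEStronglyMeasurable (fun a => h (Λ a p + c a)) (μ.restrict A) := by
  refine ContinuousOn.aestronglyMeasurable (hh.comp (t := s') (?_) fun a ha => hmap a ha p hp) hA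
  exact (hΛ.clm_apply continuousOn_const).add hc

theorem IsTestOn.integrableOn_comp (hA : MeasurableSet A) (hs' : IsClosed s')
    (hh : IsTestOn s' h) (hΛ : ContinuousOn Λ A) (hc : ContinuousOn c A)
    (hmap : ∀ a ∈ A, ∀ p ∈ s, Λ a p + c a ∈ s') (hW : IntegrableOn W A μ) {p : P} (hp : p ∈ s) :
    IntegrableOn (fun a => W a (h (Λ a p + c a))) A μ := by
  obtain ⟨M, hM⟩ := hh.exists_bound hs'
  refine Integrable.mono' (hW.norm.mul_const M) ?_ ?_
  · exact (ContinuousLinearMap.apply ℝ G').flip.aestronglyMeasurable_comp₂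
      hW.aestronglyMeasurable
      (aestronglyMeasurable_comp hA hh.smooth.continuousOn hΛ hc hmap hp)
  · filter_upwards [ae_restrict_mem hA] with a ha
    exact ((W a).le_opNorm _).trans
      (mul_le_mul_of_nonneg_left (hM _ (hmap a ha p hp)) (norm_nonneg _))

set_option maxSynthPendingDepth 5 in
-- Differentiating `W a (h (Λ a p + c a))` in `p` gives `W a ∘ Dh ∘ Λ a`, which is again a weight
-- applied to a test function, namely to `Dh`. The new weight `L ↦ W a ∘ L ∘ Λ a` is integrable
-- because `Λ` is bounded on `A`.
theorem integrableOn_clm_comp_weight (hA : MeasurableSet A) (hΛ : ContinuousOn Λ A)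
    (hC : ∀ a ∈ A, ‖Λ a‖ ≤ C) (hW : IntegrableOn W A μ) :
    IntegrableOn (fun a => ((ContinuousLinearMap.compL ℝ P G G' (W a)).comp
      ((ContinuousLinearMap.compL ℝ P P' G).flip (Λ a)))) A μ := by
  refine Integrable.mono' ((hW.norm.mul_const C)) ?_ ?_
  · refine (ContinuousLinearMap.compL ℝ (P' →L[ℝ] G) (P →L[ℝ] G)
      (P →L[ℝ] G')).aestronglyMeasurable_comp₂ ?_ ?_
    · exact (ContinuousLinearMap.compL ℝ P G G').continuous.comp_aestronglyMeasurable
        hW.aestronglyMeasurable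
    · exact (ContinuousLinearMap.compL ℝ P P' G).flip.continuous.comp_aestronglyMeasurable
        (hΛ.aestronglyMeasurable hA)
  · filter_upwards [ae_restrict_mem hA] with a ha
    refine ContinuousLinearMap.opNorm_le_bound _
      (mul_nonneg (norm_nonneg _) ((norm_nonneg _).trans (hC a ha))) fun L => ?_
    calc ‖(W a).comp (L.comp (Λ a))‖ ≤ ‖W a‖ * (‖L‖ * ‖Λ a‖) :=
          (ContinuousLinearMap.opNorm_comp_le _ _).trans
            (mul_le_mul_of_nonneg_left (ContinuousLinearMap.opNorm_comp_le _ _) (norm_nonneg _))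
      _ ≤ ‖W a‖ * (‖L‖ * C) := by gcongr; exact hC a ha
      _ = ‖W a‖ * C * ‖L‖ := by ring

theorem IsTestOn.hasFDerivWithinAt_integral [CompleteSpace G'] (hA : MeasurableSet A) (hs : Convex ℝ s)
    (hs' : IsClosed s') (hu : UniqueDiffOn ℝ s') (hh : IsTestOn s' h) (hΛ : ContinuousOn Λ A)
    (hc : ContinuousOn c A) (hC : ∀ a ∈ A, ‖Λ a‖ ≤ C)
    (hmap : ∀ a ∈ A, ∀ p ∈ s, Λ a p + c a ∈ s') (hW : IntegrableOn W A μ) {p : P} (hp : p ∈ s) :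
    HasFDerivWithinAt (fun q => ∫ a in A, W a (h (Λ a q + c a)) ∂μ)
      (∫ a in A, (W a).comp ((fderivWithin ℝ h s' (Λ a p + c a)).comp (Λ a)) ∂μ) s p := by
  have hh' := hh.isTestOn_fderivWithin hu
  obtain ⟨M, hM⟩ := hh'.exists_bound hs'
  refine hasFDerivWithinAt_integral_of_dominated hs (b := fun a => ‖W a‖ * (M * C))
    (F := fun q a => W a (h (Λ a q + c a)))
    (F' := fun q a => (W a).comp ((fderivWithin ℝ h s' (Λ a q + c a)).comp (Λ a)))
    (fun q hq => hh.integrableOn_comp hA hs' hΛ hc hmap hW hq) ?_ ?_ (hW.norm.mul_const _) hp ?_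
  · filter_upwards [ae_restrict_mem hA] with a ha q hq
    have h1 : HasFDerivWithinAt h (fderivWithin ℝ h s' (Λ a q + c a)) s' (Λ a q + c a) :=
      (hh.smooth.differentiableOn (by simp) _ (hmap a ha q hq)).hasFDerivWithinAt
    have h2 : HasFDerivWithinAt (fun q => Λ a q + c a) (Λ a) s q :=
      ((Λ a).hasFDerivAt.add_const (c a)).hasFDerivWithinAt
    exact (W a).hasFDerivAt.comp_hasFDerivWithinAt q
      (h1.comp q h2 fun q hq => hmap a ha q hq)
  · filter_upwards [ae_restrict_mem hA] with a ha q hq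
    have hM0 := hM _ (hmap a ha q hq)
    have := hC a ha
    refine (ContinuousLinearMap.opNorm_comp_le _ _).trans
      (mul_le_mul_of_nonneg_left ?_ (norm_nonneg _))
    refine (ContinuousLinearMap.opNorm_comp_le _ _).trans ?_
    exact mul_le_mul hM0 this (norm_nonneg _) ((norm_nonneg _).trans hM0)
  · exact (hh'.integrableOn_comp hA hs' hΛ hc hmap
      (integrableOn_clm_comp_weight hA hΛ hC hW) hp).aestronglyMeasurable

end ParametricIntegral

/-- Integrals of this form are stable under differentiation: `h` becomes its derivative and the
weight becomes that of `integrableOn_clm_comp_weight`. The target spaces change at each step, which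
is why weights are operator-valued and `G`, `G'` are quantified inside the induction. -/
theorem IsTestOn.contDiffOn_integral_nat {P P' α : Type} [NormedAddCommGroup P] [NormedSpace ℝ P]
    [NormedAddCommGroup P'] [NormedSpace ℝ P']
    [TopologicalSpace α] [SecondCountableTopology α] [MeasurableSpace α]
    [OpensMeasurableSpace α] {μ : Measure α} {A : Set α} {s : Set P} {s' : Set P'}
    {Λ : α → P →L[ℝ] P'} {c : α → P'} {C : ℝ}
    (hA : MeasurableSet A) (hs : Convex ℝ s) (hsu : UniqueDiffOn ℝ s)
    (hs' : IsClosed s') (hu : UniqueDiffOn ℝ s') (hΛ : ContinuousOn Λ A)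
    (hc : ContinuousOn c A) (hC : ∀ a ∈ A, ‖Λ a‖ ≤ C)
    (hmap : ∀ a ∈ A, ∀ p ∈ s, Λ a p + c a ∈ s') (n : ℕ) :
    ∀ {G G' : Type} [NormedAddCommGroup G] [NormedSpace ℝ G]
    [NormedAddCommGroup G'] [NormedSpace ℝ G'] [CompleteSpace G'] {h : P' → G}
    {W : α → G →L[ℝ] G'}, IsTestOn s' h → IntegrableOn W A μ →
    ContDiffOn ℝ n (fun q => ∫ a in A, W a (h (Λ a q + c a)) ∂μ) s := by
  induction n with
  | zero =>
    intro G G' _ _ _ _ _ h W hh hW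
    exact contDiffOn_zero.2 fun p hp =>
      (hh.hasFDerivWithinAt_integral hA hs hs' hu hΛ hc hC hmap hW hp).continuousWithinAt
  | succ n ih =>
    intro G G' _ _ _ _ _ h W hh hW
    have hd := fun p hp => hh.hasFDerivWithinAt_integral hA hs hs' hu hΛ hc hC hmap hW (p := p) hp
    push_cast
    refine (contDiffOn_succ_iff_fderivWithin hsu).2
      ⟨fun p hp => (hd p hp).differentiableWithinAt, by simp, ?_⟩
    refine (ih (hh.isTestOn_fderivWithin hu) (integrableOn_clm_comp_weight hA hΛ hC hW)).congr
      fun p hp => ?_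
    exact (hd p hp).fderivWithin (hsu p hp)

/-- Smoothness of integrals with a scalar weight of a test function along affine maps. -/
theorem IsTestOn.contDiffOn_integral {P P' G α : Type} [NormedAddCommGroup P] [NormedSpace ℝ P]
    [NormedAddCommGroup P'] [NormedSpace ℝ P'] [NormedAddCommGroup G] [NormedSpace ℝ G]
    [CompleteSpace G]
    [TopologicalSpace α] [SecondCountableTopology α] [MeasurableSpace α]
    [OpensMeasurableSpace α] {μ : Measure α} {A : Set α} {s : Set P} {s' : Set P'}
    {Λ : α → P →L[ℝ] P'} {c : α → P'} {C : ℝ}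
    (hA : MeasurableSet A) (hs : Convex ℝ s) (hsu : UniqueDiffOn ℝ s)
    (hs' : IsClosed s') (hu : UniqueDiffOn ℝ s') (hΛ : ContinuousOn Λ A)
    (hc : ContinuousOn c A) (hC : ∀ a ∈ A, ‖Λ a‖ ≤ C)
    (hmap : ∀ a ∈ A, ∀ p ∈ s, Λ a p + c a ∈ s') {h : P' → G} (hh : IsTestOn s' h)
    {w : α → ℝ} (hw : IntegrableOn w A μ) :
    ContDiffOn ℝ ∞ (fun q => ∫ a in A, w a • h (Λ a q + c a) ∂μ) s ∧
    ∀ p ∈ s, ∀ v, fderivWithin ℝ (fun q => ∫ a in A, w a • h (Λ a q + c a) ∂μ) s p v =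
      ∫ a in A, w a • (fderivWithin ℝ h s' (Λ a p + c a) (Λ a v)) ∂μ := by
  have hW : IntegrableOn (fun a => w a • ContinuousLinearMap.id ℝ G) A μ := hw.smul_const _
  refine ⟨contDiffOn_infty.2 fun n =>
    IsTestOn.contDiffOn_integral_nat hA hs hsu hs' hu hΛ hc hC hmap n hh hW, fun p hp v => ?_⟩
  have := (hh.hasFDerivWithinAt_integral hA hs hs' hu hΛ hc hC hmap hW hp).fderivWithin (hsu p hp)
  simp only [_root_.smul_apply, ContinuousLinearMap.id_apply] at this
  rw [this, ContinuousLinearMap.integral_apply]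
  · simp
  · exact (hh.isTestOn_fderivWithin hu).integrableOn_comp hA hs' hΛ hc hmap
      (integrableOn_clm_comp_weight hA hΛ hC hW) hp

end VlasovMaxwell

namespace VlasovMaxwell

/-! ### Directional derivatives on the slab -/

section SlabCalculus

variable {T : ℝ} {g h : ℝ × E3 → ℝ} {p : ℝ × E3}

theorem convex_slab (T : ℝ) : Convex ℝ (slab T) := (convex_Icc 0 T).prod convex_univ

theorem isClosed_slab (T : ℝ) : IsClosed (slab T) := isClosed_Icc.prod isClosed_univ

theorem uniqueDiffOn_slab (hT : 0 < T) : UniqueDiffOn ℝ (slab T) :=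
  (uniqueDiffOn_Icc hT).prod uniqueDiffOn_univ

theorem mem_slab {t : ℝ} (ht : t ∈ Icc 0 T) (x : E3) : (t, x) ∈ slab T := ⟨ht, mem_univ _⟩

/-- The unit vector of the time direction. -/
noncomputable def timeDir : ℝ × E3 := (1, 0)

/-- The unit vectors of the space directions. -/
noncomputable def spaceDir (i : Fin 3) : ℝ × E3 := (0, EuclideanSpace.single i 1)

/-- The derivative in the direction `v`, within the slab. -/
noncomputable def slabDeriv (T : ℝ) (v : ℝ × E3) (g : ℝ × E3 → ℝ) (p : ℝ × E3) : ℝ :=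
  fderivWithin ℝ g (slab T) p v

/-- The Laplacian in space, computed within the slab. -/
noncomputable def slabLaplacian (T : ℝ) (g : ℝ × E3 → ℝ) (p : ℝ × E3) : ℝ :=
  ∑ i, slabDeriv T (spaceDir i) (slabDeriv T (spaceDir i) g) p

theorem contDiffOn_slabDeriv (hT : 0 < T) (hg : ContDiffOn ℝ ∞ g (slab T)) (v : ℝ × E3) :
    ContDiffOn ℝ ∞ (slabDeriv T v g) (slab T) :=
  (hg.fderivWithin (uniqueDiffOn_slab hT) (by simp)).clm_apply contDiffOn_const

theorem contDiffOn_slabLaplacian (hT : 0 < T) (hg : ContDiffOn ℝ ∞ g (slab T)) :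
    ContDiffOn ℝ ∞ (slabLaplacian T g) (slab T) :=
  ContDiffOn.sum fun _ _ => contDiffOn_slabDeriv hT (contDiffOn_slabDeriv hT hg _) _

theorem IsTestOn.slabDeriv (hT : 0 < T) (hg : IsTestOn (slab T) g) (v : ℝ × E3) :
    IsTestOn (slab T) (slabDeriv T v g) :=
  (hg.isTestOn_fderivWithin (uniqueDiffOn_slab hT)).comp_clm (ContinuousLinearMap.apply ℝ ℝ v)

theorem IsTestOn.slabLaplacian (hT : 0 < T) (hg : IsTestOn (slab T) g) :
    IsTestOn (slab T) (slabLaplacian T g) := by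
  have h := fun i => (hg.slabDeriv hT (spaceDir i)).slabDeriv hT (spaceDir i)
  have := ((h 0).add (h 1)).add (h 2)
  refine (funext fun p => ?_ : VlasovMaxwell.slabLaplacian T g = _) ▸ this
  rw [VlasovMaxwell.slabLaplacian, Fin.sum_univ_three]

theorem slabDeriv_congr (hgh : EqOn g h (slab T)) (hp : p ∈ slab T) (v : ℝ × E3) :
    slabDeriv T v g p = slabDeriv T v h p := by
  rw [slabDeriv, slabDeriv, fderivWithin_congr hgh (hgh hp)]

theorem slabDeriv_add (hT : 0 < T) (hg : DifferentiableOn ℝ g (slab T))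
    (hh : DifferentiableOn ℝ h (slab T)) (v : ℝ × E3) (hp : p ∈ slab T) :
    slabDeriv T v (fun q => g q + h q) p = slabDeriv T v g p + slabDeriv T v h p := by
  rw [slabDeriv, fderivWithin_fun_add (uniqueDiffOn_slab hT p hp) (hg p hp) (hh p hp)]; rfl

theorem slabDeriv_sub (hT : 0 < T) (hg : DifferentiableOn ℝ g (slab T))
    (hh : DifferentiableOn ℝ h (slab T)) (v : ℝ × E3) (hp : p ∈ slab T) :
    slabDeriv T v (fun q => g q - h q) p = slabDeriv T v g p - slabDeriv T v h p := by
  rw [slabDeriv, fderivWithin_fun_sub (uniqueDiffOn_slab hT p hp) (hg p hp) (hh p hp)]; rfl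

theorem slabDeriv_neg (hT : 0 < T) (v : ℝ × E3) (hp : p ∈ slab T) :
    slabDeriv T v (fun q => -g q) p = -slabDeriv T v g p := by
  rw [slabDeriv, fderivWithin_fun_neg (uniqueDiffOn_slab hT p hp)]; rfl

theorem slabDeriv_sum (hT : 0 < T) {ι : Type} {s : Finset ι} {G : ι → ℝ × E3 → ℝ}
    (hG : ∀ i ∈ s, DifferentiableOn ℝ (G i) (slab T)) (v : ℝ × E3) (hp : p ∈ slab T) :
    slabDeriv T v (fun q => ∑ i ∈ s, G i q) p = ∑ i ∈ s, slabDeriv T v (G i) p := by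
  rw [slabDeriv, fderivWithin_fun_sum (uniqueDiffOn_slab hT p hp) fun i hi => hG i hi p hp]
  simp [slabDeriv]

theorem slab_subset_closure_interior (hT : 0 < T) : slab T ⊆ closure (interior (slab T)) := by
  rw [slab, interior_prod_eq, closure_prod_eq, interior_Icc, closure_Ioo hT.ne]
  simp

/-- Symmetry of second derivatives persists at the boundary because the slab lies in the closure of
its interior. -/
theorem slabDeriv_comm (hT : 0 < T) (hg : ContDiffOn ℝ ∞ g (slab T)) (v w : ℝ × E3)
    (hp : p ∈ slab T) :
    slabDeriv T v (slabDeriv T w g) p = slabDeriv T w (slabDeriv T v g) p := by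
  have hd : DifferentiableWithinAt ℝ (fderivWithin ℝ g (slab T)) (slab T) p :=
    (hg.fderivWithin (uniqueDiffOn_slab hT) (m := ∞) (by simp)).differentiableOn (by simp) p hp
  have key : ∀ v w : ℝ × E3, slabDeriv T v (slabDeriv T w g) p =
      fderivWithin ℝ (fderivWithin ℝ g (slab T)) (slab T) p v w := by
    intro v w
    have h1 : HasFDerivWithinAt (slabDeriv T w g) _ (slab T) p :=
      hd.hasFDerivWithinAt.clm_apply (hasFDerivWithinAt_const w p _)
    rw [slabDeriv, h1.fderivWithin (uniqueDiffOn_slab hT p hp)]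
    simp
  rw [key, key]
  exact ((hg p hp).isSymmSndFDerivWithinAt (by simpa using ENat.LEInfty.out) (uniqueDiffOn_slab hT)
    (slab_subset_closure_interior hT hp) hp) v w

theorem hasDerivWithinAt_slabDeriv (hg : DifferentiableOn ℝ g (slab T)) {t : ℝ}
    (ht : t ∈ Icc 0 T) (x : E3) :
    HasDerivWithinAt (fun s => g (s, x)) (slabDeriv T timeDir g (t, x)) (Icc 0 T) t := by
  have h1 := (hg _ (mem_slab ht x)).hasFDerivWithinAt
  have h2 : HasDerivWithinAt (fun s : ℝ => (s, x)) timeDir (Icc 0 T) t :=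
    ((hasDerivAt_id t).prodMk (hasDerivAt_const t x)).hasDerivWithinAt
  exact h1.comp_hasDerivWithinAt t h2 fun s hs => mem_slab hs x

theorem hasFDerivAt_slice (hg : DifferentiableOn ℝ g (slab T)) {t : ℝ}
    (ht : t ∈ Icc 0 T) (x : E3) :
    HasFDerivAt (fun y => g (t, y))
      ((fderivWithin ℝ g (slab T) (t, x)).comp (ContinuousLinearMap.inr ℝ ℝ E3)) x := by
  have h1 := (hg _ (mem_slab ht x)).hasFDerivWithinAt
  have h2 : HasFDerivWithinAt (fun y : E3 => (t, y)) (ContinuousLinearMap.inr ℝ ℝ E3) univ x :=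
    (hasFDerivAt_prodMk_right t x).hasFDerivWithinAt
  exact hasFDerivWithinAt_univ.1 (h1.comp x h2 fun y _ => mem_slab ht y)

theorem partialDeriv_slice (hg : DifferentiableOn ℝ g (slab T)) {t : ℝ}
    (ht : t ∈ Icc 0 T) (x : E3) (i : Fin 3) :
    partialDeriv i (fun y => g (t, y)) x = slabDeriv T (spaceDir i) g (t, x) := by
  rw [partialDeriv, (hasFDerivAt_slice hg ht x).fderiv]; rfl

theorem gradient_apply (q : E3 → ℝ) (x : E3) (i : Fin 3) :
    gradient q x i = partialDeriv i q x := by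
  rw [gradient, partialDeriv]
  have := InnerProductSpace.toDual_symm_apply (𝕜 := ℝ) (E := E3) (x := EuclideanSpace.single i 1)
    (y := fderiv ℝ q x)
  rw [← this, EuclideanSpace.inner_single_right]
  simp

theorem laplacian_eq_sum_partialDeriv {q : E3 → ℝ} {x : E3} (hq : ContDiffAt ℝ 2 q x) :
    Laplacian.laplacian q x = ∑ i, partialDeriv i (partialDeriv i q) x := by
  rw [InnerProductSpace.laplacian_eq_iteratedFDeriv_orthonormalBasis q
    (EuclideanSpace.basisFun (Fin 3) ℝ)]
  refine Finset.sum_congr rfl fun i _ => ?_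
  have hd : DifferentiableAt ℝ (fderiv ℝ q) x :=
    (hq.fderiv_right (m := 1) (by norm_num)).differentiableAt (by simp)
  have h1 : HasFDerivAt (partialDeriv i q) _ x :=
    hd.hasFDerivAt.clm_apply (hasFDerivAt_const (EuclideanSpace.single i 1) x)
  rw [partialDeriv, h1.fderiv]
  simp [iteratedFDeriv_two_apply]

theorem contDiff_slice (hg : ContDiffOn ℝ ∞ g (slab T)) {t : ℝ} (ht : t ∈ Icc 0 T) :
    ContDiff ℝ ∞ fun y => g (t, y) :=
  hg.comp_contDiff (contDiff_const.prodMk contDiff_id) fun y => mem_slab ht y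

theorem laplacian_slice (hT : 0 < T) (hg : ContDiffOn ℝ ∞ g (slab T)) {t : ℝ}
    (ht : t ∈ Icc 0 T) (x : E3) :
    Laplacian.laplacian (fun y => g (t, y)) x = slabLaplacian T g (t, x) := by
  rw [laplacian_eq_sum_partialDeriv ((contDiff_slice hg ht).of_le ENat.LEInfty.out).contDiffAt]
  refine Finset.sum_congr rfl fun i _ => ?_
  have h1 : partialDeriv i (fun y => g (t, y)) = fun y => slabDeriv T (spaceDir i) g (t, y) :=
    funext fun y => partialDeriv_slice (hg.differentiableOn (by simp)) ht y i
  rw [h1, partialDeriv_slice ((contDiffOn_slabDeriv hT hg _).differentiableOn (by simp)) ht]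

theorem timeDeriv_eq_slabDeriv (hT : 0 < T) {w : ℝ → E3 → ℝ}
    (hw : ∀ t ∈ Icc 0 T, ∀ x, w t x = g (t, x)) (hg : DifferentiableOn ℝ g (slab T)) {t : ℝ}
    (ht : t ∈ Icc 0 T) (x : E3) : timeDeriv T w t x = slabDeriv T timeDir g (t, x) := by
  rw [timeDeriv, derivWithin_congr (fun s hs => hw s hs x) (hw t ht x)]
  exact (hasDerivWithinAt_slabDeriv hg ht x).derivWithin (uniqueDiffOn_Icc hT t ht)

theorem dAlembert_eq (hT : 0 < T) {w : ℝ → E3 → ℝ}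
    (hw : ∀ t ∈ Icc 0 T, ∀ x, w t x = g (t, x)) (hg : ContDiffOn ℝ ∞ g (slab T)) {t : ℝ}
    (ht : t ∈ Icc 0 T) (x : E3) : dAlembert T w t x =
      slabDeriv T timeDir (slabDeriv T timeDir g) (t, x) - slabLaplacian T g (t, x) := by
  rw [dAlembert, timeDeriv_eq_slabDeriv hT (fun t ht x =>
      timeDeriv_eq_slabDeriv hT hw (hg.differentiableOn (by simp)) ht x)
      ((contDiffOn_slabDeriv hT hg _).differentiableOn (by simp)) ht, ← laplacian_slice hT hg ht,
    show w t = fun y => g (t, y) from funext (hw t ht)]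

end SlabCalculus

end VlasovMaxwell

namespace VlasovMaxwell

/-! ### Integrals over Euclidean space -/

theorem finrank_E3 : Module.finrank ℝ E3 = 3 := by simp

theorem integrableOn_ball_inv_norm (r : ℝ) :
    IntegrableOn (fun y : E3 => ‖y‖⁻¹) (ball 0 r) := by
  rw [integrableOn_fun_norm_addHaar volume (f := fun r => r⁻¹), finrank_E3]
  refine (integrableOn_Icc_iff_integrableOn_Ioo (a := 0) (b := r)).1 ?_ |>.congr_fun
    (f := fun y => y) (fun y hy => ?_) measurableSet_Ioo
  · exact continuous_id.continuousOn.integrableOn_Icc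
  · have := hy.1.ne'
    simp only [smul_eq_mul]; field_simp

theorem integrableOn_ball_inv_norm_sq (r : ℝ) :
    IntegrableOn (fun y : E3 => (‖y‖ ^ 2)⁻¹) (ball 0 r) := by
  rw [integrableOn_fun_norm_addHaar volume (f := fun r => (r ^ 2)⁻¹), finrank_E3]
  refine (integrableOn_Icc_iff_integrableOn_Ioo (a := 0) (b := r)).1 ?_ |>.congr_fun
    (f := fun _ => (1 : ℝ)) (fun y hy => ?_) measurableSet_Ioo
  · exact continuous_const.continuousOn.integrableOn_Icc
  · have := hy.1.ne'
    simp only [smul_eq_mul]; field_simp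

/-- In polar coordinates the radial density $3r^2(1+r^2)^{-5/2}$ has the primitive
$r^3(1+r^2)^{-3/2}$, which increases from 0 to 1. The remaining factor is three times the volume
$4\pi/3$ of the unit ball. -/
theorem integrable_and_integral_kernel :
    Integrable (fun z : E3 => 3 / √(1 + ‖z‖ ^ 2) ^ 5) ∧
    ∫ z : E3, 3 / √(1 + ‖z‖ ^ 2) ^ 5 = 4 * Real.pi := by
  have hpos : ∀ r : ℝ, 0 < √(1 + r ^ 2) := fun r => by positivity
  have hsq : ∀ r : ℝ, √(1 + r ^ 2) ^ 2 = 1 + r ^ 2 := fun r => Real.sq_sqrt (by positivity)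
  have hd : ∀ r ∈ Ici (0 : ℝ), HasDerivAt (fun r : ℝ => r ^ 3 / √(1 + r ^ 2) ^ 3)
      (r ^ (Module.finrank ℝ E3 - 1) • (3 / √(1 + r ^ 2) ^ 5)) r := by
    intro r _
    have h1 : HasDerivAt (fun r : ℝ => √(1 + r ^ 2)) (r / √(1 + r ^ 2)) r := by
      convert! (((hasDerivAt_id r).pow 2).const_add 1).sqrt (by simp; positivity) using 1
      simp; ring
    convert! ((hasDerivAt_id r).pow 3).div (h1.pow 3) (pow_ne_zero 3 (hpos r).ne') using 1
    have := hsq r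
    have h0 := (hpos r).ne'
    simp only [finrank_E3, Pi.pow_apply, id, smul_eq_mul]
    generalize √(1 + r ^ 2) = a at this h0
    norm_num
    field_simp
    linear_combination (-r ^ 2) * this
  have hlim : Tendsto (fun r : ℝ => r ^ 3 / √(1 + r ^ 2) ^ 3) atTop (𝓝 1) := by
    have h1 : Tendsto (fun r : ℝ => (√((r ^ 2)⁻¹ + 1) ^ 3)⁻¹) atTop (𝓝 ((√(0 + 1) ^ 3)⁻¹)) := by
      have : Tendsto (fun r : ℝ => (r ^ 2)⁻¹) atTop (𝓝 0) :=
        (tendsto_pow_atTop two_ne_zero).inv_tendsto_atTop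
      exact (((this.add_const 1).sqrt).pow 3).inv₀ (by simp)
    simp only [zero_add, Real.sqrt_one, one_pow, inv_one] at h1
    refine h1.congr' ?_
    filter_upwards [eventually_gt_atTop 0] with r hr
    have : √(1 + r ^ 2) = r * √((r ^ 2)⁻¹ + 1) := by
      rw [← Real.sqrt_sq hr.le, ← Real.sqrt_mul (by positivity), Real.sqrt_sq hr.le]
      congr 1; field_simp
    rw [this]; field_simp
  have hnn : ∀ r ∈ Ioi (0 : ℝ), 0 ≤ r ^ (Module.finrank ℝ E3 - 1) • (3 / √(1 + r ^ 2) ^ 5) :=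
    fun r hr => by have : (0 : ℝ) < r := hr; simp only [smul_eq_mul]; positivity
  refine ⟨(integrable_fun_norm_addHaar volume (f := fun r => 3 / √(1 + r ^ 2) ^ 5)).2
    (integrableOn_Ioi_deriv_of_nonneg' hd hnn hlim), ?_⟩
  rw [integral_fun_norm_addHaar volume (fun r => 3 / √(1 + r ^ 2) ^ 5),
    integral_Ioi_of_hasDerivAt_of_nonneg' hd hnn hlim, Measure.real,
    EuclideanSpace.volume_ball_fin_three, finrank_E3]
  simp [ENNReal.toReal_ofReal (by positivity : 0 ≤ Real.pi * 4 / 3)]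
  ring

theorem integral_fderiv_eq_zero {g : E3 → ℝ} (hg : ContDiff ℝ 1 g) (hc : HasCompactSupport g)
    (v : E3) : ∫ x, fderiv ℝ g x v = 0 := by
  have h := integral_mul_fderiv_eq_neg_fderiv_mul_of_integrable (μ := (volume : Measure E3))
    (f := fun _ : E3 => (1 : ℝ)) (g := g) (v := v) (by simp) ?_ ?_
    (fun _ _ => differentiableAt_const _) (fun x _ => hg.differentiable (by simp) x)
  · simpa using h
  · simpa using ((hg.continuous_fderiv (by simp)).clm_apply continuous_const).integrable_of_hasCompactSupport
      ((hc.fderiv ℝ).comp_left (g := fun L : E3 →L[ℝ] ℝ => L v) (by simp))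
  · simpa using hg.continuous.integrable_of_hasCompactSupport hc

/-! ### The regularized light cone -/

section LightCone

/-- A point of the regularized backward light cone with apex `p`. -/
noncomputable def conePoint (p : ℝ × E3) (ε : ℝ) (y : E3) : ℝ × E3 :=
  (p.1 - √(ε ^ 2 + ‖y‖ ^ 2), p.2 + y)

theorem conePoint_zero (p : ℝ × E3) (y : E3) : conePoint p 0 y = (p.1 - ‖y‖, p.2 + y) := by
  simp [conePoint, Real.sqrt_sq]

theorem continuous_conePoint (p : ℝ × E3) :
    Continuous fun z : ℝ × E3 => conePoint p z.1 z.2 := by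
  unfold conePoint; fun_prop

/-- Supplies domination uniform in `ε`. The support is compact in space only, but once `y` is large
the space coordinate leaves `K` for every `ε`, and the remaining pairs `(ε, y)` form a compact set.
-/
theorem conePoint_bound {φ : ℝ × E3 → ℝ} (hφ : Continuous φ) {K : Set E3} (hK : IsCompact K)
    (h0 : ∀ q : ℝ × E3, q.2 ∉ K → φ q = 0) (p : ℝ × E3) :
    ∃ C R : ℝ, 0 ≤ C ∧ (∀ ε ∈ Icc (0 : ℝ) 1, ∀ y, |φ (conePoint p ε y)| ≤ C) ∧
      ∀ ε y, R ≤ ‖y‖ → φ (conePoint p ε y) = 0 := by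
  obtain ⟨R, hR⟩ := hK.isBounded.exists_norm_le
  have hzero : ∀ ε y, R + ‖p.2‖ + 1 ≤ ‖y‖ → φ (conePoint p ε y) = 0 := fun ε y hy => by
    refine h0 _ fun hmem => ?_
    have h1 := hR _ hmem
    have h2 : ‖y‖ ≤ ‖p.2 + y‖ + ‖p.2‖ := by simpa using norm_sub_le (p.2 + y) p.2
    simp only [conePoint] at h1
    linarith
  obtain ⟨C, hC⟩ := ((isCompact_Icc (a := (0 : ℝ)) (b := 1)).prod
    (isCompact_closedBall (0 : E3) (R + ‖p.2‖ + 1))).exists_bound_of_continuousOn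
    (hφ.comp (continuous_conePoint p)).continuousOn
  refine ⟨max C 0, R + ‖p.2‖ + 1, le_max_right _ _, fun ε hε y => ?_, hzero⟩
  by_cases hy : R + ‖p.2‖ + 1 ≤ ‖y‖
  · rw [hzero ε y hy]; simp
  · refine (hC (ε, y) ⟨hε, ?_⟩).trans (le_max_left _ _)
    simpa using (not_le.1 hy).le

theorem tendsto_integral_conePoint {φ : ℝ × E3 → ℝ} (hφ : Continuous φ) {K : Set E3}
    (hK : IsCompact K) (h0 : ∀ q : ℝ × E3, q.2 ∉ K → φ q = 0) (p : ℝ × E3)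
    {c : ℝ → E3 → ℝ} {c₀ b : E3 → ℝ} (hb : ∀ r, IntegrableOn b (ball 0 r))
    (hc : ∀ ε ∈ Ioc (0 : ℝ) 1, Continuous (c ε))
    (hcb : ∀ ε ∈ Ioc (0 : ℝ) 1, ∀ y ≠ 0, |c ε y| ≤ b y)
    (hlim : ∀ y ≠ 0, Tendsto (fun ε => c ε y) (𝓝[>] 0) (𝓝 (c₀ y))) :
    Tendsto (fun ε => ∫ y, c ε y * φ (conePoint p ε y)) (𝓝[>] 0)
      (𝓝 (∫ y, c₀ y * φ (conePoint p 0 y))) := by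
  obtain ⟨C, R, hC0, hC, hR⟩ := conePoint_bound hφ hK h0 p
  have hev : ∀ᶠ ε : ℝ in 𝓝[>] 0, ε ∈ Ioc (0 : ℝ) 1 := Ioc_mem_nhdsGT one_pos
  -- The dominating functions in use are singular at the origin, so bounds and limits are only
  -- required off this null set.
  have hae : ∀ᵐ y : E3, y ≠ 0 := by simp [ae_iff]
  refine tendsto_integral_filter_of_dominated_convergence
    (fun y => (ball (0 : E3) R).indicator b y * C) ?_ ?_ ?_ ?_
  · filter_upwards [hev] with ε hε
    exact ((hc ε hε).mul (hφ.comp ((continuous_conePoint p).comp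
      (.prodMk_right ε)))).aestronglyMeasurable
  · filter_upwards [hev] with ε hε
    filter_upwards [hae] with y hy
    rw [Real.norm_eq_abs, abs_mul]
    by_cases hyR : y ∈ ball (0 : E3) R
    · rw [indicator_of_mem hyR]
      exact mul_le_mul (hcb ε hε y hy) (hC ε (Ioc_subset_Icc_self hε) y) (abs_nonneg _)
        ((abs_nonneg _).trans (hcb ε hε y hy))
    · rw [indicator_of_notMem hyR, hR ε y (by simpa using hyR)]; simp
  · exact ((hb R).integrable_indicator measurableSet_ball).mul_const C
  · filter_upwards [hae] with y hy
    refine (hlim y hy).mul ?_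
    exact ((hφ.comp (continuous_conePoint p)).comp
      (Continuous.prodMk_left y)).continuousAt.tendsto.mono_left nhdsWithin_le_nhds

/-- The substitution $y=\varepsilon z$ turns the kernel into the fixed density of mass $4\pi$, while
the cone point tends to the apex `p`: the kernels form an approximate identity. -/
theorem tendsto_integral_conePoint_kernel {φ : ℝ × E3 → ℝ} (hφ : Continuous φ) {K : Set E3}
    (hK : IsCompact K) (h0 : ∀ q : ℝ × E3, q.2 ∉ K → φ q = 0) (p : ℝ × E3) :
    Tendsto (fun ε => ∫ y, 3 * ε ^ 2 / √(ε ^ 2 + ‖y‖ ^ 2) ^ 5 * φ (conePoint p ε y)) (𝓝[>] 0)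
      (𝓝 (4 * Real.pi * φ p)) := by
  obtain ⟨C, R, hC0, hC, hR⟩ := conePoint_bound hφ hK h0 p
  have hscale : ∀ ε ∈ Ioc (0 : ℝ) 1,
      ∫ y, 3 * ε ^ 2 / √(ε ^ 2 + ‖y‖ ^ 2) ^ 5 * φ (conePoint p ε y) =
      ∫ z, 3 / √(1 + ‖z‖ ^ 2) ^ 5 * φ (conePoint p ε (ε • z)) := by
    intro ε hε
    have hε0 := hε.1
    have h := Measure.integral_comp_smul (volume : Measure E3)
      (fun y => 3 * ε ^ 2 / √(ε ^ 2 + ‖y‖ ^ 2) ^ 5 * φ (conePoint p ε y)) ε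
    rw [finrank_E3, abs_of_pos (by positivity), smul_eq_mul, eq_inv_mul_iff_mul_eq₀ (by positivity),
      ← integral_const_mul] at h
    rw [← h]
    refine integral_congr_ae (.of_forall fun z => ?_)
    have : √(ε ^ 2 + ‖ε • z‖ ^ 2) = ε * √(1 + ‖z‖ ^ 2) := by
      rw [norm_smul, Real.norm_of_nonneg hε0.le]
      conv_rhs => rw [← Real.sqrt_sq hε0.le, ← Real.sqrt_mul (by positivity)]
      congr 1; ring
    simp only [this]
    have h2 : 0 < √(1 + ‖z‖ ^ 2) := by positivity
    field_simp
  have hev : ∀ᶠ ε : ℝ in 𝓝[>] 0, ε ∈ Ioc (0 : ℝ) 1 := Ioc_mem_nhdsGT one_pos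
  rw [tendsto_congr' (hev.mono hscale), ← integrable_and_integral_kernel.2, ← integral_mul_const]
  have hcone : Continuous fun z : ℝ × E3 => φ (conePoint p z.1 (z.1 • z.2)) :=
    hφ.comp ((continuous_conePoint p).comp (by fun_prop : Continuous fun z : ℝ × E3 =>
      (z.1, z.1 • z.2)))
  refine tendsto_integral_filter_of_dominated_convergence
    (fun z => 3 / √(1 + ‖z‖ ^ 2) ^ 5 * C) ?_ ?_ ?_ ?_
  · refine .of_forall fun ε => Continuous.aestronglyMeasurable (.mul ?_ ?_)
    · exact continuous_const.div (by fun_prop) fun z => by positivity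
    · exact hcone.comp (.prodMk_right ε)
  · filter_upwards [hev] with ε hε
    refine .of_forall fun z => ?_
    rw [Real.norm_eq_abs, abs_mul, abs_of_nonneg (by positivity)]
    exact mul_le_mul_of_nonneg_left (hC ε (Ioc_subset_Icc_self hε) _) (by positivity)
  · exact integrable_and_integral_kernel.1.mul_const C
  · refine .of_forall fun z => tendsto_const_nhds.mul ?_
    have := (hcone.comp (Continuous.prodMk_left z)).tendsto 0
    simp only [Function.comp_apply, zero_smul, conePoint_zero] at this
    rw [add_zero, norm_zero, sub_zero] at this
    exact this.mono_left nhdsWithin_le_nhds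

end LightCone

end VlasovMaxwell

namespace VlasovMaxwell

/-! ### The retarded potential of a smooth source -/

section RetardedIdentity

/-- The derivative in the direction `v`. -/
noncomputable def dirDeriv (v : ℝ × E3) (k : ℝ × E3 → ℝ) (p : ℝ × E3) : ℝ := fderiv ℝ k p v

/-- The d'Alembert operator applied to a function on the whole space-time. -/
noncomputable def waveOp (k : ℝ × E3 → ℝ) (p : ℝ × E3) : ℝ :=
  dirDeriv timeDir (dirDeriv timeDir k) p - ∑ i, dirDeriv (spaceDir i) (dirDeriv (spaceDir i) k) p

variable {k : ℝ × E3 → ℝ} {K : Set E3}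

theorem contDiff_dirDeriv (hk : ContDiff ℝ ∞ k) (v : ℝ × E3) : ContDiff ℝ ∞ (dirDeriv v k) :=
  (hk.fderiv_right (m := ∞) (by simp)).clm_apply contDiff_const

theorem contDiff_waveOp (hk : ContDiff ℝ ∞ k) : ContDiff ℝ ∞ (waveOp k) :=
  (contDiff_dirDeriv (contDiff_dirDeriv hk _) _).sub
    (ContDiff.sum fun _ _ => contDiff_dirDeriv (contDiff_dirDeriv hk _) _)

theorem dirDeriv_comm (hk : ContDiff ℝ ∞ k) (v w : ℝ × E3) (p : ℝ × E3) :
    dirDeriv v (dirDeriv w k) p = dirDeriv w (dirDeriv v k) p := by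
  have hd : DifferentiableAt ℝ (fderiv ℝ k) p :=
    (hk.fderiv_right (m := ∞) (by simp)).differentiable (by simp) p
  have key : ∀ v w : ℝ × E3, dirDeriv v (dirDeriv w k) p = fderiv ℝ (fderiv ℝ k) p v w := by
    intro v w
    have h1 : HasFDerivAt (dirDeriv w k) _ p := hd.hasFDerivAt.clm_apply (hasFDerivAt_const w p)
    rw [dirDeriv, h1.fderiv]; simp
  rw [key, key]
  exact (hk.contDiffAt.isSymmSndFDerivAt (by simpa using ENat.LEInfty.out)) v w

theorem dirDeriv_eq_zero (hK : IsClosed K) (h0 : ∀ q : ℝ × E3, q.2 ∉ K → k q = 0) (v : ℝ × E3) :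
    ∀ q : ℝ × E3, q.2 ∉ K → dirDeriv v k q = 0 := by
  intro q hq
  have : k =ᶠ[𝓝 q] fun _ => 0 := by
    filter_upwards [continuous_snd.continuousAt.preimage_mem_nhds (hK.isOpen_compl.mem_nhds hq)]
      with z hz using h0 z hz
  rw [dirDeriv, this.fderiv_eq]; simp

theorem waveOp_eq_zero (hK : IsClosed K) (h0 : ∀ q : ℝ × E3, q.2 ∉ K → k q = 0) :
    ∀ q : ℝ × E3, q.2 ∉ K → waveOp k q = 0 := by
  intro q hq
  have h := fun v => dirDeriv_eq_zero hK (dirDeriv_eq_zero hK h0 v) v q hq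
  simp [waveOp, h]

theorem sqrt_cone_pos {ε : ℝ} (hε : 0 < ε) (y : E3) : 0 < √(ε ^ 2 + ‖y‖ ^ 2) := by positivity

theorem contDiff_sqrt_cone {ε : ℝ} (hε : 0 < ε) :
    ContDiff ℝ ∞ fun y : E3 => √(ε ^ 2 + ‖y‖ ^ 2) :=
  (contDiff_const.add (contDiff_norm_sq ℝ)).sqrt fun y => by positivity

theorem contDiff_conePoint {ε : ℝ} (hε : 0 < ε) (p : ℝ × E3) : ContDiff ℝ ∞ (conePoint p ε) :=
  (contDiff_const.sub (contDiff_sqrt_cone hε)).prodMk (contDiff_const.add contDiff_id)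

theorem hasDerivAt_sqrt_cone {ε : ℝ} (hε : 0 < ε) (y : E3) (i : Fin 3) :
    HasDerivAt (fun s : ℝ => √(ε ^ 2 + ‖y + s • EuclideanSpace.single i (1 : ℝ)‖ ^ 2))
      (y i / √(ε ^ 2 + ‖y‖ ^ 2)) 0 := by
  have h1 : HasDerivAt (fun s : ℝ => y + s • EuclideanSpace.single i (1 : ℝ))
      (EuclideanSpace.single i (1 : ℝ)) 0 := by
    simpa using ((hasDerivAt_id (0 : ℝ)).smul_const (EuclideanSpace.single i (1 : ℝ))).const_add y
  convert! (h1.norm_sq.const_add (ε ^ 2)).sqrt (by positivity) using 1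
  simp [EuclideanSpace.inner_single_right]
  field_simp

theorem hasDerivAt_conePoint {φ : ℝ × E3 → ℝ} (hφ : Differentiable ℝ φ) {ε : ℝ} (hε : 0 < ε)
    (p : ℝ × E3) (y : E3) (i : Fin 3) :
    HasDerivAt (fun s : ℝ => φ (conePoint p ε (y + s • EuclideanSpace.single i (1 : ℝ))))
      (dirDeriv (spaceDir i) φ (conePoint p ε y) -
        y i / √(ε ^ 2 + ‖y‖ ^ 2) * dirDeriv timeDir φ (conePoint p ε y)) 0 := by
  have h1 : HasDerivAt (fun s : ℝ => y + s • EuclideanSpace.single i (1 : ℝ))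
      (EuclideanSpace.single i (1 : ℝ)) 0 := by
    simpa using ((hasDerivAt_id (0 : ℝ)).smul_const (EuclideanSpace.single i (1 : ℝ))).const_add y
  have h2 := (hasDerivAt_sqrt_cone hε y i).const_sub p.1 |>.prodMk (h1.const_add p.2)
  have h3 := (hφ (conePoint p ε (y + (0 : ℝ) • EuclideanSpace.single i (1 : ℝ)))).hasFDerivAt
    |>.comp_hasDerivAt (0 : ℝ) h2
  convert! h3 using 1
  rw [zero_smul, add_zero, dirDeriv, dirDeriv, ← smul_eq_mul, ← map_smul, ← map_sub]
  congr 1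
  simp [spaceDir, timeDir]

/-- The `i`-th component of a vector field whose divergence is the integrand of the retarded
potential of the d'Alembertian of `k`, up to an approximate identity. -/
noncomputable def coneFlux (k : ℝ × E3 → ℝ) (p : ℝ × E3) (ε : ℝ) (i : Fin 3) (y : E3) : ℝ :=
  dirDeriv (spaceDir i) k (conePoint p ε y) / √(ε ^ 2 + ‖y‖ ^ 2) +
    y i * dirDeriv timeDir k (conePoint p ε y) / √(ε ^ 2 + ‖y‖ ^ 2) ^ 2 +
    y i * k (conePoint p ε y) / √(ε ^ 2 + ‖y‖ ^ 2) ^ 3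

theorem contDiff_coneFlux (hk : ContDiff ℝ ∞ k) (p : ℝ × E3) {ε : ℝ} (hε : 0 < ε) (i : Fin 3) :
    ContDiff ℝ ∞ (coneFlux k p ε i) := by
  have hc := contDiff_conePoint hε p
  have hs := contDiff_sqrt_cone hε
  have hne := fun y => (sqrt_cone_pos hε y).ne'
  have hi : ContDiff ℝ ∞ fun y : E3 => y i := contDiff_piLp_apply 2
  exact ((((contDiff_dirDeriv hk _).comp hc).div hs hne).add
    ((hi.mul ((contDiff_dirDeriv hk _).comp hc)).div (hs.pow 2)
      fun y => pow_ne_zero _ (hne y))).add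
    ((hi.mul (hk.comp hc)).div (hs.pow 3) fun y => pow_ne_zero _ (hne y))

theorem hasCompactSupport_comp_conePoint {φ : ℝ × E3 → ℝ} (hφ : Continuous φ) (hK : IsCompact K)
    (h0 : ∀ q : ℝ × E3, q.2 ∉ K → φ q = 0) (p : ℝ × E3) (ε : ℝ) :
    HasCompactSupport fun y => φ (conePoint p ε y) := by
  obtain ⟨C, R, -, -, hR⟩ := conePoint_bound hφ hK h0 p
  refine HasCompactSupport.of_support_subset_isCompact (isCompact_closedBall 0 R) fun y hy => ?_
  by_contra h
  exact hy (hR ε y (by simpa using (not_le.1 (by simpa using h)).le))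

theorem hasCompactSupport_coneFlux (hk : ContDiff ℝ ∞ k) (hK : IsCompact K)
    (h0 : ∀ q : ℝ × E3, q.2 ∉ K → k q = 0) (p : ℝ × E3) (ε : ℝ) (i : Fin 3) :
    HasCompactSupport (coneFlux k p ε i) := by
  have h := fun v => hasCompactSupport_comp_conePoint (contDiff_dirDeriv hk v).continuous hK
    (dirDeriv_eq_zero hK.isClosed h0 v) p ε
  have h' := hasCompactSupport_comp_conePoint hk.continuous hK h0 p ε
  unfold coneFlux
  simp only [div_eq_mul_inv]
  exact ((h _).mul_right.add ((h _).mul_left.mul_right)).add (h'.mul_left.mul_right)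

/-- The three terms of the flux are chosen so that the mixed derivatives $\partial_t\partial_ik$ and
the first derivatives $\partial_ik$ cancel. Only $\partial_i^2k$, $\partial_t^2k$, $\partial_tk$ and
$k$ survive. -/
theorem fderiv_coneFlux (hk : ContDiff ℝ ∞ k) (p : ℝ × E3) {ε : ℝ} (hε : 0 < ε) (i : Fin 3)
    (y : E3) :
    fderiv ℝ (coneFlux k p ε i) y (EuclideanSpace.single i 1) =
      dirDeriv (spaceDir i) (dirDeriv (spaceDir i) k) (conePoint p ε y) / √(ε ^ 2 + ‖y‖ ^ 2) +
      dirDeriv timeDir k (conePoint p ε y) *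
        (1 / √(ε ^ 2 + ‖y‖ ^ 2) ^ 2 - 3 * y i ^ 2 / √(ε ^ 2 + ‖y‖ ^ 2) ^ 4) -
      dirDeriv timeDir (dirDeriv timeDir k) (conePoint p ε y) *
        (y i ^ 2 / √(ε ^ 2 + ‖y‖ ^ 2) ^ 3) +
      k (conePoint p ε y) *
        (1 / √(ε ^ 2 + ‖y‖ ^ 2) ^ 3 - 3 * y i ^ 2 / √(ε ^ 2 + ‖y‖ ^ 2) ^ 5) := by
  have hl := (((contDiff_coneFlux hk p hε i).differentiable (by simp) y).hasFDerivAt.hasLineDerivAt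
    (EuclideanSpace.single i 1))
  refine HasDerivAt.unique hl ?_
  have hs := hasDerivAt_sqrt_cone hε y i
  have hi : HasDerivAt (fun s : ℝ => (y + s • EuclideanSpace.single i (1 : ℝ)) i) 1 0 := by
    simpa using (hasDerivAt_id (0 : ℝ)).const_add (y i)
  have hd := fun v => hasDerivAt_conePoint ((contDiff_dirDeriv hk v).differentiable (by simp)) hε p y i
  have hk' := hasDerivAt_conePoint (hk.differentiable (by simp)) hε p y i
  have hpos := (sqrt_cone_pos hε y).ne'
  have hpos' : √(ε ^ 2 + ‖y + (0 : ℝ) • EuclideanSpace.single i (1 : ℝ)‖ ^ 2) ≠ 0 := by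
    simpa using hpos
  have h := (((hd (spaceDir i)).div hs hpos').add
    ((hi.mul (hd timeDir)).div (hs.pow 2) (pow_ne_zero 2 hpos'))).add
    ((hi.mul hk').div (hs.pow 3) (pow_ne_zero 3 hpos'))
  convert! h using 1
  simp only [zero_smul, add_zero, Pi.pow_apply, Pi.mul_apply]
  rw [dirDeriv_comm hk (spaceDir i) timeDir]
  generalize √(ε ^ 2 + ‖y‖ ^ 2) = σ at hpos ⊢
  field_simp
  ring

/-- Sum `fderiv_coneFlux` over `i` and insert $|y|^2=\sigma^2-\varepsilon^2$ with
$\sigma=\sqrt{\varepsilon^2+|y|^2}$: the divergence of the flux is $-\Box k/\sigma$ plus terms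
carrying a factor $\varepsilon^2$. Its integral vanishes by compact support. -/
theorem integral_conePoint_identity (hk : ContDiff ℝ ∞ k) (hK : IsCompact K)
    (h0 : ∀ q : ℝ × E3, q.2 ∉ K → k q = 0) (p : ℝ × E3) {ε : ℝ} (hε : 0 < ε) :
    ∫ y, 1 / √(ε ^ 2 + ‖y‖ ^ 2) * waveOp k (conePoint p ε y) =
      (∫ y, ε ^ 2 / √(ε ^ 2 + ‖y‖ ^ 2) ^ 3 *
          dirDeriv timeDir (dirDeriv timeDir k) (conePoint p ε y)) +
      (∫ y, 3 * ε ^ 2 / √(ε ^ 2 + ‖y‖ ^ 2) ^ 4 * dirDeriv timeDir k (conePoint p ε y)) +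
      ∫ y, 3 * ε ^ 2 / √(ε ^ 2 + ‖y‖ ^ 2) ^ 5 * k (conePoint p ε y) := by
  have hint : ∀ {φ : ℝ × E3 → ℝ}, Continuous φ → (∀ q : ℝ × E3, q.2 ∉ K → φ q = 0) →
      ∀ (c : ℝ) (n : ℕ), Integrable fun y => c / √(ε ^ 2 + ‖y‖ ^ 2) ^ n * φ (conePoint p ε y) := by
    intro φ hφ hφ0 c n
    refine Continuous.integrable_of_hasCompactSupport ?_
      (hasCompactSupport_comp_conePoint hφ hK hφ0 p ε).mul_left
    exact (continuous_const.div ((contDiff_sqrt_cone hε).continuous.pow n)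
      fun y => pow_ne_zero _ (sqrt_cone_pos hε y).ne').mul
      (hφ.comp (contDiff_conePoint hε p).continuous)
  have hz := dirDeriv_eq_zero hK.isClosed h0
  have i1 := hint (contDiff_waveOp hk).continuous (waveOp_eq_zero hK.isClosed h0) 1 1
  have i2 := hint (contDiff_dirDeriv (contDiff_dirDeriv hk timeDir) timeDir).continuous
    (dirDeriv_eq_zero hK.isClosed (hz timeDir) timeDir) (ε ^ 2) 3
  have i3 := hint (contDiff_dirDeriv hk timeDir).continuous (hz timeDir) (3 * ε ^ 2) 4
  have i4 := hint hk.continuous h0 (3 * ε ^ 2) 5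
  have hdiv : ∫ y, ∑ i, fderiv ℝ (coneFlux k p ε i) y (EuclideanSpace.single i 1) = 0 := by
    rw [integral_finsetSum]
    · exact Finset.sum_eq_zero fun i _ => integral_fderiv_eq_zero
        ((contDiff_coneFlux hk p hε i).of_le (by simp)) (hasCompactSupport_coneFlux hk hK h0 p ε i) _
    · intro i _
      exact (((contDiff_coneFlux hk p hε i).continuous_fderiv (by simp)).clm_apply
        continuous_const).integrable_of_hasCompactSupport
        (((hasCompactSupport_coneFlux hk hK h0 p ε i).fderiv ℝ).comp_left
          (g := fun L : E3 →L[ℝ] ℝ => L (EuclideanSpace.single i 1)) (by simp))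
  simp only [pow_one] at i1
  rw [← integral_add' i2 i3, ← integral_add' (i2.add i3) i4, ← sub_eq_zero,
    ← integral_sub' i1 ((i2.add i3).add i4), ← neg_eq_zero, ← integral_neg, ← hdiv]
  refine integral_congr_ae (.of_forall fun y => ?_)
  simp only [fderiv_coneFlux hk p hε, Pi.add_apply, Pi.sub_apply, Fin.sum_univ_three, waveOp]
  have hσ := sqrt_cone_pos hε y
  have hsq : √(ε ^ 2 + ‖y‖ ^ 2) ^ 2 = ε ^ 2 + (y 0 ^ 2 + y 1 ^ 2 + y 2 ^ 2) := by
    rw [Real.sq_sqrt (by positivity), EuclideanSpace.norm_sq_eq]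
    simp [Fin.sum_univ_three]
  generalize √(ε ^ 2 + ‖y‖ ^ 2) = σ at hσ hsq ⊢
  have hy : y 0 ^ 2 = σ ^ 2 - ε ^ 2 - y 1 ^ 2 - y 2 ^ 2 := by linarith
  rw [hy]
  field_simp
  ring

/-- The retarded potential inverts the d'Alembert operator. -/
theorem integral_retarded_waveOp (hk : ContDiff ℝ ∞ k) (hK : IsCompact K)
    (h0 : ∀ q : ℝ × E3, q.2 ∉ K → k q = 0) (p : ℝ × E3) :
    ∫ y, (4 * Real.pi * ‖y‖)⁻¹ * waveOp k (p.1 - ‖y‖, p.2 + y) = k p := by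
  have hz := dirDeriv_eq_zero hK.isClosed h0
  have hsp : ∀ ε : ℝ, 0 < ε → ∀ y : E3, 0 < √(ε ^ 2 + ‖y‖ ^ 2) := fun ε hε y => by positivity
  have hle : ∀ (ε : ℝ) (y : E3), ‖y‖ ≤ √(ε ^ 2 + ‖y‖ ^ 2) := fun ε y =>
    Real.le_sqrt_of_sq_le (by nlinarith)
  have hle' : ∀ ε : ℝ, 0 < ε → ∀ y : E3, ε ≤ √(ε ^ 2 + ‖y‖ ^ 2) := fun ε hε y =>
    Real.le_sqrt_of_sq_le (by nlinarith [norm_nonneg y])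
  have hcont : ∀ ε : ℝ, 0 < ε → ∀ (c : ℝ) (n : ℕ),
      Continuous fun y : E3 => c / √(ε ^ 2 + ‖y‖ ^ 2) ^ n := fun ε hε c n =>
    continuous_const.div ((contDiff_sqrt_cone hε).continuous.pow n)
      fun y => pow_ne_zero _ (hsp ε hε y).ne'
  have htend : ∀ (c : ℝ → ℝ) (hc : Continuous c) (n : ℕ) (y : E3), y ≠ 0 →
      Tendsto (fun ε => c ε / √(ε ^ 2 + ‖y‖ ^ 2) ^ n) (𝓝[>] 0) (𝓝 (c 0 / ‖y‖ ^ n)) := by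
    intro c hc n y hy
    have : ContinuousAt (fun ε => c ε / √(ε ^ 2 + ‖y‖ ^ 2) ^ n) 0 := by
      refine hc.continuousAt.div (by fun_prop) ?_
      simpa [Real.sqrt_sq] using fun h => absurd h hy
    have := this.tendsto.mono_left (nhdsWithin_le_nhds (s := Ioi 0))
    simpa [Real.sqrt_sq] using this
  have l1 := tendsto_integral_conePoint (contDiff_waveOp hk).continuous hK
    (waveOp_eq_zero hK.isClosed h0) p (c := fun ε y => 1 / √(ε ^ 2 + ‖y‖ ^ 2) ^ 1)
    (c₀ := fun y => 1 / ‖y‖ ^ 1) (b := fun y => ‖y‖⁻¹) integrableOn_ball_inv_norm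
    (fun ε hε => hcont ε hε.1 1 1)
    (fun ε hε y hy => by
      have := hsp ε hε.1 y
      have hy' := norm_pos_iff.2 hy
      rw [abs_of_nonneg (by positivity), pow_one, one_div]
      exact inv_anti₀ hy' (hle ε y))
    (htend (fun _ => 1) continuous_const 1)
  -- Since $\varepsilon\le\sigma$ and $|y|\le\sigma$, the weights of the next two integrals are at
  -- most $|y|^{-1}$ and $3|y|^{-2}$, both locally integrable in dimension three; they tend to 0
  -- pointwise, so these integrals disappear.
  have l2 := tendsto_integral_conePoint
    (contDiff_dirDeriv (contDiff_dirDeriv hk timeDir) timeDir).continuous hK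
    (dirDeriv_eq_zero hK.isClosed (hz timeDir) timeDir) p
    (c := fun ε y => ε ^ 2 / √(ε ^ 2 + ‖y‖ ^ 2) ^ 3) (c₀ := fun y => 0 ^ 2 / ‖y‖ ^ 3)
    (b := fun y => ‖y‖⁻¹) integrableOn_ball_inv_norm (fun ε hε => hcont ε hε.1 (ε ^ 2) 3)
    (fun ε hε y hy => by
      have h1 := hsp ε hε.1 y
      have hy' := norm_pos_iff.2 hy
      rw [abs_of_nonneg (by positivity), div_le_iff₀ (by positivity), inv_mul_eq_div,
        le_div_iff₀ hy', pow_succ (√(ε ^ 2 + ‖y‖ ^ 2)) 2]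
      have := hε.1
      exact mul_le_mul (pow_le_pow_left₀ hε.1.le (hle' ε hε.1 y) 2) (hle ε y) hy'.le
        (by positivity))
    (htend (fun ε => ε ^ 2) (by fun_prop) 3)
  have l3 := tendsto_integral_conePoint (contDiff_dirDeriv hk timeDir).continuous hK
    (hz timeDir) p
    (c := fun ε y => 3 * ε ^ 2 / √(ε ^ 2 + ‖y‖ ^ 2) ^ 4) (c₀ := fun y => 3 * 0 ^ 2 / ‖y‖ ^ 4)
    (b := fun y => 3 * (‖y‖ ^ 2)⁻¹) (fun r => (integrableOn_ball_inv_norm_sq r).const_mul 3)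
    (fun ε hε => hcont ε hε.1 (3 * ε ^ 2) 4)
    (fun ε hε y hy => by
      have h1 := hsp ε hε.1 y
      have hy' := norm_pos_iff.2 hy
      rw [abs_of_nonneg (by positivity), div_le_iff₀ (by positivity), mul_assoc, inv_mul_eq_div]
      refine mul_le_mul_of_nonneg_left ?_ (by norm_num)
      rw [le_div_iff₀ (pow_pos hy' 2), show (4 : ℕ) = 2 + 2 from rfl, pow_add]
      have := hε.1
      exact mul_le_mul (pow_le_pow_left₀ hε.1.le (hle' ε hε.1 y) 2)
        (pow_le_pow_left₀ hy'.le (hle ε y) 2) (by positivity) (by positivity))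
    (htend (fun ε => 3 * ε ^ 2) (by fun_prop) 4)
  have l4 := tendsto_integral_conePoint_kernel hk.continuous hK h0 p
  have l := (l2.add l3).add l4
  have hev : ∀ᶠ ε : ℝ in 𝓝[>] 0, 0 < ε := self_mem_nhdsWithin
  have heq := tendsto_nhds_unique (l1.congr' (hev.mono fun ε hε => by
    simpa only [pow_one] using integral_conePoint_identity hk hK h0 p hε)) l
  simp only [conePoint_zero, pow_one, ne_eq, OfNat.ofNat_ne_zero, not_false_eq_true, zero_pow,
    mul_zero, zero_div, zero_mul, integral_zero, zero_add] at heq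
  have hpi := Real.pi_pos
  have : ∀ y : E3, (4 * Real.pi * ‖y‖)⁻¹ * waveOp k (p.1 - ‖y‖, p.2 + y) =
      (4 * Real.pi)⁻¹ * (1 / ‖y‖ * waveOp k (p.1 - ‖y‖, p.2 + y)) := fun y => by
    rw [mul_inv]; ring
  simp only [this, integral_const_mul]
  rw [heq]; field_simp

end RetardedIdentity

end VlasovMaxwell

namespace VlasovMaxwell

/-! ### Duhamel's formula for the wave equation with a source on the slab -/

section Duhamel

variable {T : ℝ} {h : ℝ × E3 → ℝ}

/-- The weight of the retarded potential. -/
noncomputable def newtonWeight (y : E3) : ℝ := (4 * Real.pi * ‖y‖)⁻¹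

theorem newtonWeight_nonneg (y : E3) : 0 ≤ newtonWeight y := by
  have := Real.pi_pos; unfold newtonWeight; positivity

theorem integrableOn_newtonWeight (r : ℝ) : IntegrableOn newtonWeight (ball 0 r) := by
  have := (integrableOn_ball_inv_norm r).const_mul (4 * Real.pi)⁻¹
  refine IntegrableOn.congr_fun this (fun y _ => ?_) measurableSet_ball
  simp only [newtonWeight, mul_inv]

/-- The map to the points of the backward light cone with apex `p`, normalized to the ball. -/
noncomputable def coneMap (y : E3) : ℝ × E3 →L[ℝ] ℝ × E3 :=
  ((1 - ‖y‖) • ContinuousLinearMap.fst ℝ ℝ E3).prod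
    (ContinuousLinearMap.snd ℝ ℝ E3 + (ContinuousLinearMap.fst ℝ ℝ E3).smulRight y)

theorem coneMap_apply (y : E3) (p : ℝ × E3) :
    coneMap y p = (p.1 * (1 - ‖y‖), p.2 + p.1 • y) := by
  simp [coneMap, mul_comm]

theorem coneMap_spaceDir (y : E3) (i : Fin 3) : coneMap y (spaceDir i) = spaceDir i := by
  simp [coneMap_apply, spaceDir]

theorem continuous_coneMap : Continuous coneMap := by
  refine continuous_clm_apply.2 fun p => ?_
  simp only [coneMap_apply]
  fun_prop

theorem exists_norm_coneMap_le : ∃ C, ∀ y ∈ ball (0 : E3) 1, ‖coneMap y‖ ≤ C := by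
  obtain ⟨C, hC⟩ := (isCompact_closedBall (0 : E3) 1).exists_bound_of_continuousOn
    continuous_coneMap.continuousOn
  exact ⟨C, fun y hy => hC y (ball_subset_closedBall hy)⟩

theorem coneMap_mem {y : E3} (hy : y ∈ ball (0 : E3) 1) {p : ℝ × E3} (hp : p ∈ slab T) :
    coneMap y p ∈ slab T := by
  rw [mem_ball_zero_iff] at hy
  have h1 := hp.1
  have := norm_nonneg y
  rw [coneMap_apply]
  refine mem_slab ⟨mul_nonneg h1.1 (by linarith), ?_⟩ _
  nlinarith [h1.1, h1.2]

/-- The solution of the wave equation with source `h` and vanishing initial data, as a retarded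
potential in normalized form. -/
noncomputable def duhamel (h : ℝ × E3 → ℝ) (p : ℝ × E3) : ℝ :=
  p.1 ^ 2 * ∫ y in ball (0 : E3) 1, newtonWeight y * h (coneMap y p)

/-- After normalization neither domain nor weight depends on `p`, and `coneMap y` is linear in `p`
and maps the slab to itself. Hence smoothness up to the boundary is an instance of
`IsTestOn.contDiffOn_integral`. -/
theorem contDiffOn_coneIntegral (hT : 0 < T) (hh : IsTestOn (slab T) h) :
    ContDiffOn ℝ ∞ (fun p => ∫ y in ball (0 : E3) 1, newtonWeight y * h (coneMap y p)) (slab T) ∧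
    ∀ p ∈ slab T, ∀ v,
      slabDeriv T v (fun p => ∫ y in ball (0 : E3) 1, newtonWeight y * h (coneMap y p)) p =
      ∫ y in ball (0 : E3) 1, newtonWeight y * fderivWithin ℝ h (slab T) (coneMap y p)
        (coneMap y v) := by
  obtain ⟨C, hC⟩ := exists_norm_coneMap_le
  have := IsTestOn.contDiffOn_integral (μ := (volume : Measure E3)) (Λ := coneMap)
    (c := fun _ => (0 : ℝ × E3)) measurableSet_ball (convex_slab T) (uniqueDiffOn_slab hT)
    (isClosed_slab T) (uniqueDiffOn_slab hT) continuous_coneMap.continuousOn continuousOn_const hC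
    (fun y hy p hp => by simpa using coneMap_mem hy hp) hh (integrableOn_newtonWeight 1)
  simp only [add_zero, smul_eq_mul] at this
  exact this

theorem contDiffOn_duhamel (hT : 0 < T) (hh : IsTestOn (slab T) h) :
    ContDiffOn ℝ ∞ (duhamel h) (slab T) :=
  (contDiff_fst.pow 2).contDiffOn.mul (contDiffOn_coneIntegral hT hh).1

theorem slabDeriv_duhamel (hT : 0 < T) (hh : IsTestOn (slab T) h) {p : ℝ × E3} (hp : p ∈ slab T)
    (v : ℝ × E3) : slabDeriv T v (duhamel h) p =
      2 * p.1 * v.1 * (∫ y in ball (0 : E3) 1, newtonWeight y * h (coneMap y p)) +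
      p.1 ^ 2 * slabDeriv T v
        (fun p => ∫ y in ball (0 : E3) 1, newtonWeight y * h (coneMap y p)) p := by
  have h1 : HasFDerivWithinAt (fun p : ℝ × E3 => p.1 ^ 2) _ (slab T) p :=
    ((hasFDerivAt_fst (𝕜 := ℝ) (p := p)).pow 2).hasFDerivWithinAt
  have h2 := ((contDiffOn_coneIntegral hT hh).1.differentiableOn (by simp) p hp).hasFDerivWithinAt
  have h3 := (h1.mul h2).fderivWithin (uniqueDiffOn_slab hT p hp)
  rw [slabDeriv]
  unfold duhamel
  refine (congrArg (fun L : ℝ × E3 →L[ℝ] ℝ => L v) h3).trans ?_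
  simp [slabDeriv]
  ring

/-- Space directions are fixed by `coneMap` and do not see the factor $t^2$, so space derivatives
pass to the source. -/
theorem slabDeriv_spaceDir_duhamel (hT : 0 < T) (hh : IsTestOn (slab T) h) {p : ℝ × E3}
    (hp : p ∈ slab T) (i : Fin 3) :
    slabDeriv T (spaceDir i) (duhamel h) p = duhamel (slabDeriv T (spaceDir i) h) p := by
  rw [slabDeriv_duhamel hT hh hp, (contDiffOn_coneIntegral hT hh).2 p hp]
  simp only [coneMap_spaceDir]
  simp [spaceDir, duhamel, slabDeriv]

theorem duhamel_initial (x : E3) : duhamel h (0, x) = 0 := by simp [duhamel]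

theorem slabDeriv_timeDir_duhamel_initial (hT : 0 < T) (hh : IsTestOn (slab T) h) (x : E3) :
    slabDeriv T timeDir (duhamel h) (0, x) = 0 := by
  rw [slabDeriv_duhamel hT hh (mem_slab (left_mem_Icc.2 hT.le) x)]; simp

theorem integrableOn_cone (hh : IsTestOn (slab T) h) {p : ℝ × E3} (hp : p ∈ slab T) :
    IntegrableOn (fun y => newtonWeight y * h (coneMap y p)) (ball 0 1) := by
  have hW : IntegrableOn (fun y : E3 => newtonWeight y • ContinuousLinearMap.id ℝ ℝ) (ball 0 1) :=
    (integrableOn_newtonWeight 1).smul_const _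
  have := hh.integrableOn_comp (Λ := coneMap) (c := fun _ => (0 : ℝ × E3)) measurableSet_ball
    (isClosed_slab T) continuous_coneMap.continuousOn continuousOn_const
    (fun y hy p hp => by simpa using coneMap_mem hy hp) hW hp
  simpa using this

theorem duhamel_sum {ι : Type} (s : Finset ι) {H : ι → ℝ × E3 → ℝ}
    (hH : ∀ i ∈ s, IsTestOn (slab T) (H i)) {p : ℝ × E3} (hp : p ∈ slab T) :
    duhamel (fun q => ∑ i ∈ s, H i q) p = ∑ i ∈ s, duhamel (H i) p := by
  simp only [duhamel, Finset.mul_sum]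
  rw [integral_finsetSum _ fun i hi => integrableOn_cone (hH i hi) hp, Finset.mul_sum]

theorem slabLaplacian_duhamel (hT : 0 < T) (hh : IsTestOn (slab T) h) {p : ℝ × E3}
    (hp : p ∈ slab T) : slabLaplacian T (duhamel h) p = duhamel (slabLaplacian T h) p := by
  have : ∀ i, slabDeriv T (spaceDir i) (slabDeriv T (spaceDir i) (duhamel h)) p =
      duhamel (slabDeriv T (spaceDir i) (slabDeriv T (spaceDir i) h)) p := fun i => by
    rw [slabDeriv_congr (fun q hq => slabDeriv_spaceDir_duhamel hT hh hq i) hp,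
      slabDeriv_spaceDir_duhamel hT (hh.slabDeriv hT _) hp]
  unfold slabLaplacian
  rw [duhamel_sum _ (fun i _ => (hh.slabDeriv hT _).slabDeriv hT _) hp]
  exact Finset.sum_congr rfl fun i _ => this i

/-! #### Time cut-offs -/

theorem exists_time_cutoff (hT : 0 < T) : ∃ η : ℕ → ℝ → ℝ, (∀ n, ContDiff ℝ ∞ (η n)) ∧
    (∀ n, tsupport (η n) ⊆ Ioo 0 T) ∧ (∀ n s, |η n s| ≤ 1) ∧
    ∀ s ∈ Ioo 0 T, ∀ᶠ n in atTop, η n s = 1 := by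
  -- Inner and outer radii of a bump centred at $T/2$. The shift by 3 makes $2/(n+3)<1$, so the
  -- inner radius is positive already at `n = 0`; the outer radius stays below $T/2$ and the inner
  -- one tends to it.
  have hlt : ∀ n : ℕ, T / 2 * (1 - 2 / (n + 3)) < T / 2 * (1 - 1 / (n + 3)) := fun n => by
    have : (0 : ℝ) < n + 3 := by positivity
    refine mul_lt_mul_of_pos_left ?_ (by linarith)
    have : (1 : ℝ) / (n + 3) < 2 / (n + 3) := by gcongr; norm_num
    linarith
  have hpos : ∀ n : ℕ, 0 < T / 2 * (1 - 2 / (n + 3)) := fun n => by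
    have : (2 : ℝ) / (n + 3) < 1 := by
      rw [div_lt_one (by positivity)]
      linarith [n.cast_nonneg (α := ℝ)]
    exact mul_pos (by linarith) (by linarith)
  let b : ∀ n : ℕ, ContDiffBump (T / 2) := fun n => ⟨_, _, hpos n, hlt n⟩
  refine ⟨fun n => b n, fun n => (b n).contDiff, fun n => ?_, fun n s => ?_, fun s hs => ?_⟩
  · rw [(b n).tsupport_eq, Real.closedBall_eq_Icc]
    have : T / 2 * (1 - 1 / ((n : ℝ) + 3)) < T / 2 := by
      have : (0 : ℝ) < 1 / (n + 3) := by positivity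
      nlinarith
    intro s hs
    have h1 : T / 2 - (T / 2 * (1 - 1 / ((n : ℝ) + 3))) ≤ s := hs.1
    have h2 : s ≤ T / 2 + (T / 2 * (1 - 1 / ((n : ℝ) + 3))) := hs.2
    constructor <;> linarith
  · rw [abs_of_nonneg (b n).nonneg]; exact (b n).le_one
  · have hlim : Tendsto (fun n : ℕ => T / 2 * (1 - 2 / ((n : ℝ) + 3))) atTop
        (𝓝 (T / 2 * (1 - 0))) := by
      refine tendsto_const_nhds.mul (tendsto_const_nhds.sub ?_)
      exact tendsto_const_nhds.div_atTop
        (tendsto_atTop_add_const_right _ _ tendsto_natCast_atTop_atTop)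
    have : |s - T / 2| < T / 2 * (1 - 0) := by
      rw [abs_lt]; constructor <;> linarith [hs.1, hs.2]
    filter_upwards [hlim.eventually (lt_mem_nhds this)] with n hn
    exact (b n).one_of_mem_closedBall (by rw [mem_closedBall, Real.dist_eq]; exact hn.le)

theorem cutoff_eventually_zero {η : ℝ → ℝ} (hs : tsupport η ⊆ Ioo 0 T) {p : ℝ × E3}
    (hp : p.1 ∉ Ioo 0 T) : ∀ᶠ q in 𝓝 p, η q.1 = 0 := by
  have : p.1 ∈ (tsupport η)ᶜ := fun h => hp (hs h)
  filter_upwards [continuous_fst.continuousAt.preimage_mem_nhds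
    ((isClosed_tsupport η).isOpen_compl.mem_nhds this)] with q hq
  exact image_eq_zero_of_notMem_tsupport hq

theorem slab_mem_nhds {p : ℝ × E3} (hp : p.1 ∈ Ioo 0 T) : slab T ∈ 𝓝 p :=
  prod_mem_nhds (Icc_mem_nhds hp.1 hp.2) univ_mem

/-- At interior times `h` is smooth in the unrestricted sense, and near all other times the product
vanishes identically, whatever the values of `h` outside the slab. -/
theorem contDiff_cutoff {η : ℝ → ℝ} (hη : ContDiff ℝ ∞ η) (hs : tsupport η ⊆ Ioo 0 T)
    (hh : ContDiffOn ℝ ∞ h (slab T)) : ContDiff ℝ ∞ fun p => η p.1 * h p := by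
  refine contDiff_iff_contDiffAt.2 fun p => ?_
  by_cases hp : p.1 ∈ Ioo 0 T
  · exact (hη.comp contDiff_fst).contDiffAt.mul (hh.contDiffAt (slab_mem_nhds hp))
  · refine (contDiffAt_const (c := (0 : ℝ))).congr_of_eventuallyEq ?_
    filter_upwards [cutoff_eventually_zero hs hp] with q hq
    simp [hq]

theorem dirDeriv_cutoff {η : ℝ → ℝ} (hη : ContDiff ℝ ∞ η) (hs : tsupport η ⊆ Ioo 0 T)
    (hh : ContDiffOn ℝ ∞ h (slab T)) (i : Fin 3) :
    dirDeriv (spaceDir i) (fun p => η p.1 * h p) =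
      fun p => η p.1 * slabDeriv T (spaceDir i) h p := by
  funext p
  by_cases hp : p.1 ∈ Ioo 0 T
  · have h1 : HasFDerivAt h (fderivWithin ℝ h (slab T) p) p := by
      have hd := (hh.contDiffAt (slab_mem_nhds hp)).differentiableAt (by simp)
      rw [fderivWithin_of_mem_nhds (slab_mem_nhds hp)]
      exact hd.hasFDerivAt
    have h2 : HasFDerivAt (fun p : ℝ × E3 => η p.1) _ p :=
      ((hη.differentiable (by simp) p.1).hasDerivAt).comp_hasFDerivAt p
        (hasFDerivAt_fst (𝕜 := ℝ) (p := p))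
    have h3 : HasFDerivAt (fun p : ℝ × E3 => η p.1 * h p) _ p := h2.mul h1
    rw [dirDeriv, h3.fderiv]
    simp [slabDeriv, spaceDir]
  · have h0 := cutoff_eventually_zero hs hp
    have : (fun p => η p.1 * h p) =ᶠ[𝓝 p] fun _ => 0 := by
      filter_upwards [h0] with q hq
      simp [hq]
    rw [dirDeriv, this.fderiv_eq, h0.self_of_nhds]; simp

theorem waveOp_cutoff (hT : 0 < T) {η : ℝ → ℝ} (hη : ContDiff ℝ ∞ η) (hs : tsupport η ⊆ Ioo 0 T)
    (hh : ContDiffOn ℝ ∞ h (slab T)) (p : ℝ × E3) :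
    waveOp (fun p => η p.1 * h p) p =
      dirDeriv timeDir (dirDeriv timeDir fun p => η p.1 * h p) p -
        η p.1 * slabLaplacian T h p := by
  rw [waveOp, slabLaplacian, Finset.mul_sum]
  congr 1
  refine Finset.sum_congr rfl fun i _ => ?_
  rw [dirDeriv_cutoff hη hs hh, dirDeriv_cutoff hη hs (contDiffOn_slabDeriv hT hh _)]

/-! #### The retarded potential on the whole space -/

/-- The retarded potential. -/
noncomputable def retarded (φ : ℝ × E3 → ℝ) (p : ℝ × E3) : ℝ :=
  ∫ y, newtonWeight y * φ (p.1 - ‖y‖, p.2 + y)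

theorem integrable_retarded {φ : ℝ × E3 → ℝ} (hφ : Continuous φ) {K : Set E3} (hK : IsCompact K)
    (h0 : ∀ q : ℝ × E3, q.2 ∉ K → φ q = 0) (p : ℝ × E3) :
    Integrable fun y => newtonWeight y * φ (p.1 - ‖y‖, p.2 + y) := by
  obtain ⟨C, R, -, hC, hR⟩ := conePoint_bound hφ hK h0 p
  simp only [← conePoint_zero]
  have hm : Continuous fun y => φ (conePoint p 0 y) :=
    hφ.comp ((continuous_conePoint p).comp (.prodMk_right 0))
  refine (((integrableOn_newtonWeight R).integrable_indicator measurableSet_ball).mul_const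
    C).mono' ?_ (.of_forall fun y => ?_)
  · refine AEStronglyMeasurable.mul ?_ hm.aestronglyMeasurable
    exact (by unfold newtonWeight; fun_prop : Measurable newtonWeight).aestronglyMeasurable
  · rw [Real.norm_eq_abs, abs_mul, abs_of_nonneg (newtonWeight_nonneg y)]
    by_cases hy : y ∈ ball (0 : E3) R
    · rw [indicator_of_mem hy]
      exact mul_le_mul_of_nonneg_left (hC 0 (by simp) y) (newtonWeight_nonneg y)
    · rw [indicator_of_notMem hy, hR 0 y (by simpa using hy)]; simp

/-- Substitute $y\mapsto ty$: the Jacobian $t^3$ and the weight $t^{-1}$ give the factor $t^2$. The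
part $|y|\ge1$ sees only times $t(1-|y|)\le0$, where `φ` vanishes. -/
theorem retarded_eq_duhamel {φ : ℝ × E3 → ℝ} (h0 : ∀ q : ℝ × E3, q.1 ≤ 0 → φ q = 0)
    {p : ℝ × E3} (hp : 0 ≤ p.1) : retarded φ p = duhamel φ p := by
  rcases hp.eq_or_lt with hp | hp
  · simp only [retarded, duhamel, ← hp]
    simp [fun y : E3 => h0 (-‖y‖, p.2 + y) (by simp)]
  · have h := Measure.integral_comp_smul (volume : Measure E3)
      (fun y => newtonWeight y * φ (p.1 - ‖y‖, p.2 + y)) p.1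
    rw [finrank_E3, abs_of_pos (by positivity), smul_eq_mul,
      eq_inv_mul_iff_mul_eq₀ (by positivity)] at h
    rw [retarded, ← h, duhamel, ← integral_indicator measurableSet_ball, ← integral_const_mul,
      ← integral_const_mul]
    refine integral_congr_ae (.of_forall fun y => ?_)
    simp only [norm_smul, Real.norm_of_nonneg hp.le]
    by_cases hy : y ∈ ball (0 : E3) 1
    · rw [indicator_of_mem hy, coneMap_apply]
      simp only [newtonWeight, norm_smul, Real.norm_of_nonneg hp.le, mul_one_sub, mul_inv]
      field_simp
    · rw [indicator_of_notMem hy, h0]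
      · simp
      · have : 1 ≤ ‖y‖ := by simpa using hy
        simp only; nlinarith

end Duhamel

end VlasovMaxwell

namespace VlasovMaxwell

/-! ### The wave equation for Duhamel's formula, up to the boundary of the slab -/

section DuhamelEquation

variable {T : ℝ} {h : ℝ × E3 → ℝ}

theorem hasDerivAt_time_slice {k : ℝ × E3 → ℝ} (hk : Differentiable ℝ k) (r s : ℝ) (x : E3) :
    HasDerivAt (fun s => k (s - r, x)) (dirDeriv timeDir k (s - r, x)) s :=
  (hk (s - r, x)).hasFDerivAt.comp_hasDerivAt s
    (((hasDerivAt_id s).sub_const r).prodMk (hasDerivAt_const s x))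

/-- Taylor's formula with integral remainder, shifted by `r`: the boundary terms at $s=0$ are values
at time $-r\le0$ and vanish. -/
theorem integral_time_taylor {k : ℝ × E3 → ℝ} (hk : ContDiff ℝ ∞ k)
    (h0 : ∀ q : ℝ × E3, q.1 ≤ 0 → k q = 0)
    (h1 : ∀ q : ℝ × E3, q.1 ≤ 0 → dirDeriv timeDir k q = 0) {r : ℝ} (hr : 0 ≤ r) (t : ℝ) (x : E3) :
    ∫ s in (0 : ℝ)..t, (t - s) * dirDeriv timeDir (dirDeriv timeDir k) (s - r, x) =
      k (t - r, x) := by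
  have hk1 := contDiff_dirDeriv hk timeDir
  have hk2 := contDiff_dirDeriv hk1 timeDir
  have hd : ∀ s ∈ uIcc 0 t, HasDerivAt
      (fun s => (t - s) * dirDeriv timeDir k (s - r, x) + k (s - r, x))
      ((t - s) * dirDeriv timeDir (dirDeriv timeDir k) (s - r, x)) s := by
    intro s _
    convert! (((hasDerivAt_id s).const_sub t).mul
      (hasDerivAt_time_slice (hk1.differentiable (by simp)) r s x)).add
      (hasDerivAt_time_slice (hk.differentiable (by simp)) r s x) using 1
    simp
  rw [intervalIntegral.integral_eq_sub_of_hasDerivAt hd]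
  · simp [h0 (-r, x) (by simpa using hr), h1 (-r, x) (by simpa using hr)]
  · have := hk2.continuous
    exact Continuous.intervalIntegrable (by fun_prop) _ _

theorem integral_time_retarded {φ : ℝ × E3 → ℝ} (hφ : Continuous φ) {K : Set E3}
    (hK : IsCompact K) (h0 : ∀ q : ℝ × E3, q.2 ∉ K → φ q = 0) {C : ℝ} (hC : ∀ q, |φ q| ≤ C)
    {t : ℝ} (ht : 0 ≤ t) (x : E3) :
    ∫ s in (0 : ℝ)..t, (t - s) * retarded φ (s, x) =
      ∫ y, newtonWeight y * ∫ s in (0 : ℝ)..t, (t - s) * φ (s - ‖y‖, x + y) := by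
  obtain ⟨R, hR⟩ : ∃ R : ℝ, ∀ y : E3, R ≤ ‖y‖ → x + y ∉ K := by
    obtain ⟨R, hR⟩ := hK.isBounded.exists_norm_le
    refine ⟨R + ‖x‖ + 1, fun y hy hmem => ?_⟩
    have h2 : ‖y‖ ≤ ‖x + y‖ + ‖x‖ := by simpa using norm_sub_le (x + y) x
    linarith [hR _ hmem]
  have hwm : Measurable newtonWeight := by unfold newtonWeight; fun_prop
  simp only [retarded, ← integral_const_mul, intervalIntegral.integral_of_le ht]
  rw [integral_integral_swap]
  · simp only [mul_left_comm]
  have hb := ((integrableOn_newtonWeight R).integrable_indicator measurableSet_ball).const_mul (t * C)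
  refine (hb.comp_snd (volume.restrict (Ioc 0 t))).mono' ?_ ?_
  · refine AEStronglyMeasurable.mul (Continuous.aestronglyMeasurable (by fun_prop)) (.mul ?_ ?_)
    · exact (hwm.comp measurable_snd).aestronglyMeasurable
    · exact Continuous.aestronglyMeasurable (by fun_prop)
  · have : ∀ᵐ z ∂((volume.restrict (Ioc 0 t)).prod (volume : Measure E3)), z.1 ∈ Ioc 0 t :=
      Measure.quasiMeasurePreserving_fst.ae (ae_restrict_mem measurableSet_Ioc)
    filter_upwards [this] with z hz
    simp only [Function.uncurry, Real.norm_eq_abs]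
    by_cases hy : z.2 ∈ ball (0 : E3) R
    · rw [indicator_of_mem hy, abs_mul, abs_mul, abs_of_nonneg (newtonWeight_nonneg _),
        abs_of_nonneg (by linarith [hz.2])]
      have h1 := newtonWeight_nonneg z.2
      calc (t - z.1) * (newtonWeight z.2 * |φ (z.1 - ‖z.2‖, x + z.2)|)
          ≤ t * (newtonWeight z.2 * C) := by
            refine mul_le_mul (by linarith [hz.1]) (mul_le_mul_of_nonneg_left (hC _) h1)
              (by positivity) ht
        _ = t * C * newtonWeight z.2 := by ring
    · rw [indicator_of_notMem hy, h0 _ (hR _ (by simpa using hy))]; simp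

/-- Let $k=\eta h$ and let $R$ be the retarded potential. From $R[\Box k]=k$ and $\Box
k=\partial_t^2k-\eta\Delta h$ follows $R[\partial_t^2k]=D[\eta\Delta h]+k$. Integrating against
$t-s$ and using Fubini and `integral_time_taylor`, the left side becomes $R[k]=D[k]$. The result
contains no derivative of `η`, so the cut-off can be removed in the limit. -/
theorem duhamel_cutoff_eq (hT : 0 < T) (hh : IsTestOn (slab T) h) {η : ℝ → ℝ}
    (hη : ContDiff ℝ ∞ η) (hs : tsupport η ⊆ Ioo 0 T) {t : ℝ} (ht : t ∈ Icc 0 T) (x : E3) :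
    duhamel (fun p => η p.1 * h p) (t, x) = ∫ s in (0 : ℝ)..t, (t - s) *
      (duhamel (fun p => η p.1 * slabLaplacian T h p) (s, x) + η s * h (s, x)) := by
  obtain ⟨K₀, hK₀, hK0⟩ := hh.support
  set K : Set E3 := Prod.snd '' K₀ with hKdef
  have hK : IsCompact K := hK₀.image continuous_snd
  set k : ℝ × E3 → ℝ := fun p => η p.1 * h p with hkdef
  have hk : ContDiff ℝ ∞ k := contDiff_cutoff hη hs hh.smooth
  have hη0 : ∀ s, s ∉ Ioo 0 T → η s = 0 := fun s hs' =>
    image_eq_zero_of_notMem_tsupport fun h => hs' (hs h)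
  have h0 : ∀ q : ℝ × E3, q.2 ∉ K → k q = 0 := by
    intro q hq
    by_cases hqT : q.1 ∈ Ioo 0 T
    · simp only [hkdef]
      rw [hK0 q ⟨Ioo_subset_Icc_self hqT, mem_univ _⟩ fun h => hq ⟨q, h, rfl⟩, mul_zero]
    · simp [hkdef, hη0 _ hqT]
  have hz := fun v => dirDeriv_eq_zero hK.isClosed h0 v
  have hz2 := dirDeriv_eq_zero hK.isClosed (hz timeDir) timeDir
  have hneg : ∀ q : ℝ × E3, q.1 ≤ 0 → k q = 0 := fun q hq => by
    simp [hkdef, hη0 q.1 fun h => absurd h.1 (not_lt.2 hq)]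
  have hout : ∀ q : ℝ × E3, q.1 ∉ Ioo 0 T → k =ᶠ[𝓝 q] fun _ => 0 := fun q hq => by
    filter_upwards [cutoff_eventually_zero hs hq] with z hz
    simp [hkdef, hz]
  have hneg1 : ∀ q : ℝ × E3, q.1 ≤ 0 → dirDeriv timeDir k q = 0 := fun q hq => by
    rw [dirDeriv, (hout q fun h => absurd h.1 (not_lt.2 hq)).fderiv_eq]; simp
  have hk2 := contDiff_dirDeriv (contDiff_dirDeriv hk timeDir) timeDir
  have hcs : HasCompactSupport k := by
    refine HasCompactSupport.intro (isCompact_Icc.prod hK : IsCompact (Icc 0 T ×ˢ K)) fun q hq => ?_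
    by_cases hqT : q.1 ∈ Ioo 0 T
    · exact h0 q fun h => hq ⟨Ioo_subset_Icc_self hqT, h⟩
    · simp [hkdef, hη0 _ hqT]
  have hcd : ∀ {g : ℝ × E3 → ℝ}, HasCompactSupport g → HasCompactSupport (dirDeriv timeDir g) :=
    fun hg => (hg.fderiv ℝ).comp_left (g := fun L : ℝ × E3 →L[ℝ] ℝ => L timeDir) (by simp)
  obtain ⟨C, hC⟩ := hk2.continuous.bounded_above_of_compact_support (hcd (hcd hcs))
  have hΔ := hh.slabLaplacian hT
  have hL : ContDiff ℝ ∞ fun p : ℝ × E3 => η p.1 * slabLaplacian T h p :=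
    contDiff_cutoff hη hs hΔ.smooth
  have hLe : (fun p : ℝ × E3 => η p.1 * slabLaplacian T h p) = fun p =>
      dirDeriv timeDir (dirDeriv timeDir k) p - waveOp k p := by
    funext p; rw [waveOp_cutoff hT hη hs hh.smooth]; ring
  have hL0 : ∀ q : ℝ × E3, q.2 ∉ K → η q.1 * slabLaplacian T h q = 0 := fun q hq => by
    rw [congrFun hLe q, hz2 q hq, waveOp_eq_zero hK.isClosed h0 q hq, sub_zero]
  have hLneg : ∀ q : ℝ × E3, q.1 ≤ 0 → η q.1 * slabLaplacian T h q = 0 := fun q hq => by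
    simp [hη0 q.1 fun h => absurd h.1 (not_lt.2 hq)]
  -- The cut-off source vanishes at nonpositive times, so its Duhamel integral is a retarded
  -- potential and can be added to that of `waveOp k`.
  have hpt : ∀ s, 0 ≤ s → duhamel (fun p => η p.1 * slabLaplacian T h p) (s, x) + η s * h (s, x) =
      retarded (dirDeriv timeDir (dirDeriv timeDir k)) (s, x) := by
    intro s hs0
    have hid : ∫ y, newtonWeight y * waveOp k (s - ‖y‖, x + y) = k (s, x) :=
      integral_retarded_waveOp hk hK h0 (s, x)
    rw [← retarded_eq_duhamel hLneg hs0, show η s * h (s, x) = k (s, x) from rfl, ← hid, retarded,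
      retarded, ← integral_add (integrable_retarded hL.continuous hK hL0 (s, x))
        (integrable_retarded (contDiff_waveOp hk).continuous hK (waveOp_eq_zero hK.isClosed h0) (s, x))]
    refine integral_congr_ae (.of_forall fun y => ?_)
    simp only
    rw [congrFun hLe (s - ‖y‖, x + y)]
    ring
  have hint : ∫ s in (0 : ℝ)..t, (t - s) *
      (duhamel (fun p => η p.1 * slabLaplacian T h p) (s, x) + η s * h (s, x)) =
      ∫ s in (0 : ℝ)..t, (t - s) * retarded (dirDeriv timeDir (dirDeriv timeDir k)) (s, x) := by
    refine intervalIntegral.integral_congr fun s hs' => ?_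
    rw [uIcc_of_le ht.1] at hs'
    simp only [hpt s hs'.1]
  rw [hint, integral_time_retarded hk2.continuous hK hz2 (fun q => hC q) ht.1,
    ← retarded_eq_duhamel hneg ht.1, retarded]
  refine integral_congr_ae (.of_forall fun y => ?_)
  simp only
  rw [integral_time_taylor hk hneg hneg1 (norm_nonneg y)]

theorem abs_duhamel_le {φ : ℝ × E3 → ℝ} {C : ℝ} (hC : ∀ p ∈ slab T, |φ p| ≤ C)
    {p : ℝ × E3} (hp : p ∈ slab T) :
    |duhamel φ p| ≤ T ^ 2 * ∫ y in ball (0 : E3) 1, newtonWeight y * C := by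
  have hC0 : 0 ≤ C := (abs_nonneg _).trans (hC p hp)
  have h1 : |∫ y in ball (0 : E3) 1, newtonWeight y * φ (coneMap y p)| ≤
      ∫ y in ball (0 : E3) 1, newtonWeight y * C := by
    rw [← Real.norm_eq_abs]
    refine norm_integral_le_of_norm_le ((integrableOn_newtonWeight 1).mul_const C) ?_
    filter_upwards [ae_restrict_mem measurableSet_ball] with y hy
    rw [Real.norm_eq_abs, abs_mul, abs_of_nonneg (newtonWeight_nonneg y)]
    exact mul_le_mul_of_nonneg_left (hC _ (coneMap_mem hy hp)) (newtonWeight_nonneg y)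
  have h2 : p.1 ^ 2 ≤ T ^ 2 := pow_le_pow_left₀ hp.1.1 hp.1.2 2
  rw [duhamel, abs_mul, abs_of_nonneg (sq_nonneg p.1)]
  exact mul_le_mul h2 h1 (abs_nonneg _) (sq_nonneg T)

theorem tendsto_duhamel_cutoff {φ : ℝ × E3 → ℝ} (hφ : IsTestOn (slab T) φ) {η : ℕ → ℝ → ℝ}
    (hη : ∀ n, ContDiff ℝ ∞ (η n)) (hb : ∀ n s, |η n s| ≤ 1)
    (hlim : ∀ s ∈ Ioo 0 T, ∀ᶠ n in atTop, η n s = 1) {p : ℝ × E3} (hp : p ∈ slab T) :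
    Tendsto (fun n => duhamel (fun q => η n q.1 * φ q) p) atTop (𝓝 (duhamel φ p)) := by
  rcases hp.1.1.eq_or_lt with h0 | h0
  · simp [duhamel, ← h0]
  obtain ⟨C, hC⟩ := hφ.exists_bound (isClosed_slab T)
  refine tendsto_const_nhds.mul ?_
  refine tendsto_integral_of_dominated_convergence (fun y => newtonWeight y * C) (fun n => ?_)
    ((integrableOn_newtonWeight 1).mul_const C) (fun n => ?_) ?_
  · exact (integrableOn_cone (hφ.smooth_smul ((hη n).comp contDiff_fst).contDiffOn)
      hp).aestronglyMeasurable
  · filter_upwards [ae_restrict_mem measurableSet_ball] with y hy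
    rw [Real.norm_eq_abs, abs_mul, abs_mul, abs_of_nonneg (newtonWeight_nonneg y)]
    refine mul_le_mul_of_nonneg_left ?_ (newtonWeight_nonneg y)
    calc _ ≤ 1 * C := mul_le_mul (hb n _) (hC _ (coneMap_mem hy hp)) (abs_nonneg _) zero_le_one
      _ = C := one_mul C
  -- For $t>0$ and $0<|y|<1$ the time $t(1-|y|)$ is interior, where the cut-offs are eventually 1.
  -- The origin must be excluded: it gives time $t$, which may equal $T$.
  · have hae : ∀ᵐ y : E3 ∂(volume.restrict (ball 0 1)), y ≠ 0 :=
      ae_restrict_of_ae (by simp [ae_iff])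
    filter_upwards [ae_restrict_mem measurableSet_ball, hae] with y hy hy0
    have hy1 : ‖y‖ < 1 := by simpa using hy
    have hy2 : 0 < ‖y‖ := norm_pos_iff.2 hy0
    have : (coneMap y p).1 ∈ Ioo 0 T := by
      rw [coneMap_apply]
      have := hp.1.2
      constructor <;> simp only <;> nlinarith
    refine tendsto_const_nhds.congr' ?_
    filter_upwards [hlim _ this] with n hn
    rw [hn, one_mul]

theorem duhamel_eq_integral (hT : 0 < T) (hh : IsTestOn (slab T) h) {t : ℝ} (ht : t ∈ Icc 0 T)
    (x : E3) : duhamel h (t, x) = ∫ s in (0 : ℝ)..t, (t - s) *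
      (duhamel (slabLaplacian T h) (s, x) + h (s, x)) := by
  obtain ⟨η, hη, hs, hb, hlim⟩ := exists_time_cutoff hT
  have hΔ := hh.slabLaplacian hT
  obtain ⟨C, hC⟩ := hh.exists_bound (isClosed_slab T)
  obtain ⟨D, hD⟩ := hΔ.exists_bound (isClosed_slab T)
  have hsub : uIoc 0 t ⊆ Icc 0 T := by
    rw [uIoc_of_le ht.1]
    exact fun s hs => ⟨hs.1.le, hs.2.trans ht.2⟩
  refine tendsto_nhds_unique (tendsto_duhamel_cutoff hh hη hb hlim (mem_slab ht x)) ?_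
  simp only [fun n => duhamel_cutoff_eq hT hh (hη n) (hs n) ht x]
  refine intervalIntegral.tendsto_integral_filter_of_dominated_convergence
    (fun _ => t * (T ^ 2 * (∫ y in ball (0 : E3) 1, newtonWeight y * D) + C)) ?_ ?_ (by simp) ?_
  · refine .of_forall fun n => ?_
    have hc : ContinuousOn (fun s => (t - s) *
        (duhamel (fun p => η n p.1 * slabLaplacian T h p) (s, x) + η n s * h (s, x)))
        (Icc 0 T) := by
      have h1 := (contDiffOn_duhamel hT
        (hΔ.smooth_smul ((hη n).comp contDiff_fst).contDiffOn)).continuousOn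
      have h2 : ContinuousOn (fun s : ℝ => (s, x)) (Icc 0 T) := by fun_prop
      have h3 : MapsTo (fun s : ℝ => (s, x)) (Icc 0 T) (slab T) := fun s hs => mem_slab hs x
      exact ContinuousOn.mul (by fun_prop) ((h1.comp h2 h3).add
        ((hη n).continuous.continuousOn.mul (hh.smooth.continuousOn.comp h2 h3)))
    exact (hc.mono hsub).aestronglyMeasurable measurableSet_uIoc
  · refine .of_forall fun n => .of_forall fun s hs' => ?_
    have hsT := hsub hs'
    rw [uIoc_of_le ht.1] at hs'
    rw [Real.norm_eq_abs, abs_mul, abs_of_nonneg (by linarith [hs'.2])]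
    refine mul_le_mul (by linarith [hs'.1]) ((abs_add_le _ _).trans (add_le_add ?_ ?_))
      (abs_nonneg _) ht.1
    · refine abs_duhamel_le (fun p hp => ?_) (mem_slab hsT x)
      rw [abs_mul, ← one_mul D]
      exact mul_le_mul (hb n _) (hD p hp) (abs_nonneg _) zero_le_one
    · rw [abs_mul, ← one_mul C]
      exact mul_le_mul (hb n _) (hC _ (mem_slab hsT x)) (abs_nonneg _) zero_le_one
  -- All cut-offs vanish at $s=T$, a null set for the time integral.
  · have hae : ∀ᵐ s : ℝ, s ≠ T := by simp [ae_iff]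
    filter_upwards [hae] with s hsT' hs'
    have hsT := hsub hs'
    rw [uIoc_of_le ht.1] at hs'
    refine tendsto_const_nhds.mul ((tendsto_duhamel_cutoff hΔ hη hb hlim (mem_slab hsT x)).add ?_)
    refine tendsto_const_nhds.congr' ?_
    filter_upwards [hlim s ⟨hs'.1, lt_of_le_of_ne hsT.2 hsT'⟩] with n hn
    rw [hn, one_mul]

theorem hasDerivWithinAt_double_integral (hT : 0 < T) {G : ℝ → ℝ} (hG : ContinuousOn G (Icc 0 T))
    {t : ℝ} (ht : t ∈ Icc 0 T) :
    HasDerivWithinAt (fun t => ∫ s in (0 : ℝ)..t, (t - s) * G s) (∫ s in (0 : ℝ)..t, G s)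
      (Icc 0 T) t ∧
    HasDerivWithinAt (fun t => ∫ s in (0 : ℝ)..t, G s) (G t) (Icc 0 T) t := by
  -- Extension by the end point values makes the integrand continuous on the line, so that the
  -- two-sided fundamental theorem of calculus applies at 0 and `T` as well.
  set H : ℝ → ℝ := IccExtend hT.le ((Icc 0 T).domRestrict G) with hHdef
  have hH : Continuous H := (continuousOn_iff_continuous_domRestrict.1 hG).Icc_extend'
  have hHG : ∀ s ∈ Icc 0 T, H s = G s := fun s hs => by
    rw [hHdef, IccExtend_of_mem _ _ hs]; rfl
  have hsub : ∀ t ∈ Icc 0 T, uIcc 0 t ⊆ Icc 0 T := fun t ht => by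
    rw [uIcc_of_le ht.1]; exact Icc_subset_Icc_right ht.2
  have e1 : ∀ t ∈ Icc 0 T, ∫ s in (0 : ℝ)..t, G s = ∫ s in (0 : ℝ)..t, H s := fun t ht =>
    intervalIntegral.integral_congr fun s hs => (hHG s (hsub t ht hs)).symm
  have hsH : Continuous fun s => s * H s := continuous_id.mul hH
  have e2 : ∀ t ∈ Icc 0 T, ∫ s in (0 : ℝ)..t, (t - s) * G s =
      t * (∫ s in (0 : ℝ)..t, H s) - ∫ s in (0 : ℝ)..t, s * H s := fun t ht => by
    rw [← intervalIntegral.integral_const_mul, ← intervalIntegral.integral_sub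
      ((hH.const_mul t).intervalIntegrable _ _) (hsH.intervalIntegrable _ _)]
    refine intervalIntegral.integral_congr fun s hs => ?_
    simp only [hHG s (hsub t ht hs)]; ring
  have hd1 : HasDerivAt (fun t => ∫ s in (0 : ℝ)..t, H s) (H t) t :=
    intervalIntegral.integral_hasDerivAt_right (hH.intervalIntegrable _ _)
      hH.stronglyMeasurable.stronglyMeasurableAtFilter hH.continuousAt
  have hd2 : HasDerivAt (fun t => ∫ s in (0 : ℝ)..t, s * H s) (t * H t) t :=
    intervalIntegral.integral_hasDerivAt_right (hsH.intervalIntegrable _ _)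
      hsH.stronglyMeasurable.stronglyMeasurableAtFilter hsH.continuousAt
  constructor
  · refine HasDerivWithinAt.congr ?_ e2 (e2 t ht)
    have := (((hasDerivAt_id t).mul hd1).sub hd2).hasDerivWithinAt (s := Icc 0 T)
    rw [e1 t ht]
    convert! this using 1
    simp
  · rw [← hHG t ht]
    exact hd1.hasDerivWithinAt.congr e1 (e1 t ht)

/-- Duhamel's formula solves the wave equation, up to the boundary of the slab. -/
theorem slabDeriv_timeDir_timeDir_duhamel (hT : 0 < T) (hh : IsTestOn (slab T) h) {p : ℝ × E3}
    (hp : p ∈ slab T) : slabDeriv T timeDir (slabDeriv T timeDir (duhamel h)) p =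
      slabLaplacian T (duhamel h) p + h p := by
  obtain ⟨t, x⟩ := p
  have ht : t ∈ Icc 0 T := hp.1
  have hu := uniqueDiffOn_Icc hT
  have hS := contDiffOn_duhamel hT hh
  have hcont : ContinuousOn (fun s => duhamel (slabLaplacian T h) (s, x) + h (s, x)) (Icc 0 T) := by
    have h2 : ContinuousOn (fun s : ℝ => (s, x)) (Icc 0 T) := by fun_prop
    have h3 : MapsTo (fun s : ℝ => (s, x)) (Icc 0 T) (slab T) := fun s hs => mem_slab hs x
    exact ((contDiffOn_duhamel hT (hh.slabLaplacian hT)).continuousOn.comp h2 h3).add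
      (hh.smooth.continuousOn.comp h2 h3)
  -- The integral equation is differentiated twice; one-sided derivatives within the interval are
  -- unique, so they agree with the slab derivatives, end points included.
  have h1 : ∀ s ∈ Icc 0 T, slabDeriv T timeDir (duhamel h) (s, x) =
      ∫ r in (0 : ℝ)..s, (duhamel (slabLaplacian T h) (r, x) + h (r, x)) := by
    intro s hs
    refine (hu s hs).eq_deriv _ (hasDerivWithinAt_slabDeriv (hS.differentiableOn (by simp)) hs x) ?_
    exact (hasDerivWithinAt_double_integral hT hcont hs).1.congr
      (fun r hr => duhamel_eq_integral hT hh hr x) (duhamel_eq_integral hT hh hs x)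
  refine (hu t ht).eq_deriv _ (hasDerivWithinAt_slabDeriv
    ((contDiffOn_slabDeriv hT hS _).differentiableOn (by simp)) ht x) ?_
  rw [slabLaplacian_duhamel hT hh hp]
  exact (hasDerivWithinAt_double_integral hT hcont ht).2.congr h1 (h1 t ht)

end DuhamelEquation

end VlasovMaxwell

namespace VlasovMaxwell

/-! ### Uniqueness of classical solutions of the wave equation -/

section Energy

variable {T : ℝ} {F G : ℝ × E3 → ℝ} {K : Set E3}

/-- The open slab. -/
def openSlab (T : ℝ) : Set (ℝ × E3) := Ioo 0 T ×ˢ univ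

theorem isOpen_openSlab (T : ℝ) : IsOpen (openSlab T) := isOpen_Ioo.prod isOpen_univ

theorem continuousOn_dirDeriv (hF : ContDiffOn ℝ 1 F (openSlab T)) (v : ℝ × E3) :
    ContinuousOn (dirDeriv v F) (openSlab T) :=
  (hF.continuousOn_fderiv_of_isOpen (isOpen_openSlab T) le_rfl).clm_apply continuousOn_const

theorem dirDeriv_eq_zero_of_openSlab (hK : IsCompact K)
    (h0 : ∀ p ∈ openSlab T, p.2 ∉ K → F p = 0) (v : ℝ × E3) :
    ∀ p ∈ openSlab T, p.2 ∉ K → dirDeriv v F p = 0 := by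
  intro p hp hpK
  have : F =ᶠ[𝓝 p] fun _ => 0 := by
    filter_upwards [(isOpen_openSlab T).mem_nhds hp,
      continuous_snd.continuousAt.preimage_mem_nhds (hK.isClosed.isOpen_compl.mem_nhds hpK)]
      with q hq hqK using h0 q hq hqK
  rw [dirDeriv, this.fderiv_eq]; simp

theorem continuous_slice_openSlab (hF : ContinuousOn F (openSlab T)) {t : ℝ} (ht : t ∈ Ioo 0 T) :
    Continuous fun x => F (t, x) :=
  hF.comp_continuous (by fun_prop) fun x => ⟨ht, mem_univ _⟩

theorem hasCompactSupport_slice (hK : IsCompact K) (h0 : ∀ p ∈ openSlab T, p.2 ∉ K → F p = 0)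
    {t : ℝ} (ht : t ∈ Ioo 0 T) : HasCompactSupport fun x => F (t, x) :=
  HasCompactSupport.intro hK fun x hx => h0 (t, x) ⟨ht, mem_univ _⟩ hx

theorem integrable_slice_openSlab (hF : ContinuousOn F (openSlab T)) (hK : IsCompact K)
    (h0 : ∀ p ∈ openSlab T, p.2 ∉ K → F p = 0) {t : ℝ} (ht : t ∈ Ioo 0 T) :
    Integrable fun x => F (t, x) :=
  (continuous_slice_openSlab hF ht).integrable_of_hasCompactSupport
    (hasCompactSupport_slice hK h0 ht)

theorem hasDerivAt_time (hF : ContDiffOn ℝ 1 F (openSlab T)) {p : ℝ × E3} (hp : p ∈ openSlab T) :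
    HasDerivAt (fun s => F (s, p.2)) (dirDeriv timeDir F p) p.1 :=
  ((hF.contDiffAt ((isOpen_openSlab T).mem_nhds hp)).differentiableAt
    (by simp)).hasFDerivAt.comp_hasDerivAt p.1
    ((hasDerivAt_id p.1).prodMk (hasDerivAt_const p.1 p.2))

theorem hasDerivAt_integral_slice (hF : ContDiffOn ℝ 1 F (openSlab T)) (hK : IsCompact K)
    (h0 : ∀ p ∈ openSlab T, p.2 ∉ K → F p = 0) {t : ℝ} (ht : t ∈ Ioo 0 T) :
    HasDerivAt (fun s => ∫ x, F (s, x)) (∫ x, dirDeriv timeDir F (t, x)) t := by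
  -- The time derivative is controlled only in the open slab; a compact window around `t` provides
  -- the uniform bound.
  obtain ⟨a, ha0, hat⟩ := exists_between ht.1
  obtain ⟨b, htb, hbT⟩ := exists_between ht.2
  have hsub : ∀ s ∈ Icc a b, s ∈ Ioo 0 T := fun s hs => ⟨ha0.trans_le hs.1, hs.2.trans_lt hbT⟩
  have hD := continuousOn_dirDeriv hF timeDir
  have hD0 := dirDeriv_eq_zero_of_openSlab hK h0 timeDir
  obtain ⟨C, hC⟩ := ((isCompact_Icc (a := a) (b := b)).prod hK).exists_bound_of_continuousOn
    (hD.mono fun p hp => ⟨hsub p.1 hp.1, mem_univ _⟩)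
  refine (hasDerivAt_integral_of_dominated_loc_of_deriv_le (F := fun s x => F (s, x))
    (F' := fun s x => dirDeriv timeDir F (s, x)) (bound := K.indicator fun _ => C)
    (Icc_mem_nhds hat htb) ?_ (integrable_slice_openSlab hF.continuousOn hK h0 ht)
    (continuous_slice_openSlab hD ht).aestronglyMeasurable ?_ ?_ ?_).2
  · filter_upwards [Icc_mem_nhds hat htb] with s hs
    exact (continuous_slice_openSlab hF.continuousOn (hsub s hs)).aestronglyMeasurable
  · refine .of_forall fun x s hs => ?_
    by_cases hx : x ∈ K
    · rw [indicator_of_mem hx]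
      exact hC (s, x) ⟨hs, hx⟩
    · rw [indicator_of_notMem hx, hD0 (s, x) ⟨hsub s hs, mem_univ _⟩ hx, norm_zero]
  · exact (integrable_indicator_iff hK.measurableSet).2
      (integrableOn_const hK.measure_lt_top.ne)
  · exact .of_forall fun x s hs => hasDerivAt_time hF (p := (s, x)) ⟨hsub s hs, mem_univ _⟩

theorem contDiff_slice_openSlab {n : WithTop ℕ∞} (hF : ContDiffOn ℝ n F (openSlab T)) {t : ℝ}
    (ht : t ∈ Ioo 0 T) : ContDiff ℝ n fun x => F (t, x) :=
  hF.comp_contDiff (by fun_prop) fun x => ⟨ht, mem_univ _⟩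

theorem partialDeriv_openSlab (hF : ContDiffOn ℝ 1 F (openSlab T)) {p : ℝ × E3}
    (hp : p ∈ openSlab T) (i : Fin 3) :
    partialDeriv i (fun y => F (p.1, y)) p.2 = dirDeriv (spaceDir i) F p := by
  have h1 := ((hF.contDiffAt ((isOpen_openSlab T).mem_nhds hp)).differentiableAt
    (by simp)).hasFDerivAt
  have h2 : HasFDerivAt (fun y : E3 => (p.1, y)) (ContinuousLinearMap.inr ℝ ℝ E3) p.2 :=
    hasFDerivAt_prodMk_right p.1 p.2
  have h3 : HasFDerivAt (fun y : E3 => F (p.1, y)) _ p.2 := h1.comp p.2 h2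
  rw [partialDeriv, h3.fderiv]; rfl

theorem integral_dirDeriv_spaceDir (hF : ContDiffOn ℝ 1 F (openSlab T)) (hK : IsCompact K)
    (h0 : ∀ p ∈ openSlab T, p.2 ∉ K → F p = 0) {t : ℝ} (ht : t ∈ Ioo 0 T) (i : Fin 3) :
    ∫ x, dirDeriv (spaceDir i) F (t, x) = 0 := by
  rw [← integral_fderiv_eq_zero (contDiff_slice_openSlab hF ht) (hasCompactSupport_slice hK h0 ht)
    (EuclideanSpace.single i 1)]
  exact integral_congr_ae (.of_forall fun x =>
    (partialDeriv_openSlab hF (p := (t, x)) ⟨ht, mem_univ _⟩ i).symm)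

theorem dirDeriv_mul {p : ℝ × E3} (hF : DifferentiableAt ℝ F p) (hG : DifferentiableAt ℝ G p)
    (v : ℝ × E3) :
    dirDeriv v (fun q => F q * G q) p = dirDeriv v F p * G p + F p * dirDeriv v G p := by
  have : HasFDerivAt (fun q => F q * G q) _ p := hF.hasFDerivAt.mul hG.hasFDerivAt
  rw [dirDeriv, this.fderiv]; simp [dirDeriv]; ring

theorem dirDeriv_add {p : ℝ × E3} (hF : DifferentiableAt ℝ F p) (hG : DifferentiableAt ℝ G p)
    (v : ℝ × E3) : dirDeriv v (fun q => F q + G q) p = dirDeriv v F p + dirDeriv v G p := by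
  rw [dirDeriv, fderiv_fun_add hF hG]; rfl

/-- The profile of the energy cut-off is nonincreasing along the backward light cone. -/
noncomputable def coneCutoff (T : ℝ) (x₀ : E3) (p : ℝ × E3) : ℝ :=
  expNegInvGlue (T + 2 - p.1 - √(1 ^ 2 + ‖p.2 - x₀‖ ^ 2))

theorem contDiff_coneCutoff (T : ℝ) (x₀ : E3) : ContDiff ℝ ∞ (coneCutoff T x₀) :=
  (expNegInvGlue.contDiff (n := ⊤)).comp ((contDiff_const.sub contDiff_fst).sub
    ((contDiff_sqrt_cone one_pos).comp (contDiff_snd.sub contDiff_const)))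

theorem deriv_expNegInvGlue_nonneg (z : ℝ) : 0 ≤ deriv expNegInvGlue z :=
  expNegInvGlue.monotone.deriv_nonneg

theorem dirDeriv_timeDir_coneCutoff (T : ℝ) (x₀ : E3) (p : ℝ × E3) :
    dirDeriv timeDir (coneCutoff T x₀) p =
      -deriv expNegInvGlue (T + 2 - p.1 - √(1 ^ 2 + ‖p.2 - x₀‖ ^ 2)) := by
  have h1 := (((contDiff_coneCutoff T x₀).differentiable (by simp) p).hasFDerivAt).comp_hasDerivAt
    p.1 ((hasDerivAt_id p.1).prodMk (hasDerivAt_const p.1 p.2))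
  have h2 := ((expNegInvGlue.contDiff (n := ⊤)).differentiable (by simp)
    (T + 2 - p.1 - √(1 ^ 2 + ‖p.2 - x₀‖ ^ 2))).hasDerivAt.comp p.1
    (((hasDerivAt_id p.1).const_sub (T + 2)).sub_const (√(1 ^ 2 + ‖p.2 - x₀‖ ^ 2)))
  exact (h1.unique h2).trans (by simp)

theorem dirDeriv_spaceDir_coneCutoff (T : ℝ) (x₀ : E3) (p : ℝ × E3) (i : Fin 3) :
    dirDeriv (spaceDir i) (coneCutoff T x₀) p =
      -(deriv expNegInvGlue (T + 2 - p.1 - √(1 ^ 2 + ‖p.2 - x₀‖ ^ 2)) *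
        ((p.2 - x₀) i / √(1 ^ 2 + ‖p.2 - x₀‖ ^ 2))) := by
  have h1 := ((contDiff_coneCutoff T x₀).differentiable (by simp) p).hasFDerivAt.hasLineDerivAt
    (spaceDir i)
  have h3 := (hasDerivAt_sqrt_cone one_pos (p.2 - x₀) i).const_sub (T + 2 - p.1)
  have h2 := ((expNegInvGlue.contDiff (n := ⊤)).differentiable (by simp) _).hasDerivAt.comp
    (0 : ℝ) h3
  have h4 := h2.congr_of_eventuallyEq (f₁ := fun s : ℝ => coneCutoff T x₀ (p + s • spaceDir i))
    (.of_forall fun s => by simp [coneCutoff, spaceDir, add_sub_right_comm])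
  have := HasDerivAt.unique h1 h4
  rw [dirDeriv, this]
  simp

theorem coneCutoff_eq_zero {x₀ : E3} {p : ℝ × E3} (hp : 0 ≤ p.1)
    (h : p.2 ∉ closedBall x₀ (T + 2)) : coneCutoff T x₀ p = 0 := by
  have h1 : T + 2 < ‖p.2 - x₀‖ := by simpa [dist_eq_norm] using h
  refine expNegInvGlue.zero_of_nonpos ?_
  have : ‖p.2 - x₀‖ ≤ √(1 ^ 2 + ‖p.2 - x₀‖ ^ 2) := Real.le_sqrt_of_sq_le (by linarith)
  linarith

/-- The energy density of `g`, where `D v` is the derivative of `g` in the direction `v`. -/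
noncomputable def energyDensity (D : ℝ × E3 → ℝ × E3 → ℝ) (p : ℝ × E3) : ℝ :=
  D timeDir p * D timeDir p + (D (spaceDir 0) p * D (spaceDir 0) p +
    D (spaceDir 1) p * D (spaceDir 1) p + D (spaceDir 2) p * D (spaceDir 2) p)

theorem energyDensity_nonneg (D : ℝ × E3 → ℝ × E3 → ℝ) (p : ℝ × E3) : 0 ≤ energyDensity D p := by
  unfold energyDensity
  nlinarith [mul_self_nonneg (D timeDir p), mul_self_nonneg (D (spaceDir 0) p),
    mul_self_nonneg (D (spaceDir 1) p), mul_self_nonneg (D (spaceDir 2) p)]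

theorem energy_flux_ineq {a b₀ b₁ b₂ n₀ n₁ n₂ : ℝ} (hn : n₀ ^ 2 + n₁ ^ 2 + n₂ ^ 2 ≤ 1) :
    2 * (a * (b₀ * n₀ + b₁ * n₁ + b₂ * n₂)) ≤ a * a + (b₀ * b₀ + b₁ * b₁ + b₂ * b₂) := by
  nlinarith [sq_nonneg (b₀ - a * n₀), sq_nonneg (b₁ - a * n₁), sq_nonneg (b₂ - a * n₂),
    mul_nonneg (sq_nonneg a) (sub_nonneg.2 hn)]

/-- Subtract twice the divergence of $\chi\,\partial_tg\nabla g$, which integrates to zero. By the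
wave equation and symmetry the terms with $\chi$ undifferentiated cancel. What is left is
$-\eta'\,(e-2\,\partial_tg\;n\cdot\nabla g)$, where $e$ is the energy density, $\eta'\ge0$ the
derivative of the profile and $n=(x-x_0)/\sqrt{1+|x-x_0|^2}$. As $|n|\le1$, the bracket is
nonnegative by `energy_flux_ineq`. -/
theorem energy_deriv_nonpos {D : ℝ × E3 → ℝ × E3 → ℝ}
    (hD : ∀ v, ContDiffOn ℝ 1 (D v) (openSlab T))
    (hsymm : ∀ p ∈ openSlab T, ∀ i, dirDeriv timeDir (D (spaceDir i)) p =
      dirDeriv (spaceDir i) (D timeDir) p)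
    (heq : ∀ p ∈ openSlab T, dirDeriv timeDir (D timeDir) p =
      ∑ i, dirDeriv (spaceDir i) (D (spaceDir i)) p) (x₀ : E3) {t : ℝ} (ht : t ∈ Ioo 0 T) :
    ∫ x, dirDeriv timeDir (fun p => energyDensity D p * coneCutoff T x₀ p) (t, x) ≤ 0 := by
  set χ := coneCutoff T x₀ with hχdef
  have hχ : ContDiffOn ℝ 1 χ (openSlab T) := ((contDiff_coneCutoff T x₀).of_le (by simp)).contDiffOn
  have hK : IsCompact (closedBall x₀ (T + 2)) := isCompact_closedBall _ _
  have hχ0 : ∀ p ∈ openSlab T, p.2 ∉ closedBall x₀ (T + 2) → χ p = 0 := fun p hp h =>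
    coneCutoff_eq_zero hp.1.1.le h
  have hF : ContDiffOn ℝ 1 (fun p => energyDensity D p * χ p) (openSlab T) := by
    unfold energyDensity
    exact (((hD _).mul (hD _)).add ((((hD _).mul (hD _)).add ((hD _).mul (hD _))).add
      ((hD _).mul (hD _)))).mul hχ
  have hG : ∀ i, ContDiffOn ℝ 1 (fun p => D timeDir p * D (spaceDir i) p * χ p) (openSlab T) :=
    fun i => ((hD _).mul (hD _)).mul hχ
  have hF0 : ∀ p ∈ openSlab T, p.2 ∉ closedBall x₀ (T + 2) → energyDensity D p * χ p = 0 :=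
    fun p hp h => by rw [hχ0 p hp h, mul_zero]
  have hG0 : ∀ i, ∀ p ∈ openSlab T, p.2 ∉ closedBall x₀ (T + 2) →
      D timeDir p * D (spaceDir i) p * χ p = 0 :=
    fun i p hp h => by rw [hχ0 p hp h, mul_zero]
  have hFi := integrable_slice_openSlab (continuousOn_dirDeriv hF timeDir) hK
    (dirDeriv_eq_zero_of_openSlab hK hF0 timeDir) ht
  have hGi := fun i => integrable_slice_openSlab (continuousOn_dirDeriv (hG i) (spaceDir i)) hK
    (dirDeriv_eq_zero_of_openSlab hK (hG0 i) (spaceDir i)) ht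
  have hsum : ∫ x, ∑ i, dirDeriv (spaceDir i)
      (fun p => D timeDir p * D (spaceDir i) p * χ p) (t, x) = 0 := by
    rw [integral_finsetSum _ fun i _ => hGi i]
    exact Finset.sum_eq_zero fun i _ => integral_dirDeriv_spaceDir (hG i) hK (hG0 i) ht i
  have hsplit : ∫ x, dirDeriv timeDir (fun p => energyDensity D p * χ p) (t, x) =
      ∫ x, (dirDeriv timeDir (fun p => energyDensity D p * χ p) (t, x) - 2 *
        ∑ i, dirDeriv (spaceDir i) (fun p => D timeDir p * D (spaceDir i) p * χ p) (t, x)) := by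
    rw [integral_sub hFi ((integrable_finsetSum _ fun i _ => hGi i).const_mul 2),
      integral_const_mul, hsum, mul_zero, sub_zero]
  rw [hsplit]
  refine integral_nonpos fun x => ?_
  have hp : (t, x) ∈ openSlab T := ⟨ht, mem_univ _⟩
  have hnh := (isOpen_openSlab T).mem_nhds hp
  have dD := fun v => ((hD v).contDiffAt hnh).differentiableAt (by simp)
  have dχ := (hχ.contDiffAt hnh).differentiableAt (by simp)
  have dE : DifferentiableAt ℝ (energyDensity D) (t, x) := by
    unfold energyDensity
    exact ((dD _).mul (dD _)).add ((((dD _).mul (dD _)).add ((dD _).mul (dD _))).add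
      ((dD _).mul (dD _)))
  have eE : dirDeriv timeDir (energyDensity D) (t, x) =
      2 * (D timeDir (t, x) * dirDeriv timeDir (D timeDir) (t, x) +
        (D (spaceDir 0) (t, x) * dirDeriv timeDir (D (spaceDir 0)) (t, x) +
        D (spaceDir 1) (t, x) * dirDeriv timeDir (D (spaceDir 1)) (t, x) +
        D (spaceDir 2) (t, x) * dirDeriv timeDir (D (spaceDir 2)) (t, x))) := by
    unfold energyDensity
    rw [dirDeriv_add ((dD _).fun_mul (dD _))
      ((((dD _).fun_mul (dD _)).fun_add ((dD _).fun_mul (dD _))).fun_add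
      ((dD _).fun_mul (dD _))), dirDeriv_add (((dD _).fun_mul (dD _)).fun_add ((dD _).fun_mul (dD _)))
      ((dD _).fun_mul (dD _)), dirDeriv_add ((dD _).fun_mul (dD _)) ((dD _).fun_mul (dD _)),
      dirDeriv_mul (dD _) (dD _), dirDeriv_mul (dD _) (dD _), dirDeriv_mul (dD _) (dD _),
      dirDeriv_mul (dD _) (dD _)]
    ring
  simp only [Fin.sum_univ_three, Pi.zero_apply]
  rw [dirDeriv_mul dE dχ, eE, dirDeriv_mul ((dD _).fun_mul (dD _)) dχ,
    dirDeriv_mul ((dD _).fun_mul (dD _)) dχ, dirDeriv_mul ((dD _).fun_mul (dD _)) dχ,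
    dirDeriv_mul (dD _) (dD _), dirDeriv_mul (dD _) (dD _), dirDeriv_mul (dD _) (dD _),
    hsymm _ hp, hsymm _ hp, hsymm _ hp, heq _ hp, Fin.sum_univ_three, hχdef,
    dirDeriv_timeDir_coneCutoff, dirDeriv_spaceDir_coneCutoff, dirDeriv_spaceDir_coneCutoff,
    dirDeriv_spaceDir_coneCutoff]
  have hη := deriv_expNegInvGlue_nonneg (T + 2 - t - √(1 ^ 2 + ‖x - x₀‖ ^ 2))
  have hs : 0 < √(1 ^ 2 + ‖x - x₀‖ ^ 2) := by positivity
  have hn : ((x - x₀) 0 / √(1 ^ 2 + ‖x - x₀‖ ^ 2)) ^ 2 + ((x - x₀) 1 / √(1 ^ 2 + ‖x - x₀‖ ^ 2)) ^ 2 +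
      ((x - x₀) 2 / √(1 ^ 2 + ‖x - x₀‖ ^ 2)) ^ 2 ≤ 1 := by
    have h2 : √(1 ^ 2 + ‖x - x₀‖ ^ 2) ^ 2 =
        1 + ((x - x₀) 0 ^ 2 + (x - x₀) 1 ^ 2 + (x - x₀) 2 ^ 2) := by
      rw [Real.sq_sqrt (by positivity), EuclideanSpace.norm_sq_eq]
      simp [Fin.sum_univ_three]
    rw [div_pow, div_pow, div_pow, ← add_div, ← add_div, div_le_one (by positivity), h2]
    linarith
  have key := mul_nonneg hη (sub_nonneg.2 (energy_flux_ineq (a := D timeDir (t, x))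
    (b₀ := D (spaceDir 0) (t, x)) (b₁ := D (spaceDir 1) (t, x)) (b₂ := D (spaceDir 2) (t, x)) hn))
  refine le_of_eq_of_le ?_ (neg_nonpos.2 key)
  simp only [energyDensity]
  ring

end Energy

/-- The weighted energy is nonnegative, nonincreasing and zero at $t=0$, hence zero. The weight is
positive above its centre $x_0$, so $\partial_tw(t,x_0)=0$ for all $t$ and every $x_0$, and $w$
keeps its initial value 0. -/
theorem IsWaveSolution.eq_zero {T : ℝ} (hT : 0 < T) {w : ℝ → E3 → ℝ}
    (hw : IsWaveSolution T (fun _ _ => 0) (fun _ => 0) (fun _ => 0) w) :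
    ∀ t ∈ Icc 0 T, ∀ x, w t x = 0 := by
  set g : ℝ × E3 → ℝ := fun p => w p.1 p.2 with hg
  have hu := uniqueDiffOn_slab hT
  have hgd : DifferentiableOn ℝ g (slab T) := hw.contDiffOn_one.differentiableOn (by simp)
  -- Derivatives within the slab are continuous up to the boundary, by the $C^1$ hypothesis, and
  -- coincide with the full derivatives inside, where they are $C^1$. The estimate needs both.
  set D : ℝ × E3 → ℝ × E3 → ℝ := fun v => slabDeriv T v g with hDdef
  have hDc : ∀ v, ContinuousOn (D v) (slab T) := fun v =>
    (hw.contDiffOn_one.continuousOn_fderivWithin hu (by simp)).clm_apply continuousOn_const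
  have hmem : ∀ p ∈ openSlab T, slab T ∈ 𝓝 p := fun p hp => slab_mem_nhds hp.1
  have hDe : ∀ v, EqOn (D v) (dirDeriv v g) (openSlab T) := fun v p hp => by
    simp only [hDdef, slabDeriv, dirDeriv, fderivWithin_of_mem_nhds (hmem p hp)]
  have hD : ∀ v, ContDiffOn ℝ 1 (D v) (openSlab T) := fun v =>
    ((hw.contDiffOn_two.fderiv_of_isOpen (isOpen_openSlab T) (m := 1) (by norm_num)).clm_apply
      contDiffOn_const).congr (hDe v)
  have hDe' : ∀ v, ∀ p ∈ openSlab T, D v =ᶠ[𝓝 p] dirDeriv v g := fun v p hp =>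
    (hDe v).eventuallyEq_of_mem ((isOpen_openSlab T).mem_nhds hp)
  have hsymm : ∀ p ∈ openSlab T, ∀ i, dirDeriv timeDir (D (spaceDir i)) p =
      dirDeriv (spaceDir i) (D timeDir) p := by
    intro p hp i
    have hg2 : ContDiffAt ℝ 2 g p := hw.contDiffOn_two.contDiffAt ((isOpen_openSlab T).mem_nhds hp)
    have hd : DifferentiableAt ℝ (fderiv ℝ g) p :=
      (hg2.fderiv_right (m := 1) (by norm_num)).differentiableAt (by simp)
    have key : ∀ v v' : ℝ × E3, dirDeriv v (D v') p = fderiv ℝ (fderiv ℝ g) p v v' := by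
      intro v v'
      have h1 : HasFDerivAt (dirDeriv v' g) _ p :=
        hd.hasFDerivAt.clm_apply (hasFDerivAt_const v' p)
      rw [dirDeriv, (hDe' v' p hp).fderiv_eq, h1.fderiv]; simp
    rw [key, key]
    exact hg2.isSymmSndFDerivAt (by simp) _ _
  have htd : ∀ t ∈ Icc 0 T, ∀ x, timeDeriv T w t x = D timeDir (t, x) := fun t ht x =>
    timeDeriv_eq_slabDeriv hT (fun _ _ _ => rfl) hgd ht x
  have heq : ∀ p ∈ openSlab T, dirDeriv timeDir (D timeDir) p =
      ∑ i, dirDeriv (spaceDir i) (D (spaceDir i)) p := by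
    rintro ⟨t, x⟩ hp
    have ht : t ∈ Ioo 0 T := hp.1
    have htc := Ioo_subset_Icc_self ht
    have h1 := hw.equation t ht x
    rw [dAlembert, sub_eq_zero, laplacian_eq_sum_partialDeriv
      (contDiff_slice_openSlab hw.contDiffOn_two ht).contDiffAt] at h1
    have h2 : timeDeriv T (timeDeriv T w) t x = dirDeriv timeDir (D timeDir) (t, x) := by
      rw [timeDeriv, derivWithin_congr (fun s hs => htd s hs x) (htd t htc x)]
      exact (hasDerivAt_time (hD timeDir) hp).hasDerivWithinAt.derivWithin
        (uniqueDiffOn_Icc hT t htc)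
    rw [← h2, h1]
    refine Finset.sum_congr rfl fun i _ => ?_
    have h3 : partialDeriv i (w t) = fun y => D (spaceDir i) (t, y) :=
      funext fun y => partialDeriv_slice hgd htc y i
    rw [h3]
    exact partialDeriv_openSlab (hD (spaceDir i)) hp i
  have hD0 : ∀ x, ∀ v ∈ ({timeDir, spaceDir 0, spaceDir 1, spaceDir 2} : Set (ℝ × E3)),
      D v (0, x) = 0 := by
    have hs : ∀ i x, D (spaceDir i) (0, x) = 0 := fun i x => by
      rw [hDdef]; simp only
      rw [← partialDeriv_slice hgd (left_mem_Icc.2 hT.le) x i]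
      simp [hg, hw.initial, partialDeriv]
    have ht : ∀ x, D timeDir (0, x) = 0 := fun x => by
      rw [← htd 0 (left_mem_Icc.2 hT.le) x, hw.initial_timeDeriv]
    rintro x v (rfl | rfl | rfl | rfl)
    exacts [ht x, hs 0 x, hs 1 x, hs 2 x]
  have htime : ∀ x₀, ∀ t ∈ Icc 0 T, D timeDir (t, x₀) = 0 := by
    intro x₀
    have hK : IsCompact (closedBall x₀ (T + 2)) := isCompact_closedBall _ _
    set F : ℝ × E3 → ℝ := fun p => energyDensity D p * coneCutoff T x₀ p with hFdef
    have hFc : ContinuousOn F (slab T) := by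
      simp only [hFdef, energyDensity]
      exact (((hDc _).mul (hDc _)).add ((((hDc _).mul (hDc _)).add ((hDc _).mul (hDc _))).add
        ((hDc _).mul (hDc _)))).mul (contDiff_coneCutoff T x₀).continuous.continuousOn
    have hF1 : ContDiffOn ℝ 1 F (openSlab T) := by
      simp only [hFdef, energyDensity]
      exact (((hD _).mul (hD _)).add ((((hD _).mul (hD _)).add ((hD _).mul (hD _))).add
        ((hD _).mul (hD _)))).mul ((contDiff_coneCutoff T x₀).of_le (by simp)).contDiffOn
    have hF0 : ∀ p ∈ slab T, p.2 ∉ closedBall x₀ (T + 2) → F p = 0 := fun p hp h => by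
      simp only [hFdef]
      rw [coneCutoff_eq_zero hp.1.1 h, mul_zero]
    have hF0' : ∀ p ∈ openSlab T, p.2 ∉ closedBall x₀ (T + 2) → F p = 0 := fun p hp h =>
      hF0 p ⟨Ioo_subset_Icc_self hp.1, mem_univ _⟩ h
    have hFnn : ∀ p, 0 ≤ F p := fun p => mul_nonneg (energyDensity_nonneg D p)
      (expNegInvGlue.nonneg _)
    have hder := fun t (ht : t ∈ Ioo 0 T) => hasDerivAt_integral_slice hF1 hK hF0' ht
    -- The energy is differentiated only at interior times; continuity on the closed interval
    -- connects it to the initial data.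
    have hcont : ContinuousOn (fun t => ∫ x, F (t, x)) (Icc 0 T) :=
      continuousOn_integral_of_compact_support (f := fun t x => F (t, x)) hK hFc
        fun t x ht hx => hF0 (t, x) (mem_slab ht x) hx
    have hanti : AntitoneOn (fun t => ∫ x, F (t, x)) (Icc 0 T) := by
      refine antitoneOn_of_deriv_nonpos (convex_Icc 0 T) hcont ?_ ?_
      · rw [interior_Icc]
        exact fun t ht => (hder t ht).differentiableAt.differentiableWithinAt
      · rw [interior_Icc]
        intro t ht
        rw [(hder t ht).deriv]
        exact energy_deriv_nonpos hD hsymm heq x₀ ht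
    intro t ht
    have hzero : ∫ x, F (t, x) = 0 := by
      refine le_antisymm ((hanti (left_mem_Icc.2 hT.le) ht ht.1).trans_eq ?_)
        (integral_nonneg fun x => hFnn _)
      have : ∀ x, F (0, x) = 0 := fun x => by
        have h := hD0 x
        simp [hFdef, energyDensity, h]
      simp [this]
    have hcs : Continuous fun x => F (t, x) :=
      hFc.comp_continuous (by fun_prop) fun x => mem_slab ht x
    have hF00 : F (t, x₀) = 0 := by
      have hint : Integrable fun x => F (t, x) := hcs.integrable_of_hasCompactSupport
        (HasCompactSupport.intro hK fun x hx => hF0 (t, x) (mem_slab ht x) hx)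
      have h1 := (integral_eq_zero_iff_of_nonneg (fun x => hFnn (t, x)) hint).1 hzero
      exact congrFun ((hcs.ae_eq_iff_eq volume continuous_zero).1 h1) x₀
    -- At the centre the argument of the profile is $T+2-t-1\ge1$.
    have hpos : 0 < coneCutoff T x₀ (t, x₀) := by
      refine expNegInvGlue.pos_of_pos ?_
      simp; linarith [ht.2]
    have h2 : energyDensity D (t, x₀) = 0 := by
      rcases mul_eq_zero.1 hF00 with h | h
      · exact h
      · exact absurd h hpos.ne'
    unfold energyDensity at h2
    nlinarith [mul_self_nonneg (D timeDir (t, x₀)), mul_self_nonneg (D (spaceDir 0) (t, x₀)),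
      mul_self_nonneg (D (spaceDir 1) (t, x₀)), mul_self_nonneg (D (spaceDir 2) (t, x₀))]
  intro t ht x
  have hd := fun s (hs : s ∈ Icc 0 T) => hasDerivWithinAt_slabDeriv hgd hs x
  have := constant_of_derivWithin_zero (f := fun s => g (s, x)) (a := 0) (b := T)
    (fun s hs => (hd s hs).differentiableWithinAt)
    (fun s hs => by
      have hs' := Ico_subset_Icc_self hs
      rw [(hd s hs').derivWithin (uniqueDiffOn_Icc hT s hs')]
      exact htime x s hs') t ht
  simpa [hg, hw.initial] using this

end VlasovMaxwell

namespace VlasovMaxwell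

/-! ### The Newtonian potential -/

section Newton

variable {ρ : E3 → ℝ}

theorem locallyIntegrable_newtonWeight : LocallyIntegrable newtonWeight := by
  intro x
  refine ⟨ball 0 (‖x‖ + 1), isOpen_ball.mem_nhds (by simp), integrableOn_newtonWeight _⟩

theorem newtonPotential_eq (ρ : E3 → ℝ) (x : E3) :
    newtonPotential ρ x = ∫ z, newtonWeight z * ρ (x + z) := by
  rw [newtonPotential, ← integral_add_left_eq_self _ x]
  simp [newtonWeight]

theorem newtonPotential_eq_convolution (ρ : E3 → ℝ) :
    newtonPotential ρ = convolution newtonWeight ρ (ContinuousLinearMap.mul ℝ ℝ) volume := by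
  funext x
  rw [newtonPotential_eq, convolution, ← integral_neg_eq_self]
  simp [newtonWeight, sub_eq_add_neg]

theorem contDiff_newtonPotential (hρ : ContDiff ℝ ∞ ρ) (hc : HasCompactSupport ρ) :
    ContDiff ℝ ∞ (newtonPotential ρ) := by
  rw [newtonPotential_eq_convolution]
  exact hc.contDiff_convolution_right (n := ⊤) _ locallyIntegrable_newtonWeight hρ

theorem hasCompactSupport_partialDeriv (hc : HasCompactSupport ρ) (i : Fin 3) :
    HasCompactSupport (partialDeriv i ρ) :=
  (hc.fderiv ℝ).comp_left (g := fun L : E3 →L[ℝ] ℝ => L (EuclideanSpace.single i 1)) (by simp)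

theorem contDiff_partialDeriv (hρ : ContDiff ℝ ∞ ρ) (i : Fin 3) :
    ContDiff ℝ ∞ (partialDeriv i ρ) :=
  (hρ.fderiv_right (m := ∞) (by simp)).clm_apply contDiff_const

theorem partialDeriv_newtonPotential (hρ : ContDiff ℝ ∞ ρ) (hc : HasCompactSupport ρ)
    (i : Fin 3) : partialDeriv i (newtonPotential ρ) = newtonPotential (partialDeriv i ρ) := by
  funext x
  rw [newtonPotential_eq_convolution, newtonPotential_eq_convolution, partialDeriv,
    (hc.hasFDerivAt_convolution_right _ locallyIntegrable_newtonWeight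
      (hρ.of_le (by simp)) x).fderiv, convolution_precompR_apply _ locallyIntegrable_newtonWeight
      (hc.fderiv ℝ) (hρ.continuous_fderiv (by simp))]
  rfl

/-- Apply the retarded identity to the static function $k(t,x)=\rho(x)$: then $\Box k=-\Delta\rho$,
and the retarded potential of a static function is its Newtonian potential. -/
theorem laplacian_newtonPotential (hρ : ContDiff ℝ ∞ ρ) (hc : HasCompactSupport ρ) (x : E3) :
    Laplacian.laplacian (newtonPotential ρ) x = -ρ x := by
  rw [laplacian_eq_sum_partialDeriv
    ((contDiff_newtonPotential hρ hc).of_le ENat.LEInfty.out).contDiffAt]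
  simp only [partialDeriv_newtonPotential hρ hc, partialDeriv_newtonPotential
    (contDiff_partialDeriv hρ _) (hasCompactSupport_partialDeriv hc _)]
  set k : ℝ × E3 → ℝ := fun p => ρ p.2 with hkdef
  have hk : ContDiff ℝ ∞ k := hρ.comp contDiff_snd
  have hd : ∀ {r : E3 → ℝ}, ContDiff ℝ ∞ r → ∀ v : ℝ × E3,
      dirDeriv v (fun p => r p.2) = fun p => fderiv ℝ r p.2 v.2 := fun {r} hr v => by
    funext p
    have h1 : HasFDerivAt (fun p : ℝ × E3 => r p.2) _ p :=
      ((hr.differentiable (by simp)) p.2).hasFDerivAt.comp p hasFDerivAt_snd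
    rw [dirDeriv, h1.fderiv]; rfl
  have ht : dirDeriv timeDir k = fun _ => 0 := by rw [hd hρ]; simp [timeDir]
  have hs : ∀ {r : E3 → ℝ}, ContDiff ℝ ∞ r → ∀ i, dirDeriv (spaceDir i) (fun p => r p.2) =
      fun p => partialDeriv i r p.2 := fun hr i => hd hr (spaceDir i)
  have hw : ∀ p, waveOp k p = -∑ i, partialDeriv i (partialDeriv i ρ) p.2 := fun p => by
    rw [waveOp, ht]
    simp only [hkdef, hs hρ, hs (contDiff_partialDeriv hρ _)]
    simp [dirDeriv]
  have key := integral_retarded_waveOp hk hc.isCompact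
    (fun q hq => image_eq_zero_of_notMem_tsupport (f := ρ) hq) (0, x)
  simp only [hw, mul_neg, integral_neg] at key
  rw [← show k (0, x) = ρ x from rfl, ← key, neg_neg]
  simp only [newtonPotential_eq, Finset.mul_sum]
  have hint : ∀ i, Integrable fun z =>
      newtonWeight z * partialDeriv i (partialDeriv i ρ) (x + z) := fun i =>
    integrable_retarded (φ := fun p => partialDeriv i (partialDeriv i ρ) p.2)
      ((contDiff_partialDeriv (contDiff_partialDeriv hρ i) i).continuous.comp continuous_snd)
      (hasCompactSupport_partialDeriv (hasCompactSupport_partialDeriv hc i) i).isCompact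
      (fun q hq => image_eq_zero_of_notMem_tsupport
        (f := partialDeriv i (partialDeriv i ρ)) hq) (0, x)
  exact (integral_finsetSum _ fun i _ => hint i).symm

end Newton

/-! ### Momentum averages -/

section Moments

variable {T : ℝ} {f : ℝ → E3 → E3 → ℝ}

theorem isClosed_phaseSlab (T : ℝ) : IsClosed (phaseSlab T) := isClosed_Icc.prod isClosed_univ

theorem uniqueDiffOn_phaseSlab (hT : 0 < T) : UniqueDiffOn ℝ (phaseSlab T) :=
  (uniqueDiffOn_Icc hT).prod uniqueDiffOn_univ

theorem mem_phaseSlab {p : ℝ × E3} (hp : p ∈ slab T) (ξ : E3) : (p.1, p.2, ξ) ∈ phaseSlab T :=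
  ⟨hp.1, mem_univ _⟩

theorem IsSmoothCompactlySupported.isTestOn (hf : IsSmoothCompactlySupported T f) :
    IsTestOn (phaseSlab T) fun p : ℝ × E3 × E3 => f p.1 p.2.1 p.2.2 := ⟨hf.smooth, hf.support⟩

theorem IsSmoothCompactlySupported.exists_radius (hf : IsSmoothCompactlySupported T f) :
    ∃ R : ℝ, ∀ p ∈ slab T, ∀ ξ, ξ ∉ ball (0 : E3) R → f p.1 p.2 ξ = 0 := by
  obtain ⟨K, hK, h0⟩ := hf.support
  obtain ⟨R, hR⟩ := (hK.image (continuous_snd.comp continuous_snd)).isBounded.exists_norm_le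
  refine ⟨R + 1, fun p hp ξ hξ => h0 _ (mem_phaseSlab hp ξ) fun hmem => hξ ?_⟩
  have := hR ξ ⟨_, hmem, rfl⟩
  rw [mem_ball_zero_iff]; linarith

theorem IsSmoothCompactlySupported.isTestOn_slice (hf : IsSmoothCompactlySupported T f) (ξ : E3) :
    IsTestOn (slab T) fun p => f p.1 p.2 ξ := by
  obtain ⟨K, hK, h0⟩ := hf.support
  refine ⟨hf.smooth.comp (f := fun p : ℝ × E3 => (p.1, p.2, ξ)) (by fun_prop)
    fun p hp => mem_phaseSlab hp ξ, _, hK.image (f := fun q : ℝ × E3 × E3 => (q.1, q.2.1))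
    (by fun_prop), fun p hp hpK => h0 _ (mem_phaseSlab hp ξ) fun h => hpK ⟨_, h, rfl⟩⟩

/-- The average in momentum of a distribution function, with a weight. -/
noncomputable def moment (m : E3 → ℝ) (f : ℝ → E3 → E3 → ℝ) (p : ℝ × E3) : ℝ :=
  ∫ ξ, m ξ * f p.1 p.2 ξ

theorem moment_eq_setIntegral {m : E3 → ℝ} {R : ℝ}
    (hR : ∀ p ∈ slab T, ∀ ξ, ξ ∉ ball (0 : E3) R → f p.1 p.2 ξ = 0) {p : ℝ × E3}
    (hp : p ∈ slab T) : moment m f p = ∫ ξ in ball (0 : E3) R, m ξ * f p.1 p.2 ξ :=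
  (setIntegral_eq_integral_of_forall_compl_eq_zero fun ξ hξ => by rw [hR p hp ξ hξ, mul_zero]).symm

theorem integrableOn_ball_of_continuous {m : E3 → ℝ} (hm : Continuous m) (R : ℝ) :
    IntegrableOn m (ball (0 : E3) R) :=
  (hm.continuousOn.integrableOn_compact (isCompact_closedBall 0 R)).mono_set ball_subset_closedBall

theorem slabDeriv_slice (hT : 0 < T) (hf : IsSmoothCompactlySupported T f) (ξ : E3)
    {p : ℝ × E3} (hp : p ∈ slab T) (v : ℝ × E3) :
    slabDeriv T v (fun p => f p.1 p.2 ξ) p =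
      fderivWithin ℝ (fun q : ℝ × E3 × E3 => f q.1 q.2.1 q.2.2) (phaseSlab T) (p.1, p.2, ξ)
        (v.1, v.2, 0) := by
  have h1 := (hf.smooth.differentiableOn (by simp) _ (mem_phaseSlab hp ξ)).hasFDerivWithinAt
  have h2 : HasFDerivWithinAt (fun p : ℝ × E3 => (p.1, p.2, ξ)) _ (slab T) p :=
    ((hasFDerivAt_fst (𝕜 := ℝ) (p := p)).prodMk ((hasFDerivAt_snd (𝕜 := ℝ) (p := p)).prodMk
      (hasFDerivAt_const ξ p))).hasFDerivWithinAt
  have h3 := (HasFDerivWithinAt.comp p (g := fun q : ℝ × E3 × E3 => f q.1 q.2.1 q.2.2) h1 h2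
    fun q hq => mem_phaseSlab hq ξ).fderivWithin (uniqueDiffOn_slab hT p hp)
  exact congrArg (fun L : ℝ × E3 →L[ℝ] ℝ => L v) h3

/-- `IsTestOn.contDiffOn_integral` with parameter `ξ`: the linear part is the constant embedding
$p\mapsto(p,0)$ and the translation is by $(0,0,\xi)$. The uniform momentum support makes any
continuous weight integrable. -/
theorem moment_smooth (hT : 0 < T) (hf : IsSmoothCompactlySupported T f) {m : E3 → ℝ}
    (hm : Continuous m) : IsTestOn (slab T) (moment m f) ∧
      ∀ p ∈ slab T, ∀ v, slabDeriv T v (moment m f) p =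
        ∫ ξ, m ξ * slabDeriv T v (fun p => f p.1 p.2 ξ) p := by
  obtain ⟨R, hR⟩ := hf.exists_radius
  obtain ⟨K, hK, h0⟩ := hf.support
  have key := IsTestOn.contDiffOn_integral (μ := (volume : Measure E3)) (s := slab T)
    (C := ‖(ContinuousLinearMap.fst ℝ ℝ E3).prod
      ((ContinuousLinearMap.snd ℝ ℝ E3).prod (0 : ℝ × E3 →L[ℝ] E3))‖)
    (Λ := fun _ => (ContinuousLinearMap.fst ℝ ℝ E3).prod
      ((ContinuousLinearMap.snd ℝ ℝ E3).prod (0 : ℝ × E3 →L[ℝ] E3)))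
    (c := fun ξ => ((0 : ℝ), (0 : E3), ξ)) (A := ball (0 : E3) R) (w := m)
    measurableSet_ball (convex_slab T) (uniqueDiffOn_slab hT)
    (isClosed_phaseSlab T) (uniqueDiffOn_phaseSlab hT) continuousOn_const (by fun_prop)
    (fun _ _ => le_rfl) (fun ξ _ p hp => by simpa using mem_phaseSlab hp ξ) hf.isTestOn
    (integrableOn_ball_of_continuous hm R)
  simp only [ContinuousLinearMap.prod_apply, ContinuousLinearMap.coe_fst',
    ContinuousLinearMap.coe_snd', Prod.mk_add_mk, add_zero, smul_eq_mul, zero_add,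
    _root_.zero_apply] at key
  have heq : EqOn (moment m f) (fun q => ∫ ξ in ball (0 : E3) R, m ξ * f q.1 q.2 ξ) (slab T) :=
    fun p hp => moment_eq_setIntegral hR hp
  refine ⟨⟨key.1.congr heq, _, hK.image (f := fun q : ℝ × E3 × E3 => (q.1, q.2.1))
    (by fun_prop), fun p hp hpK => ?_⟩, fun p hp v => ?_⟩
  · rw [moment]
    have : ∀ ξ, f p.1 p.2 ξ = 0 := fun ξ =>
      h0 _ (mem_phaseSlab hp ξ) fun h => hpK ⟨_, h, rfl⟩
    simp [this]
  · rw [slabDeriv_congr heq hp]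
    refine (key.2 p hp v).trans ?_
    simp only [← slabDeriv_slice hT hf _ hp v]
    refine setIntegral_eq_integral_of_forall_compl_eq_zero fun ξ hξ => ?_
    have h1 : EqOn (fun p : ℝ × E3 => f p.1 p.2 ξ) (fun _ => 0) (slab T) :=
      fun p hp => hR p hp ξ hξ
    rw [slabDeriv_congr h1 hp, slabDeriv]; simp

/-- Averaging in momentum commutes with Duhamel's formula. -/
theorem integral_duhamel_slice (hf : IsSmoothCompactlySupported T f) {m : E3 → ℝ}
    (hm : Continuous m) {p : ℝ × E3} (hp : p ∈ slab T) :
    Integrable (fun ξ => m ξ * duhamel (fun q => f q.1 q.2 ξ) p) ∧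
    ∫ ξ, m ξ * duhamel (fun q => f q.1 q.2 ξ) p = duhamel (moment m f) p := by
  obtain ⟨R, hR⟩ := hf.exists_radius
  obtain ⟨M, hM⟩ := hf.isTestOn.exists_bound (isClosed_phaseSlab T)
  have hM0 : 0 ≤ M := (norm_nonneg _).trans (hM _ (mem_phaseSlab hp 0))
  set H : E3 × E3 → ℝ := fun z =>
    newtonWeight z.1 * (m z.2 * f (coneMap z.1 p).1 (coneMap z.1 p).2 z.2) with hH
  have hint : Integrable H ((volume.restrict (ball (0 : E3) 1)).prod volume) := by
    have hb : Integrable (fun z : E3 × E3 => newtonWeight z.1 *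
        (ball (0 : E3) R).indicator (fun ξ => |m ξ| * M) z.2)
        ((volume.restrict (ball (0 : E3) 1)).prod volume) :=
      (integrableOn_newtonWeight 1).mul_prod
        ((integrable_indicator_iff measurableSet_ball).2
          (integrableOn_ball_of_continuous (hm.abs.mul continuous_const) R))
    have hz : ∀ᵐ z ∂((volume.restrict (ball (0 : E3) 1)).prod (volume : Measure E3)),
        z.1 ∈ ball (0 : E3) 1 :=
      Measure.quasiMeasurePreserving_fst.ae (ae_restrict_mem measurableSet_ball)
    refine hb.mono' ?_ ?_
    · refine AEStronglyMeasurable.mul ?_ ?_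
      · exact ((by unfold newtonWeight; fun_prop : Measurable newtonWeight).comp
          measurable_fst).aestronglyMeasurable
      -- Continuity of `f` is known on the phase slab only, which the cone map preserves for
      -- $|y|<1$; measurability is therefore checked on the ball times the momentum space.
      · have : (volume.restrict (ball (0 : E3) 1)).prod (volume : Measure E3) =
            (volume.prod volume).restrict (ball (0 : E3) 1 ×ˢ univ) := by
          rw [← Measure.prod_restrict, Measure.restrict_univ]
        rw [this]
        refine ContinuousOn.aestronglyMeasurable ?_ (measurableSet_ball.prod MeasurableSet.univ)
        refine ContinuousOn.mul (by fun_prop) ?_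
        refine hf.smooth.continuousOn.comp
          (f := fun z : E3 × E3 => ((coneMap z.1 p).1, (coneMap z.1 p).2, z.2)) ?_
          fun z hz => mem_phaseSlab (coneMap_mem hz.1 hp) z.2
        simp only [coneMap_apply]
        fun_prop
    · filter_upwards [hz] with z hz
      have hcm := coneMap_mem hz hp
      rw [Real.norm_eq_abs, abs_mul, abs_of_nonneg (newtonWeight_nonneg _), abs_mul]
      refine mul_le_mul_of_nonneg_left ?_ (newtonWeight_nonneg _)
      by_cases hξ : z.2 ∈ ball (0 : E3) R
      · rw [indicator_of_mem hξ]
        exact mul_le_mul_of_nonneg_left (hM _ (mem_phaseSlab hcm z.2)) (abs_nonneg _)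
      · rw [indicator_of_notMem hξ, hR _ hcm _ hξ]; simp
  have hpt : ∀ ξ, m ξ * duhamel (fun q => f q.1 q.2 ξ) p =
      p.1 ^ 2 * ∫ y in ball (0 : E3) 1, H (y, ξ) := fun ξ => by
    rw [duhamel, mul_left_comm, ← integral_const_mul]
    simp only [hH, mul_left_comm]
  simp only [hpt]
  refine ⟨hint.integral_prod_right.const_mul _, ?_⟩
  rw [integral_const_mul, duhamel, integral_integral_swap (f := fun ξ y => H (y, ξ)) hint.swap]
  simp only [hH, integral_const_mul, moment]

/-! ### Conservation of charge -/

theorem velocity_apply (ξ : E3) (i : Fin 3) : velocity ξ i = ξ i / √(1 ^ 2 + ‖ξ‖ ^ 2) := by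
  simp [velocity, div_eq_inv_mul]

theorem continuous_velocity : Continuous velocity := by
  unfold velocity
  refine Continuous.smul (Continuous.inv₀ (f := fun ξ : E3 => √(1 + ‖ξ‖ ^ 2)) (by fun_prop) fun ξ => ?_)
    continuous_id
  positivity

theorem continuous_velocity_apply (i : Fin 3) : Continuous fun ξ => velocity ξ i :=
  (PiLp.continuous_apply 2 _ i).comp continuous_velocity

/-- The velocity is the gradient of the relativistic energy $\sqrt{1+|\xi|^2}$. This is the only
property of it behind the conservation of charge. -/
theorem partialDeriv_sqrt (ξ : E3) (i : Fin 3) :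
    partialDeriv i (fun ξ => √(1 ^ 2 + ‖ξ‖ ^ 2)) ξ = velocity ξ i := by
  rw [velocity_apply]
  exact HasDerivAt.unique (((contDiff_sqrt_cone one_pos).differentiable (by simp)
    ξ).hasFDerivAt.hasLineDerivAt _) (hasDerivAt_sqrt_cone one_pos ξ i)

theorem partialDeriv_comm {g : E3 → ℝ} (hg : ContDiff ℝ ∞ g) (i j : Fin 3) (x : E3) :
    partialDeriv i (partialDeriv j g) x = partialDeriv j (partialDeriv i g) x := by
  have hd : DifferentiableAt ℝ (fderiv ℝ g) x :=
    (hg.fderiv_right (m := ∞) (by simp)).differentiable (by simp) x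
  have key : ∀ i j : Fin 3, partialDeriv i (partialDeriv j g) x =
      fderiv ℝ (fderiv ℝ g) x (EuclideanSpace.single i 1) (EuclideanSpace.single j 1) := by
    intro i j
    have h1 : HasFDerivAt (partialDeriv j g) _ x :=
      hd.hasFDerivAt.clm_apply (hasFDerivAt_const (EuclideanSpace.single j 1) x)
    rw [partialDeriv, h1.fderiv]; simp
  rw [key, key]
  exact (hg.contDiffAt.isSymmSndFDerivAt (by simpa using ENat.LEInfty.out)) _ _

theorem partialDeriv_mul {a b : E3 → ℝ} {x : E3} (ha : DifferentiableAt ℝ a x)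
    (hb : DifferentiableAt ℝ b x) (i : Fin 3) : partialDeriv i (fun y => a y * b y) x =
      partialDeriv i a x * b x + a x * partialDeriv i b x := by
  have : HasFDerivAt (fun q => a q * b q) _ x := ha.hasFDerivAt.mul hb.hasFDerivAt
  rw [partialDeriv, this.fderiv]; simp [partialDeriv]; ring

/-- With $\gamma=\sqrt{1+|\xi|^2}$ and $v=\nabla\gamma$ the integrand equals
$\partial_j(\gamma\,\partial_ig)-\partial_i(\gamma\,\partial_jg)$, a sum of derivatives of compactly
supported functions. -/
theorem integral_velocity_cross_grad {g : E3 → ℝ} (hg : ContDiff ℝ ∞ g) (hc : HasCompactSupport g)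
    (i j : Fin 3) :
    ∫ ξ, (velocity ξ j * partialDeriv i g ξ - velocity ξ i * partialDeriv j g ξ) = 0 := by
  have hγ := contDiff_sqrt_cone one_pos
  have hi := contDiff_partialDeriv hg
  have hsm : ∀ i, ContDiff ℝ 1 fun ξ : E3 => √(1 ^ 2 + ‖ξ‖ ^ 2) * partialDeriv i g ξ := fun i =>
    (hγ.mul (hi i)).of_le (by simp)
  have hcs : ∀ i, HasCompactSupport fun ξ : E3 => √(1 ^ 2 + ‖ξ‖ ^ 2) * partialDeriv i g ξ :=
    fun i => (hasCompactSupport_partialDeriv hc i).mul_left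
  have hint : ∀ i j, Integrable
      (partialDeriv j fun ξ : E3 => √(1 ^ 2 + ‖ξ‖ ^ 2) * partialDeriv i g ξ) := fun i j =>
    (((hsm i).continuous_fderiv (by simp)).clm_apply
      continuous_const).integrable_of_hasCompactSupport (hasCompactSupport_partialDeriv (hcs i) j)
  have hz : ∀ i j, ∫ ξ, partialDeriv j (fun ξ : E3 => √(1 ^ 2 + ‖ξ‖ ^ 2) * partialDeriv i g ξ) ξ = 0 :=
    fun i j => integral_fderiv_eq_zero (hsm i) (hcs i) _
  have := integral_sub (hint i j) (hint j i)
  rw [hz, hz, sub_zero] at this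
  rw [← this]
  refine integral_congr_ae (.of_forall fun ξ => ?_)
  simp only
  have dγ := hγ.differentiable (by simp) ξ
  have di := fun i => (hi i).differentiable (by simp) ξ
  rw [partialDeriv_mul dγ (di i), partialDeriv_mul dγ (di j), partialDeriv_sqrt, partialDeriv_sqrt,
    partialDeriv_comm hg j i]
  ring

theorem inner_gradient_eq_sum (a : E3) (g : E3 → ℝ) (x : E3) :
    inner ℝ a (gradient g x) = ∑ i, a i * partialDeriv i g x := by
  simp only [PiLp.inner_apply, gradient_apply]
  simp [mul_comm]

/-- The electric part is a constant combination of derivatives of `g`; the magnetic part is a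
combination of the antisymmetric expressions of `integral_velocity_cross_grad`, with coefficients
the components of `B`. -/
theorem integral_lorentz_force {g : E3 → ℝ} (hg : ContDiff ℝ ∞ g) (hc : HasCompactSupport g)
    (E B : E3) : ∫ ξ, inner ℝ (E + cross (velocity ξ) B) (gradient g ξ) = 0 := by
  have hpd : ∀ i, Continuous (partialDeriv i g) := fun i => (contDiff_partialDeriv hg i).continuous
  have hv := continuous_velocity_apply
  have h1 : ∀ i, Integrable (partialDeriv i g) := fun i =>
    (hpd i).integrable_of_hasCompactSupport (hasCompactSupport_partialDeriv hc i)
  have h2 : ∀ i j, Integrable fun ξ => velocity ξ j * partialDeriv i g ξ -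
      velocity ξ i * partialDeriv j g ξ := fun i j =>
    (((hv j).mul (hpd i)).integrable_of_hasCompactSupport
      (hasCompactSupport_partialDeriv hc i).mul_left).sub
    (((hv i).mul (hpd j)).integrable_of_hasCompactSupport
      (hasCompactSupport_partialDeriv hc j).mul_left)
  have z1 : ∀ i, ∫ ξ, partialDeriv i g ξ = 0 := fun i =>
    integral_fderiv_eq_zero (hg.of_le (by simp)) hc _
  have e : ∀ ξ, inner ℝ (E + cross (velocity ξ) B) (gradient g ξ) =
      (E 0 * partialDeriv 0 g ξ + E 1 * partialDeriv 1 g ξ + E 2 * partialDeriv 2 g ξ) +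
      (B 2 * (velocity ξ 1 * partialDeriv 0 g ξ - velocity ξ 0 * partialDeriv 1 g ξ) +
      B 1 * (velocity ξ 0 * partialDeriv 2 g ξ - velocity ξ 2 * partialDeriv 0 g ξ) +
      B 0 * (velocity ξ 2 * partialDeriv 1 g ξ - velocity ξ 1 * partialDeriv 2 g ξ)) := by
    intro ξ
    rw [inner_gradient_eq_sum]
    simp [Fin.sum_univ_three, cross, cross_apply]
    ring
  simp only [e]
  rw [integral_add (by
      exact (((h1 0).const_mul _).add ((h1 1).const_mul _)).add ((h1 2).const_mul _)) (by
      exact (((h2 0 1).const_mul _).add ((h2 2 0).const_mul _)).add ((h2 1 2).const_mul _)),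
    integral_add (by exact ((h1 0).const_mul _).add ((h1 1).const_mul _)) ((h1 2).const_mul _),
    integral_add ((h1 0).const_mul _) ((h1 1).const_mul _),
    integral_add (by exact ((h2 0 1).const_mul _).add ((h2 2 0).const_mul _)) ((h2 1 2).const_mul _),
    integral_add ((h2 0 1).const_mul _) ((h2 2 0).const_mul _)]
  simp only [integral_const_mul, z1, integral_velocity_cross_grad hg hc, mul_zero, add_zero]

/-- Integrate the Vlasov equation over momentum. The force term drops out whatever the regularity of
the fields, since `E` and `B` are constants at a fixed point of space-time. -/
theorem continuity_equation (hT : 0 < T) (hf : IsSmoothCompactlySupported T f) {E B : ℝ → E3 → E3}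
    (hV : VlasovEquation T f E B) {p : ℝ × E3} (hp : p ∈ slab T) :
    slabDeriv T timeDir (moment (fun _ => 1) f) p +
      ∑ i, slabDeriv T (spaceDir i) (moment (fun ξ => velocity ξ i) f) p = 0 := by
  obtain ⟨R, hR⟩ := hf.exists_radius
  have hslice : ∀ ξ, DifferentiableOn ℝ (fun p : ℝ × E3 => f p.1 p.2 ξ) (slab T) := fun ξ =>
    (hf.isTestOn_slice ξ).smooth.differentiableOn (by simp)
  have hg : ContDiff ℝ ∞ fun ξ => f p.1 p.2 ξ :=
    hf.smooth.comp_contDiff (f := fun ξ => (p.1, p.2, ξ)) (by fun_prop) fun ξ => mem_phaseSlab hp ξ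
  have hgc : HasCompactSupport fun ξ => f p.1 p.2 ξ :=
    HasCompactSupport.intro (isCompact_closedBall 0 R) fun ξ hξ => hR p hp ξ fun h =>
      hξ (ball_subset_closedBall h)
  have hcont : ∀ v, Continuous fun ξ => slabDeriv T v (fun p => f p.1 p.2 ξ) p := fun v => by
    simp only [slabDeriv_slice hT hf _ hp v]
    exact ((hf.isTestOn.isTestOn_fderivWithin
      (uniqueDiffOn_phaseSlab hT)).smooth.continuousOn.comp_continuous
      (f := fun ξ => (p.1, p.2, ξ)) (by fun_prop) fun ξ => mem_phaseSlab hp ξ).clm_apply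
      continuous_const
  have hcs : ∀ v, HasCompactSupport fun ξ => slabDeriv T v (fun p => f p.1 p.2 ξ) p := fun v =>
    HasCompactSupport.intro (isCompact_closedBall 0 R) fun ξ hξ => by
      have h1 : EqOn (fun p : ℝ × E3 => f p.1 p.2 ξ) (fun _ => 0) (slab T) :=
        fun p hp => hR p hp ξ fun h => hξ (ball_subset_closedBall h)
      rw [slabDeriv_congr h1 hp, slabDeriv]; simp
  have hi0 : Integrable fun ξ => 1 * slabDeriv T timeDir (fun p => f p.1 p.2 ξ) p := by
    simpa using (hcont timeDir).integrable_of_hasCompactSupport (hcs timeDir)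
  have hi : ∀ i, Integrable fun ξ =>
      velocity ξ i * slabDeriv T (spaceDir i) (fun p => f p.1 p.2 ξ) p := fun i =>
    ((continuous_velocity_apply i).mul (hcont _)).integrable_of_hasCompactSupport
      (hcs _).mul_left
  rw [(moment_smooth hT hf continuous_const).2 p hp]
  simp only [(moment_smooth hT hf (continuous_velocity_apply _)).2 p hp]
  rw [← integral_finsetSum _ fun i _ => hi i,
    ← integral_add hi0 (integrable_finsetSum _ fun i _ => hi i),
    ← neg_eq_zero, ← integral_neg, ← integral_lorentz_force hg hgc (E p.1 p.2) (B p.1 p.2)]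
  refine integral_congr_ae (.of_forall fun ξ => ?_)
  have h := hV p.1 hp.1 p.2 ξ
  rw [timeDeriv_eq_slabDeriv hT (g := fun p : ℝ × E3 => f p.1 p.2 ξ) (fun _ _ _ => rfl) (hslice ξ)
    hp.1, inner_gradient_eq_sum (velocity ξ)] at h
  have h2 : ∀ i, partialDeriv i (fun y => f p.1 y ξ) p.2 =
      slabDeriv T (spaceDir i) (fun p => f p.1 p.2 ξ) p := fun i =>
    partialDeriv_slice (hslice ξ) hp.1 p.2 i
  simp only [h2] at h
  simp only [one_mul]
  linarith

end Moments

end VlasovMaxwell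

namespace VlasovMaxwell

/-! ### Smooth solutions of the wave equation on the closed slab -/

section SlabWave

variable {T : ℝ} {g h g' h' : ℝ × E3 → ℝ}

/-- `g` is smooth on the closed slab and satisfies `∂ₜ²g = Δg + h` there. -/
structure IsSlabWave (T : ℝ) (g h : ℝ × E3 → ℝ) : Prop where
  smooth : ContDiffOn ℝ ∞ g (slab T)
  equation : ∀ p ∈ slab T,
    slabDeriv T timeDir (slabDeriv T timeDir g) p = slabLaplacian T g p + h p

theorem _root_.ContDiffOn.differentiableOn_slab (hg : ContDiffOn ℝ ∞ g (slab T)) :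
    DifferentiableOn ℝ g (slab T) := hg.differentiableOn (by simp)

theorem slabDeriv_slabDeriv_add (hT : 0 < T) (hg : ContDiffOn ℝ ∞ g (slab T))
    (hg' : ContDiffOn ℝ ∞ g' (slab T)) (v w : ℝ × E3) {p : ℝ × E3} (hp : p ∈ slab T) :
    slabDeriv T v (slabDeriv T w fun q => g q + g' q) p =
      slabDeriv T v (slabDeriv T w g) p + slabDeriv T v (slabDeriv T w g') p := by
  rw [slabDeriv_congr (fun q hq => slabDeriv_add hT hg.differentiableOn_slab
      hg'.differentiableOn_slab w hq) hp,
    slabDeriv_add hT (contDiffOn_slabDeriv hT hg w).differentiableOn_slab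
      (contDiffOn_slabDeriv hT hg' w).differentiableOn_slab v hp]

theorem slabDeriv_slabDeriv_neg (hT : 0 < T) (v w : ℝ × E3) {p : ℝ × E3} (hp : p ∈ slab T) :
    slabDeriv T v (slabDeriv T w fun q => -g q) p = -slabDeriv T v (slabDeriv T w g) p := by
  rw [slabDeriv_congr (fun q hq => slabDeriv_neg hT w hq) hp, slabDeriv_neg hT v hp]

theorem IsSlabWave.add (hT : 0 < T) (hg : IsSlabWave T g h) (hg' : IsSlabWave T g' h') :
    IsSlabWave T (fun p => g p + g' p) fun p => h p + h' p := by
  refine ⟨hg.smooth.add hg'.smooth, fun p hp => ?_⟩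
  have := fun v w => slabDeriv_slabDeriv_add hT hg.smooth hg'.smooth v w hp
  simp only [slabLaplacian, this, Finset.sum_add_distrib]
  have h1 := hg.equation p hp
  have h2 := hg'.equation p hp
  simp only [slabLaplacian] at h1 h2
  rw [h1, h2]; ring

theorem IsSlabWave.neg (hT : 0 < T) (hg : IsSlabWave T g h) :
    IsSlabWave T (fun p => -g p) fun p => -h p := by
  refine ⟨hg.smooth.neg, fun p hp => ?_⟩
  have := fun v w => slabDeriv_slabDeriv_neg (g := g) hT v w hp
  simp only [slabLaplacian, this, Finset.sum_neg_distrib]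
  have h1 := hg.equation p hp
  simp only [slabLaplacian] at h1
  rw [h1]; ring

theorem slabDeriv_slabDeriv_slabDeriv_comm (hT : 0 < T) (hg : ContDiffOn ℝ ∞ g (slab T))
    (v w : ℝ × E3) {p : ℝ × E3} (hp : p ∈ slab T) :
    slabDeriv T w (slabDeriv T w (slabDeriv T v g)) p =
      slabDeriv T v (slabDeriv T w (slabDeriv T w g)) p := by
  rw [slabDeriv_congr (fun q hq => slabDeriv_comm hT hg w v hq) hp,
    slabDeriv_comm hT (contDiffOn_slabDeriv hT hg w) w v hp]

/-- The operator has constant coefficients and derivatives commute on the closed slab. This yields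
the wave equation for the gauge quantity. -/
theorem IsSlabWave.slabDeriv (hT : 0 < T) (hg : IsSlabWave T g h)
    (hh : ContDiffOn ℝ ∞ h (slab T)) (v : ℝ × E3) :
    IsSlabWave T (slabDeriv T v g) (slabDeriv T v h) := by
  refine ⟨contDiffOn_slabDeriv hT hg.smooth v, fun p hp => ?_⟩
  have h2 := fun i => contDiffOn_slabDeriv hT
    (contDiffOn_slabDeriv hT hg.smooth (spaceDir i)) (spaceDir i)
  simp only [slabLaplacian, slabDeriv_slabDeriv_slabDeriv_comm hT hg.smooth v _ hp]
  rw [slabDeriv_congr hg.equation hp, slabDeriv_add hT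
    (contDiffOn_slabLaplacian hT hg.smooth).differentiableOn_slab hh.differentiableOn_slab v hp]
  congr 1
  exact slabDeriv_sum hT (fun i _ => (h2 i).differentiableOn_slab) v hp

theorem isSlabWave_duhamel (hT : 0 < T) (hh : IsTestOn (slab T) h) :
    IsSlabWave T (duhamel h) h :=
  ⟨contDiffOn_duhamel hT hh, fun _ hp => slabDeriv_timeDir_timeDir_duhamel hT hh hp⟩

theorem IsSlabWave.isWaveSolution (hT : 0 < T) (hg : IsSlabWave T g h) :
    IsWaveSolution T (fun t x => h (t, x)) (fun x => g (0, x))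
      (fun x => VlasovMaxwell.slabDeriv T timeDir g (0, x)) fun t x => g (t, x) where
  contDiffOn_one := hg.smooth.of_le (by simp)
  contDiffOn_two := (hg.smooth.of_le ENat.LEInfty.out).mono fun p hp =>
    ⟨Ioo_subset_Icc_self hp.1, hp.2⟩
  equation t ht x := by
    have ht' := Ioo_subset_Icc_self ht
    rw [dAlembert_eq hT (fun _ _ _ => rfl) hg.smooth ht', hg.equation _ (mem_slab ht' x)]
    ring
  initial _ := rfl
  initial_timeDeriv x := timeDeriv_eq_slabDeriv hT (fun _ _ _ => rfl)
    hg.smooth.differentiableOn_slab (left_mem_Icc.2 hT.le) x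

theorem IsWaveSolution.differentiableWithinAt_timeDeriv (hT : 0 < T) {h : ℝ → E3 → ℝ}
    {w₀ w₁ : E3 → ℝ} {w : ℝ → E3 → ℝ} (hw : IsWaveSolution T h w₀ w₁ w) {t : ℝ}
    (ht : t ∈ Ioo 0 T) (x : E3) :
    DifferentiableWithinAt ℝ (fun s => timeDeriv T w s x) (Icc 0 T) t := by
  set g : ℝ × E3 → ℝ := fun p => w p.1 p.2
  have h2 : ContDiffOn ℝ 1 (dirDeriv timeDir g) (openSlab T) :=
    (hw.contDiffOn_two.fderiv_of_isOpen (isOpen_openSlab T) (m := 1) (by norm_num)).clm_apply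
      contDiffOn_const
  have h3 := (hasDerivAt_time h2 (p := (t, x)) ⟨ht, mem_univ _⟩).differentiableAt
  refine (h3.congr_of_eventuallyEq ?_).differentiableWithinAt
  filter_upwards [isOpen_Ioo.mem_nhds ht] with s hs
  rw [timeDeriv_eq_slabDeriv hT (g := g) (fun _ _ _ => rfl)
    (hw.contDiffOn_one.differentiableOn (by simp)) (Ioo_subset_Icc_self hs), VlasovMaxwell.slabDeriv,
    fderivWithin_of_mem_nhds (slab_mem_nhds hs), dirDeriv]

/-- Classical solutions of the Cauchy problem for the wave equation are unique. -/
theorem IsWaveSolution.unique (hT : 0 < T) {h : ℝ → E3 → ℝ} {w₀ w₁ : E3 → ℝ} {w w' : ℝ → E3 → ℝ}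
    (hw : IsWaveSolution T h w₀ w₁ w) (hw' : IsWaveSolution T h w₀ w₁ w') {t : ℝ}
    (ht : t ∈ Icc 0 T) (x : E3) : w t x = w' t x := by
  have htd : ∀ t ∈ Icc 0 T, ∀ x, timeDeriv T (fun t x => w t x - w' t x) t x =
      timeDeriv T w t x - timeDeriv T w' t x := fun t ht x =>
    derivWithin_fun_sub
      (hasDerivWithinAt_slabDeriv (hw.contDiffOn_one.differentiableOn (by simp))
        ht x).differentiableWithinAt
      (hasDerivWithinAt_slabDeriv (hw'.contDiffOn_one.differentiableOn (by simp))
        ht x).differentiableWithinAt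
  refine sub_eq_zero.1 (IsWaveSolution.eq_zero hT (w := fun t x => w t x - w' t x)
    ⟨?_, ?_, ?_, ?_, ?_⟩ t ht x)
  · exact hw.contDiffOn_one.sub hw'.contDiffOn_one
  · exact hw.contDiffOn_two.sub hw'.contDiffOn_two
  · intro t ht x
    have ht' := Ioo_subset_Icc_self ht
    have h1 := hw.equation t ht x
    have h2 := hw'.equation t ht x
    simp only [dAlembert] at h1 h2 ⊢
    have h3 : timeDeriv T (timeDeriv T fun t x => w t x - w' t x) t x =
        timeDeriv T (timeDeriv T w) t x - timeDeriv T (timeDeriv T w') t x := by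
      rw [timeDeriv, derivWithin_congr (fun s hs => htd s hs x) (htd t ht' x)]
      exact derivWithin_fun_sub (hw.differentiableWithinAt_timeDeriv hT ht x)
        (hw'.differentiableWithinAt_timeDeriv hT ht x)
    have h4 : Laplacian.laplacian (fun x => w t x - w' t x) x =
        Laplacian.laplacian (w t) x - Laplacian.laplacian (w' t) x :=
      (contDiff_slice_openSlab hw.contDiffOn_two ht).contDiffAt.laplacian_sub
        (contDiff_slice_openSlab hw'.contDiffOn_two ht).contDiffAt
    rw [h3, h4]
    linarith
  · intro x; rw [hw.initial, hw'.initial, sub_self]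
  · intro x
    rw [htd 0 (left_mem_Icc.2 hT.le), hw.initial_timeDeriv, hw'.initial_timeDeriv, sub_self]

theorem IsSlabWave.eq_zero (hT : 0 < T) (hg : IsSlabWave T g h) (hh : ∀ p ∈ slab T, h p = 0)
    (h0 : ∀ x, g (0, x) = 0) (h1 : ∀ x, VlasovMaxwell.slabDeriv T timeDir g (0, x) = 0) :
    ∀ p ∈ slab T, g p = 0 := by
  intro p hp
  have hg' : IsSlabWave T g fun _ => 0 :=
    ⟨hg.smooth, fun p hp => by rw [hg.equation p hp, hh p hp]⟩
  have := hg'.isWaveSolution hT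
  simp only [h0, h1] at this
  exact this.eq_zero hT p.1 hp.1 p.2

theorem slabDeriv_spaceDir_initial (hT : 0 < T) (hg : ContDiffOn ℝ ∞ g (slab T))
    (h0 : ∀ x, g (0, x) = 0) (i : Fin 3) (x : E3) : slabDeriv T (spaceDir i) g (0, x) = 0 := by
  rw [← partialDeriv_slice hg.differentiableOn_slab (left_mem_Icc.2 hT.le)]
  simp [h0, partialDeriv]

theorem slabDeriv_timeDir_snd (hT : 0 < T) {q : E3 → ℝ} (hq : ContDiff ℝ ∞ q) {p : ℝ × E3}
    (hp : p ∈ slab T) : slabDeriv T timeDir (fun p => q p.2) p = 0 := by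
  have h1 : HasFDerivAt (fun p : ℝ × E3 => q p.2) _ p :=
    ((hq.differentiable (by simp)) p.2).hasFDerivAt.comp p hasFDerivAt_snd
  rw [slabDeriv, h1.hasFDerivWithinAt.fderivWithin (uniqueDiffOn_slab hT p hp)]
  simp [timeDir]

/-- A static function has no time derivatives, so Poisson's equation $-\Delta w=\rho$ is a wave
equation with source `ρ`. -/
theorem isSlabWave_newtonPotential (hT : 0 < T) {ρ : E3 → ℝ} (hρ : ContDiff ℝ ∞ ρ)
    (hc : HasCompactSupport ρ) :
    IsSlabWave T (fun p => newtonPotential ρ p.2) fun p => ρ p.2 := by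
  have hN := contDiff_newtonPotential hρ hc
  have hs : ContDiffOn ℝ ∞ (fun p : ℝ × E3 => newtonPotential ρ p.2) (slab T) :=
    (hN.comp contDiff_snd).contDiffOn
  refine ⟨hs, fun p hp => ?_⟩
  rw [slabDeriv_congr (fun q hq => slabDeriv_timeDir_snd hT hN hq) hp,
    show p = (p.1, p.2) from rfl, ← laplacian_slice hT hs hp.1,
    laplacian_newtonPotential hρ hc]
  simp [slabDeriv]

theorem timeDeriv_apply (hT : 0 < T) {V : ℝ → E3 → E3} {G : Fin 3 → ℝ × E3 → ℝ}
    (hV : ∀ t ∈ Icc 0 T, ∀ x i, V t x i = G i (t, x))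
    (hG : ∀ i, DifferentiableOn ℝ (G i) (slab T)) {t : ℝ} (ht : t ∈ Icc 0 T) (x : E3) (i : Fin 3) :
    timeDeriv T V t x i = slabDeriv T timeDir (G i) (t, x) := by
  have hd : ∀ i, HasDerivWithinAt (fun s => V s x i) (slabDeriv T timeDir (G i) (t, x))
      (Icc 0 T) t := fun i =>
    (hasDerivWithinAt_slabDeriv (hG i) ht x).congr (fun s hs => hV s hs x i) (hV t ht x i)
  have h1 : DifferentiableWithinAt ℝ (fun s => V s x) (Icc 0 T) t :=
    differentiableWithinAt_euclidean.2 fun i => (hd i).differentiableWithinAt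
  have h2 := (PiLp.proj (𝕜 := ℝ) 2 (fun _ : Fin 3 => ℝ) i).hasFDerivAt.comp_hasDerivWithinAt t
    h1.hasDerivWithinAt
  exact (uniqueDiffOn_Icc hT t ht).eq_deriv _ h2 (hd i)

end SlabWave

end VlasovMaxwell

namespace VlasovMaxwell

/-! ### Maxwell's equations for potentials in the Lorentz gauge -/

section Potentials

variable {T : ℝ}

/-- Indices in `Fin 3` are cyclic, so this form treats the three components at once. -/
theorem curl_apply (F : E3 → E3) (x : E3) (i : Fin 3) : curl F x i =
    partialDeriv (i + 1) (fun y => F y (i + 2)) x -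
      partialDeriv (i + 2) (fun y => F y (i + 1)) x := by
  fin_cases i <;> rfl

theorem sum_fin_three_cyclic (a : Fin 3 → ℝ) (i : Fin 3) :
    ∑ j, a j = a i + a (i + 1) + a (i + 2) := by
  rw [Fin.sum_univ_three]
  fin_cases i
  · rfl
  · show a 0 + a 1 + a 2 = a 1 + a 2 + a 0; ring
  · show a 0 + a 1 + a 2 = a 2 + a 0 + a 1; ring

/-- The components of the curl of a time dependent vector field given by its components. -/
noncomputable def slabCurl (T : ℝ) (A : Fin 3 → ℝ × E3 → ℝ) (i : Fin 3) (p : ℝ × E3) : ℝ :=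
  slabDeriv T (spaceDir (i + 1)) (A (i + 2)) p - slabDeriv T (spaceDir (i + 2)) (A (i + 1)) p

theorem curl_slice {V : E3 → E3} {A : Fin 3 → ℝ × E3 → ℝ} {t : ℝ} (ht : t ∈ Icc 0 T)
    (hV : ∀ x i, V x i = A i (t, x)) (hA : ∀ i, DifferentiableOn ℝ (A i) (slab T)) (x : E3)
    (i : Fin 3) : curl V x i = slabCurl T A i (t, x) := by
  simp only [curl_apply, hV, partialDeriv_slice (hA _) ht, slabCurl]

theorem divergence_slice {V : E3 → E3} {A : Fin 3 → ℝ × E3 → ℝ} {t : ℝ} (ht : t ∈ Icc 0 T)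
    (hV : ∀ x i, V x i = A i (t, x)) (hA : ∀ i, DifferentiableOn ℝ (A i) (slab T)) (x : E3) :
    divergence V x = ∑ i, slabDeriv T (spaceDir i) (A i) (t, x) := by
  simp only [divergence, hV, partialDeriv_slice (hA _) ht]

theorem contDiffOn_slabCurl (hT : 0 < T) {A : Fin 3 → ℝ × E3 → ℝ}
    (hA : ∀ i, ContDiffOn ℝ ∞ (A i) (slab T)) (i : Fin 3) :
    ContDiffOn ℝ ∞ (slabCurl T A i) (slab T) :=
  (contDiffOn_slabDeriv hT (hA _) _).sub (contDiffOn_slabDeriv hT (hA _) _)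

theorem slabDeriv_slabCurl (hT : 0 < T) {A : Fin 3 → ℝ × E3 → ℝ}
    (hA : ∀ i, ContDiffOn ℝ ∞ (A i) (slab T)) (i : Fin 3) (v : ℝ × E3) {p : ℝ × E3}
    (hp : p ∈ slab T) : slabDeriv T v (slabCurl T A i) p =
      slabDeriv T v (slabDeriv T (spaceDir (i + 1)) (A (i + 2))) p -
        slabDeriv T v (slabDeriv T (spaceDir (i + 2)) (A (i + 1))) p :=
  slabDeriv_sub hT (contDiffOn_slabDeriv hT (hA _) _).differentiableOn_slab
    (contDiffOn_slabDeriv hT (hA _) _).differentiableOn_slab v hp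

/-- The components of the electric field of an electromagnetic potential. -/
noncomputable def slabElectric (T : ℝ) (Φ : ℝ × E3 → ℝ) (A : Fin 3 → ℝ × E3 → ℝ) (i : Fin 3)
    (p : ℝ × E3) : ℝ :=
  -slabDeriv T timeDir (A i) p - slabDeriv T (spaceDir i) Φ p

variable {Φ R : ℝ × E3 → ℝ} {A J : Fin 3 → ℝ × E3 → ℝ}

theorem contDiffOn_slabElectric (hT : 0 < T) (hΦ : ContDiffOn ℝ ∞ Φ (slab T))
    (hA : ∀ i, ContDiffOn ℝ ∞ (A i) (slab T)) (i : Fin 3) :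
    ContDiffOn ℝ ∞ (slabElectric T Φ A i) (slab T) :=
  (contDiffOn_slabDeriv hT (hA _) _).neg.sub (contDiffOn_slabDeriv hT hΦ _)

theorem slabDeriv_slabElectric (hT : 0 < T) (hΦ : ContDiffOn ℝ ∞ Φ (slab T))
    (hA : ∀ i, ContDiffOn ℝ ∞ (A i) (slab T)) (i : Fin 3) (v : ℝ × E3) {p : ℝ × E3}
    (hp : p ∈ slab T) : slabDeriv T v (slabElectric T Φ A i) p =
      -slabDeriv T v (slabDeriv T timeDir (A i)) p -
        slabDeriv T v (slabDeriv T (spaceDir i) Φ) p :=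
  (slabDeriv_sub hT (contDiffOn_slabDeriv hT (hA _) _).neg.differentiableOn_slab
    (contDiffOn_slabDeriv hT hΦ _).differentiableOn_slab v hp).trans
    (by rw [slabDeriv_neg hT v hp])

theorem electricField_apply (hT : 0 < T) (hΦ : ContDiffOn ℝ ∞ Φ (slab T))
    (hA : ∀ i, ContDiffOn ℝ ∞ (A i) (slab T)) {φ : ℝ → E3 → ℝ} {V : ℝ → E3 → E3}
    (hφ : ∀ t ∈ Icc 0 T, ∀ x, φ t x = Φ (t, x)) (hV : ∀ t ∈ Icc 0 T, ∀ x i, V t x i = A i (t, x))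
    {t : ℝ} (ht : t ∈ Icc 0 T) (x : E3) (i : Fin 3) :
    electricField T φ V t x i = slabElectric T Φ A i (t, x) := by
  have h1 := timeDeriv_apply hT hV (fun i => (hA i).differentiableOn_slab) ht x i
  have h2 : gradient (φ t) x i = slabDeriv T (spaceDir i) Φ (t, x) := by
    rw [gradient_apply, show φ t = fun y => Φ (t, y) from funext (hφ t ht),
      partialDeriv_slice hΦ.differentiableOn_slab ht]
  simp [electricField, slabElectric, h1, h2]

theorem div_slabCurl (hT : 0 < T) (hA : ∀ i, ContDiffOn ℝ ∞ (A i) (slab T)) {p : ℝ × E3}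
    (hp : p ∈ slab T) : ∑ i, slabDeriv T (spaceDir i) (slabCurl T A i) p = 0 := by
  simp only [slabDeriv_slabCurl hT hA _ _ hp, Fin.sum_univ_three]
  have h1 := slabDeriv_comm hT (hA 2) (spaceDir 0) (spaceDir 1) hp
  have h2 := slabDeriv_comm hT (hA 1) (spaceDir 0) (spaceDir 2) hp
  have h3 := slabDeriv_comm hT (hA 0) (spaceDir 1) (spaceDir 2) hp
  simp only [Fin.isValue, Fin.reduceAdd, zero_add]
  rw [h1, h2, h3]; ring

/-- Only the symmetry of second derivatives enters; neither the wave equations nor the gauge is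
needed. -/
theorem slab_faraday (hT : 0 < T) (hΦ : ContDiffOn ℝ ∞ Φ (slab T))
    (hA : ∀ i, ContDiffOn ℝ ∞ (A i) (slab T)) (i : Fin 3) {p : ℝ × E3} (hp : p ∈ slab T) :
    slabDeriv T timeDir (slabCurl T A i) p + slabCurl T (slabElectric T Φ A) i p = 0 := by
  rw [slabDeriv_slabCurl hT hA i _ hp]
  simp only [slabCurl, slabDeriv_slabElectric hT hΦ hA _ _ hp]
  rw [slabDeriv_comm hT (hA _) timeDir (spaceDir (i + 1)) hp,
    slabDeriv_comm hT (hA _) timeDir (spaceDir (i + 2)) hp,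
    slabDeriv_comm hT hΦ (spaceDir (i + 1)) (spaceDir (i + 2)) hp]
  ring

/-- The divergence of the potential in space-time; it vanishes in the Lorentz gauge. -/
noncomputable def slabGauge (T : ℝ) (Φ : ℝ × E3 → ℝ) (A : Fin 3 → ℝ × E3 → ℝ) (p : ℝ × E3) : ℝ :=
  slabDeriv T timeDir Φ p + ∑ i, slabDeriv T (spaceDir i) (A i) p

theorem slabDeriv_slabGauge (hT : 0 < T) (hΦ : ContDiffOn ℝ ∞ Φ (slab T))
    (hA : ∀ i, ContDiffOn ℝ ∞ (A i) (slab T)) (v : ℝ × E3) {p : ℝ × E3}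
    (hp : p ∈ slab T) : slabDeriv T v (slabGauge T Φ A) p =
      slabDeriv T v (slabDeriv T timeDir Φ) p +
        ∑ i, slabDeriv T v (slabDeriv T (spaceDir i) (A i)) p := by
  have hd := fun i => contDiffOn_slabDeriv hT (hA i) (spaceDir i)
  exact (slabDeriv_add hT (contDiffOn_slabDeriv hT hΦ _).differentiableOn_slab
    (ContDiffOn.sum fun i _ => hd i).differentiableOn_slab v hp).trans
    (congrArg _ (slabDeriv_sum hT (fun i _ => (hd i).differentiableOn_slab) v hp))

theorem slabDeriv_slabGauge_eq_zero (hT : 0 < T) (hΦ : ContDiffOn ℝ ∞ Φ (slab T))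
    (hA : ∀ i, ContDiffOn ℝ ∞ (A i) (slab T)) (hL : ∀ p ∈ slab T, slabGauge T Φ A p = 0)
    (v : ℝ × E3) {p : ℝ × E3} (hp : p ∈ slab T) :
    slabDeriv T v (slabDeriv T timeDir Φ) p +
        ∑ i, slabDeriv T v (slabDeriv T (spaceDir i) (A i)) p = 0 := by
  rw [← slabDeriv_slabGauge hT hΦ hA v hp,
    slabDeriv_congr (h := fun _ => 0) (fun q hq => hL q hq) hp, slabDeriv]
  simp

/-- $\operatorname{div}E=-\partial_t\operatorname{div}A-\Delta\Phi$, and the time derivative of the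
gauge condition replaces $-\partial_t\operatorname{div}A$ by $\partial_t^2\Phi$, leaving $\Box\Phi$.
-/
theorem slab_gauss (hT : 0 < T) (hΦ : IsSlabWave T Φ R)
    (hA : ∀ i, ContDiffOn ℝ ∞ (A i) (slab T)) (hL : ∀ p ∈ slab T, slabGauge T Φ A p = 0)
    {p : ℝ × E3} (hp : p ∈ slab T) :
    ∑ i, slabDeriv T (spaceDir i) (slabElectric T Φ A i) p = R p := by
  have h1 := slabDeriv_slabGauge_eq_zero hT hΦ.smooth hA hL timeDir hp
  have h2 := hΦ.equation p hp
  simp only [slabDeriv_slabElectric hT hΦ.smooth hA _ _ hp, Finset.sum_sub_distrib,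
    Finset.sum_neg_distrib]
  have h3 : ∀ i, slabDeriv T (spaceDir i) (slabDeriv T timeDir (A i)) p =
      slabDeriv T timeDir (slabDeriv T (spaceDir i) (A i)) p := fun i =>
    slabDeriv_comm hT (hA i) _ _ hp
  simp only [h3]
  simp only [slabLaplacian] at h2
  linarith

/-- Expand $\operatorname{curl}\operatorname{curl}A=\nabla\operatorname{div}A-\Delta A$. By the
gauge, $\nabla\operatorname{div}A$ cancels the term $\partial_t\nabla\Phi$ of $\partial_tE$, leaving
$-\Box A$. -/
theorem slab_ampere (hT : 0 < T) (hΦ : ContDiffOn ℝ ∞ Φ (slab T))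
    (hA : ∀ i, IsSlabWave T (A i) (J i)) (hL : ∀ p ∈ slab T, slabGauge T Φ A p = 0)
    (i : Fin 3) {p : ℝ × E3} (hp : p ∈ slab T) :
    slabDeriv T timeDir (slabElectric T Φ A i) p - slabCurl T (slabCurl T A) i p = -J i p := by
  have hAs := fun i => (hA i).smooth
  have h1 := slabDeriv_slabGauge_eq_zero hT hΦ hAs hL (spaceDir i) hp
  have h2 := (hA i).equation p hp
  rw [slabDeriv_slabElectric hT hΦ hAs _ _ hp]
  have e1 : i + 1 + 1 = i + 2 := by fin_cases i <;> rfl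
  have e2 : i + 1 + 2 = i := by fin_cases i <;> rfl
  have e3 : i + 2 + 1 = i := by fin_cases i <;> rfl
  have e4 : i + 2 + 2 = i + 1 := by fin_cases i <;> rfl
  rw [show slabCurl T (slabCurl T A) i p =
      slabDeriv T (spaceDir (i + 1)) (slabCurl T A (i + 2)) p -
        slabDeriv T (spaceDir (i + 2)) (slabCurl T A (i + 1)) p from rfl,
    slabDeriv_slabCurl hT hAs _ _ hp, slabDeriv_slabCurl hT hAs _ _ hp, e1, e2, e3, e4]
  rw [slabLaplacian, sum_fin_three_cyclic _ i] at h2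
  rw [sum_fin_three_cyclic _ i, slabDeriv_comm hT hΦ (spaceDir i) timeDir hp,
    slabDeriv_comm hT (hAs _) (spaceDir i) (spaceDir (i + 1)) hp,
    slabDeriv_comm hT (hAs _) (spaceDir i) (spaceDir (i + 2)) hp] at h1
  linarith

/-- A potential which solves the wave equations with sources satisfying the continuity equation,
and which starts from electrostatic initial data, is in the Lorentz gauge. -/
theorem slabGauge_eq_zero (hT : 0 < T) (hΦ : IsSlabWave T Φ R)
    (hA : ∀ i, IsSlabWave T (A i) (J i)) (hR : ContDiffOn ℝ ∞ R (slab T))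
    (hJ : ∀ i, ContDiffOn ℝ ∞ (J i) (slab T))
    (hcont : ∀ p ∈ slab T, slabDeriv T timeDir R p + ∑ i, slabDeriv T (spaceDir i) (J i) p = 0)
    (hA0 : ∀ i x, A i (0, x) = 0) (hA1 : ∀ i x, slabDeriv T timeDir (A i) (0, x) = 0)
    (hΦ1 : ∀ x, slabDeriv T timeDir Φ (0, x) = 0)
    (hΦ2 : ∀ x, slabLaplacian T Φ (0, x) = -R (0, x)) :
    ∀ p ∈ slab T, slabGauge T Φ A p = 0 := by
  have hAs := fun i => (hA i).smooth
  have hmem := fun x : E3 => mem_slab (left_mem_Icc.2 hT.le) x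
  have hwave : IsSlabWave T (slabGauge T Φ A)
      fun p => slabDeriv T timeDir R p + ∑ i, slabDeriv T (spaceDir i) (J i) p := by
    have h := fun i => (hA i).slabDeriv hT (hJ i) (spaceDir i)
    have := (hΦ.slabDeriv hT hR timeDir).add hT (((h 0).add hT (h 1)).add hT (h 2))
    simp only [Fin.sum_univ_three]
    refine (?_ : (fun p => slabDeriv T timeDir Φ p + (slabDeriv T (spaceDir 0) (A 0) p +
      slabDeriv T (spaceDir 1) (A 1) p + slabDeriv T (spaceDir 2) (A 2) p)) =
      slabGauge T Φ A) ▸ this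
    funext p
    rw [slabGauge, Fin.sum_univ_three]
  refine hwave.eq_zero hT hcont (fun x => ?_) fun x => ?_
  · simp [slabGauge, hΦ1, slabDeriv_spaceDir_initial hT (hAs _) (hA0 _)]
  -- Initially $\partial_tG=\partial_t^2\Phi+\operatorname{div}\partial_tA=\Delta\Phi+R$, since
  -- $\partial_tA=0$; Poisson's equation for the data makes this zero.
  · rw [slabDeriv_slabGauge hT hΦ.smooth hAs _ (hmem x), hΦ.equation _ (hmem x), hΦ2]
    have : ∀ i, slabDeriv T timeDir (slabDeriv T (spaceDir i) (A i)) (0, x) = 0 := fun i => by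
      rw [slabDeriv_comm hT (hAs i) _ _ (hmem x)]
      exact slabDeriv_spaceDir_initial hT (contDiffOn_slabDeriv hT (hAs i) _) (hA1 i) i x
    simp [this]

end Potentials

/-! ### The scalar formulation -/

section ScalarFormulation

variable {T : ℝ} {fin : E3 → E3 → ℝ} {f u : ℝ → E3 → E3 → ℝ} {φ₀ : ℝ → E3 → ℝ}

/-- Uniqueness is used for each momentum separately, so no regularity of `u` in `ξ` is needed. -/
theorem IsScalarSolution.eq_duhamel (hT : 0 < T) (hf : IsSmoothCompactlySupported T f)
    (hfu : IsScalarSolution T fin φ₀ f u) {p : ℝ × E3} (hp : p ∈ slab T) (ξ : E3) :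
    u p.1 p.2 ξ = duhamel (fun q => f q.1 q.2 ξ) p := by
  have hs := (hf.isTestOn_slice ξ)
  have h := (isSlabWave_duhamel hT hs).isWaveSolution hT
  simp only [duhamel_initial, slabDeriv_timeDir_duhamel_initial hT hs] at h
  exact (hfu.wave ξ).unique hT h hp.1 p.2

theorem chargeDensity_eq_moment (f : ℝ → E3 → E3 → ℝ) (p : ℝ × E3) :
    chargeDensity (f p.1) p.2 = moment (fun _ => 1) f p := by
  simp [chargeDensity, moment]

theorem currentDensity_apply (hf : IsSmoothCompactlySupported T f) {p : ℝ × E3} (hp : p ∈ slab T)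
    (i : Fin 3) : currentDensity (f p.1) p.2 i = moment (fun ξ => velocity ξ i) f p := by
  obtain ⟨R, hR⟩ := hf.exists_radius
  have hg : Continuous fun ξ => f p.1 p.2 ξ :=
    hf.smooth.continuousOn.comp_continuous (f := fun ξ => (p.1, p.2, ξ)) (by fun_prop)
      fun ξ => mem_phaseSlab hp ξ
  have hgc : HasCompactSupport fun ξ => f p.1 p.2 ξ :=
    HasCompactSupport.intro (isCompact_closedBall 0 R) fun ξ hξ => hR p hp ξ fun h =>
      hξ (ball_subset_closedBall h)
  have hi : ∀ i, Integrable fun ξ => (f p.1 p.2 ξ • velocity ξ) i := fun i =>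
    (hg.mul (continuous_velocity_apply i)).integrable_of_hasCompactSupport hgc.mul_right
  rw [currentDensity, eval_integral_piLp hi, moment]
  simp [mul_comm]

theorem IsScalarSolution.integrable (hT : 0 < T) (hf : IsSmoothCompactlySupported T f)
    (hfu : IsScalarSolution T fin φ₀ f u) {p : ℝ × E3} (hp : p ∈ slab T) :
    Integrable (fun ξ => u p.1 p.2 ξ) ∧ Integrable (fun ξ => u p.1 p.2 ξ • velocity ξ) := by
  simp only [hfu.eq_duhamel hT hf hp]
  have h := (integral_duhamel_slice hf (m := fun _ => 1) continuous_const hp).1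
  simp only [one_mul] at h
  refine ⟨h, Integrable.of_eval_piLp fun i => ?_⟩
  have := (integral_duhamel_slice hf (continuous_velocity_apply i) hp).1
  simpa [mul_comm] using this

theorem IsScalarSolution.vectorPotential_apply (hT : 0 < T) (hf : IsSmoothCompactlySupported T f)
    (hfu : IsScalarSolution T fin φ₀ f u) {p : ℝ × E3} (hp : p ∈ slab T) (i : Fin 3) :
    vectorPotential u p.1 p.2 i = duhamel (moment (fun ξ => velocity ξ i) f) p := by
  rw [vectorPotential, eval_integral_piLp (hfu.integrable hT hf hp).2.eval_piLp,
    ← (integral_duhamel_slice hf (continuous_velocity_apply i) hp).2]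
  simp only [hfu.eq_duhamel hT hf hp]
  simp [mul_comm]

/-- The initial charge density as a function on space. -/
theorem chargeDensity_smooth (hT : 0 < T) (hf : IsSmoothCompactlySupported T f)
    (hfin : ∀ x ξ, f 0 x ξ = fin x ξ) : (∀ x, chargeDensity fin x = moment (fun _ => 1) f (0, x)) ∧
      ContDiff ℝ ∞ (chargeDensity fin) ∧ HasCompactSupport (chargeDensity fin) := by
  have h0 : ∀ x, chargeDensity fin x = moment (fun _ => 1) f (0, x) := fun x => by
    rw [← chargeDensity_eq_moment]
    simp [chargeDensity, hfin]
  have hR := (moment_smooth hT hf (m := fun _ => 1) continuous_const).1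
  have ht := left_mem_Icc.2 hT.le
  obtain ⟨K, hK, hK0⟩ := hR.support
  refine ⟨h0, ?_, ?_⟩
  · rw [funext h0]; exact contDiff_slice hR.smooth ht
  · refine HasCompactSupport.intro (hK.image continuous_snd) fun x hx => ?_
    rw [h0, hK0 _ (mem_slab ht x) fun h => hx ⟨_, h, rfl⟩]

theorem isTestOn_comp_snd {ρ : E3 → ℝ} (hρ : ContDiff ℝ ∞ ρ) (hc : HasCompactSupport ρ) :
    IsTestOn (slab T) fun p => ρ p.2 :=
  ⟨(hρ.comp contDiff_snd).contDiffOn, Icc 0 T ×ˢ tsupport ρ, isCompact_Icc.prod hc, fun _ hp hpK =>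
    image_eq_zero_of_notMem_tsupport fun h => hpK ⟨hp.1, h⟩⟩

/-- The scalar potential, as the sum of a static part and of two Duhamel integrals. -/
noncomputable def scalarPotentialFormula (ρ : E3 → ℝ) (f : ℝ → E3 → E3 → ℝ) (p : ℝ × E3) : ℝ :=
  newtonPotential ρ p.2 + -duhamel (fun q => ρ q.2) p + duhamel (moment (fun _ => 1) f) p

/-- The free potential in closed form. The static Newtonian potential and the Duhamel term have the
same source `ρ`, so the difference is a free wave; the Duhamel term has zero Cauchy data and leaves
the initial values unchanged. -/
theorem isSlabWave_static (hT : 0 < T) {ρ : E3 → ℝ} (hρ : ContDiff ℝ ∞ ρ)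
    (hc : HasCompactSupport ρ) : IsSlabWave T
      (fun p => newtonPotential ρ p.2 + -duhamel (fun q => ρ q.2) p) fun p => ρ p.2 + -ρ p.2 :=
  (isSlabWave_newtonPotential hT hρ hc).add hT
    ((isSlabWave_duhamel hT (isTestOn_comp_snd hρ hc)).neg hT)

theorem slabDeriv_timeDir_static_initial (hT : 0 < T) {ρ : E3 → ℝ} (hρ : ContDiff ℝ ∞ ρ)
    (hc : HasCompactSupport ρ) (x : E3) : slabDeriv T timeDir
      (fun p => newtonPotential ρ p.2 + -duhamel (fun q => ρ q.2) p) (0, x) = 0 := by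
  have hp := mem_slab (left_mem_Icc.2 hT.le) x
  rw [slabDeriv_add hT (isSlabWave_newtonPotential hT hρ hc).smooth.differentiableOn_slab
    (contDiffOn_duhamel hT (isTestOn_comp_snd hρ hc)).neg.differentiableOn_slab _ hp,
    slabDeriv_neg hT _ hp, slabDeriv_timeDir_duhamel_initial hT (isTestOn_comp_snd hρ hc),
    slabDeriv_timeDir_snd hT (contDiff_newtonPotential hρ hc) hp]
  simp

theorem IsScalarSolution.scalarPotential_eq (hT : 0 < T) (hf : IsSmoothCompactlySupported T f)
    (hφ₀ : IsWaveSolution T (fun _ _ => 0) (newtonPotential (chargeDensity fin)) (fun _ => 0) φ₀)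
    (hfu : IsScalarSolution T fin φ₀ f u) {p : ℝ × E3} (hp : p ∈ slab T) :
    scalarPotential φ₀ u p.1 p.2 = scalarPotentialFormula (chargeDensity fin) f p := by
  obtain ⟨-, hρ, hc⟩ := chargeDensity_smooth hT hf hfu.initial
  have h := (isSlabWave_static hT hρ hc).isWaveSolution hT
  simp only [duhamel_initial, slabDeriv_timeDir_static_initial hT hρ hc, add_neg_cancel, neg_zero,
    add_zero] at h
  rw [scalarPotential, hφ₀.unique hT h hp.1 p.2, scalarPotentialFormula,
    ← (integral_duhamel_slice hf (m := fun _ => 1) continuous_const hp).2]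
  simp only [hfu.eq_duhamel hT hf hp, one_mul]

end ScalarFormulation

end VlasovMaxwell

/-! ### The theorem, assembled from the explicit potentials -/

theorem mainTheorem5 (T : ℝ) (hT : 0 < T)
    (fin : E3 → E3 → ℝ) (f u : ℝ → E3 → E3 → ℝ) (φ₀ : ℝ → E3 → ℝ)
    (hf : IsSmoothCompactlySupported T f)
    (hφ₀ : IsWaveSolution T (fun _ _ => 0) (newtonPotential (chargeDensity fin)) (fun _ => 0) φ₀)
    (hfu : IsScalarSolution T fin φ₀ f u) :
    (∀ t ∈ Icc 0 T, ∀ x : E3,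
      Integrable (fun ξ => u t x ξ) ∧ Integrable (fun ξ => u t x ξ • velocity ξ)) ∧
    ContDiffOn ℝ ∞ (fun p : ℝ × E3 => scalarPotential φ₀ u p.1 p.2) (slab T) ∧
    ContDiffOn ℝ ∞ (fun p : ℝ × E3 => vectorPotential u p.1 p.2) (slab T) ∧
    (∀ t ∈ Icc 0 T, ∀ x : E3,
      timeDeriv T (scalarPotential φ₀ u) t x + divergence (vectorPotential u t) x = 0) ∧
    IsVlasovMaxwellSolution T f
      (electricField T (scalarPotential φ₀ u) (vectorPotential u))
      (magneticField (vectorPotential u)) ∧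
    HasElectrostaticInitialData fin f
      (electricField T (scalarPotential φ₀ u) (vectorPotential u))
      (magneticField (vectorPotential u)) := by
  obtain ⟨hρ0, hρ, hρc⟩ := chargeDensity_smooth hT hf hfu.initial
  have hR := (moment_smooth hT hf (m := fun _ => 1) continuous_const).1
  have hJ := fun i => (moment_smooth hT hf (continuous_velocity_apply i)).1
  set Φ := scalarPotentialFormula (chargeDensity fin) f with hΦdef
  set A : Fin 3 → ℝ × E3 → ℝ := fun i => duhamel (moment (fun ξ => velocity ξ i) f) with hAdef
  have hφ : ∀ t ∈ Icc 0 T, ∀ x, scalarPotential φ₀ u t x = Φ (t, x) := fun t ht x =>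
    hfu.scalarPotential_eq hT hf hφ₀ (p := (t, x)) (mem_slab ht x)
  have hV : ∀ t ∈ Icc 0 T, ∀ x i, vectorPotential u t x i = A i (t, x) := fun t ht x i =>
    hfu.vectorPotential_apply hT hf (p := (t, x)) (mem_slab ht x) i
  have ht0 := left_mem_Icc.2 hT.le
  have hmem0 := fun x : E3 => mem_slab ht0 x
  have hΦ0 : ∀ x, Φ (0, x) = newtonPotential (chargeDensity fin) x := fun x => by
    simp [hΦdef, scalarPotentialFormula, duhamel_initial]
  have hΦw : IsSlabWave T Φ (moment (fun _ => 1) f) := by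
    have := (isSlabWave_static hT hρ hρc).add hT (isSlabWave_duhamel hT hR)
    simp only [add_neg_cancel, zero_add] at this
    exact this
  have hAw : ∀ i, IsSlabWave T (A i) (moment (fun ξ => velocity ξ i) f) := fun i =>
    isSlabWave_duhamel hT (hJ i)
  have hAs := fun i => (hAw i).smooth
  have hA0 : ∀ i x, A i (0, x) = 0 := fun i x => duhamel_initial x
  have hA1 : ∀ i x, slabDeriv T timeDir (A i) (0, x) = 0 := fun i x =>
    slabDeriv_timeDir_duhamel_initial hT (hJ i) x
  have hΦ1 : ∀ x, slabDeriv T timeDir Φ (0, x) = 0 := fun x =>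
    (slabDeriv_add hT (isSlabWave_static hT hρ hρc).smooth.differentiableOn_slab
      (contDiffOn_duhamel hT hR).differentiableOn_slab _ (hmem0 x)).trans (by
      rw [slabDeriv_timeDir_static_initial hT hρ hρc,
        slabDeriv_timeDir_duhamel_initial hT hR, add_zero])
  -- At $t=0$ both Duhamel terms vanish and `Φ` is the Newtonian potential of the initial charge.
  have hΦ2 : ∀ x, slabLaplacian T Φ (0, x) = -moment (fun _ => 1) f (0, x) := fun x => by
    rw [← laplacian_slice hT hΦw.smooth ht0, funext hΦ0, laplacian_newtonPotential hρ hρc, hρ0]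
  have hgauge := slabGauge_eq_zero hT hΦw hAw hR.smooth (fun i => (hJ i).smooth)
    (fun p hp => continuity_equation hT hf hfu.vlasov hp) hA0 hA1 hΦ1 hΦ2
  have hE := fun t (ht : t ∈ Icc 0 T) => electricField_apply hT hΦw.smooth hAs hφ hV ht
  have hB : ∀ t ∈ Icc 0 T, ∀ x i, magneticField (vectorPotential u) t x i =
      slabCurl T A i (t, x) := fun t ht x i =>
    curl_slice ht (hV t ht) (fun i => (hAs i).differentiableOn_slab) x i
  have hEs := contDiffOn_slabElectric hT hΦw.smooth hAs
  have hBs := contDiffOn_slabCurl hT hAs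
  refine ⟨fun t ht x => hfu.integrable hT hf (p := (t, x)) (mem_slab ht x),
    hΦw.smooth.congr fun p hp => hφ p.1 hp.1 p.2,
    contDiffOn_euclidean.2 fun i => (hAs i).congr fun p hp => hV p.1 hp.1 p.2 i,
    fun t ht x => ?_, ⟨hf.smooth.of_le (by simp), ?_, ?_, hfu.vlasov, fun t ht x => ?_,
      fun t ht x => ?_, fun t ht x => ?_, fun t ht x => ?_⟩, ⟨hfu.initial, fun x => ?_,
      fun x => ?_⟩⟩
  · rw [timeDeriv_eq_slabDeriv hT hφ hΦw.smooth.differentiableOn_slab ht,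
      divergence_slice ht (hV t ht) fun i => (hAs i).differentiableOn_slab]
    exact hgauge _ (mem_slab ht x)
  · exact contDiffOn_euclidean.2 fun i => ((hEs i).of_le (by simp)).congr fun p hp =>
      hE p.1 hp.1 p.2 i
  · exact contDiffOn_euclidean.2 fun i => ((hBs i).of_le (by simp)).congr fun p hp =>
      hB p.1 hp.1 p.2 i
  · rw [divergence_slice ht (hB t ht) fun i => (hBs i).differentiableOn_slab]
    exact div_slabCurl hT hAs (mem_slab ht x)
  · ext i
    rw [PiLp.add_apply, timeDeriv_apply hT hB (fun i => (hBs i).differentiableOn_slab) ht,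
      curl_slice ht (hE t ht) (fun i => (hEs i).differentiableOn_slab)]
    exact slab_faraday hT hΦw.smooth hAs i (mem_slab ht x)
  · rw [divergence_slice ht (hE t ht) fun i => (hEs i).differentiableOn_slab,
      slab_gauss hT hΦw hAs hgauge (mem_slab ht x), ← chargeDensity_eq_moment]
  · ext i
    rw [PiLp.sub_apply, timeDeriv_apply hT hE (fun i => (hEs i).differentiableOn_slab) ht,
      curl_slice ht (hB t ht) (fun i => (hBs i).differentiableOn_slab),
      slab_ampere hT hΦw.smooth hAw hgauge i (mem_slab ht x), PiLp.neg_apply,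
      ← currentDensity_apply hf (mem_slab ht x)]
  · ext i
    rw [hE 0 ht0, slabElectric, hA1, PiLp.neg_apply, gradient_apply,
      ← partialDeriv_slice hΦw.smooth.differentiableOn_slab ht0, funext hΦ0]
    simp
  · ext i
    rw [hB 0 ht0, slabCurl, slabDeriv_spaceDir_initial hT (hAs _) (hA0 _),
      slabDeriv_spaceDir_initial hT (hAs _) (hA0 _)]
    simp
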